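/- Let $N\ge 1$ terminals share a channel that can serve one terminal per time slot. Packets arrive at terminal $n$ as a Poisson process of rate $\lambda_n>0$, independently over terminals, with $\sum_{n=1}^N\lambda_n<1$. There is no packet management: each terminal is an $M/G/1$ queue with infinite buffer and FCFS service, in which the service of a packet starts as soon as it has arrived and the preceding packet has left, and the $k$-th packet of terminal $n$ has service time (scheduling interval) $X_n^{(k)}$. An arrival-independent renewal (AIR) policy is a family of positive random variables $X_n^{(k)}$ that are i.i.d. in $k$ for each $n$, have finite first and second moments, and are jointly independent of the arrivals. It is admissible if almost surely $\limsup_{T\to\infty}\frac1T\sum_{n=1}^N R_n(T)\le 1$, where $R_n(T)=\sup\{r:\sum_{k=1}^r X_n^{(k)}\le T\}$ counts the schedulings of terminal $n$, and all queues are strongly stable, i.e. $\limsup_{T\to\infty}\frac1T\int_0^T\mathbb E[Q_n(t)]\,dt<\infty$ for each $n$, where $Q_n(t)$ is the number of packets of terminal $n$ in the system at time $t$. Intervals may be arbitrary real numbers; no exact conflict-free slot assignment is required. The age of information (AoI) of terminal $n$ is the time since the generation of its last delivered packet (initially, of a status generated at time $0$), the peak AoI $\Lambda_n(k)$ is the AoI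 just before the $k$-th delivery of terminal $n$, and the time-average peak AoI is the almost sure limit $$\lim_{T\to\infty}\frac1N\sum_{n=1}^N\frac1{K_n^{(T)}}\sum_{k=1}^{K_n^{(T)}}\Lambda_n(k),$$ where $K_n^{(T)}$ is the number of deliveries of terminal $n$ up to time $T$. Theorem. The problem P2 $$\text{minimize}\quad \frac1N\sum_{n=1}^N\left[\frac1{\lambda_n}+\frac12\left(\frac1{\beta_n-\lambda_n}+\frac1{\beta_n}\right)\right]\quad\text{s.t.}\quad \beta_n>\lambda_n\ (n=1,\dots,N),\quad \sum_{n=1}^N\beta_n=1,$$ is strictly convex (its feasible set is convex, and its objective is strictly convex on $\{\beta:\beta_n>\lambda_n\ \forall n\}$) and has exactly one solution $\beta^*$. The policy with the deterministic scheduling intervals $X_n^{(k)}=m_n^*=1/\beta_n^*$ (called RR-$\boldsymbol\lambda$) is admissible, and its time-average peak AoI is the minimum of P2. The time-average peak AoI of every admissible AIR policy exists and is at least this value, with equality only if $X_n^{(k)}=1/\beta_n^*$ almost surely for all $n$ and $k$. Hence RR-$\boldsymbol\lambda$ is the unique optimal AIR policy without packet management. -/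

import Mathlib

open MeasureTheory ProbabilityTheory Filter Topology
open scoped ENNReal

noncomputable section

namespace PeakAoI

/-! ### Sample paths of one terminal: an infinite-buffer FCFS single-server queue

`A i` is the time between the generations of packets `i` and `i + 1`, and `X i` is the service time
(scheduling interval) spent on packet `i + 1`.  Packets are numbered `1, 2, …`; index `0` stands for
the initial status, generated and known to the base station at time `0`. -/

/-- Generation (arrival) time of packet `k`. -/
def arrivalTime (A : ℕ → ℝ) (k : ℕ) : ℝ := ∑ i ∈ Finset.range k, A i

/-- Delivery time of packet `k`: the service of packet `k + 1` starts as soon as it has arrived and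
packet `k` has left, and no packet is ever dropped. -/
def deliveryTime (A X : ℕ → ℝ) : ℕ → ℝ
  | 0 => 0
  | k + 1 => max (deliveryTime A X k) (arrivalTime A (k + 1)) + X k

/-- Number of packets in the system (waiting or in service) at time `t`. -/
def queueLength (A X : ℕ → ℝ) (t : ℝ) : ℕ∞ :=
  {k : ℕ | 1 ≤ k ∧ arrivalTime A k ≤ t ∧ t < deliveryTime A X k}.encard

/-- Number of status updates delivered up to time `T`. -/
def numUpdates (A X : ℕ → ℝ) (T : ℝ) : ℕ :=
  {k : ℕ | 1 ≤ k ∧ deliveryTime A X k ≤ T}.ncard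

/-- Age of information at the base station just before time `t`: the time elapsed since the
generation of the last packet delivered strictly before `t` (as the service is FCFS, its index is
the number of packets delivered strictly before `t`). -/
def ageBefore (A X : ℕ → ℝ) (t : ℝ) : ℝ :=
  t - arrivalTime A {k : ℕ | 1 ≤ k ∧ deliveryTime A X k < t}.ncard

/-- Peak age `k`: the age just before the `k`-th update. -/
def peakAge (A X : ℕ → ℝ) (k : ℕ) : ℝ := ageBefore A X (deliveryTime A X k)

/-- Average of the peak ages of the updates delivered up to time `T`. -/
def avgPeakAge (A X : ℕ → ℝ) (T : ℝ) : ℝ :=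
  (1 / (numUpdates A X T : ℝ)) * ∑ k ∈ Finset.Icc 1 (numUpdates A X T), peakAge A X k

/-- Counting process of the scheduling times: `sup {r : X 0 + ⋯ + X (r - 1) ≤ t}`. -/
def numScheduled (X : ℕ → ℝ) (t : ℝ) : ℕ∞ :=
  ⨆ (r : ℕ) (_ : ∑ k ∈ Finset.range r, X k ≤ t), (r : ℕ∞)

/-! ### Random arrivals, policies and the minimization problem -/

section Model

variable {Ω : Type*} [MeasurableSpace Ω] {N : ℕ}

/-- `A n i` are the inter-arrival times of `N` independent Poisson processes with rates `lam n`. -/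
structure IsPoissonArrivals (μ : Measure Ω) (lam : Fin N → ℝ) (A : Fin N → ℕ → Ω → ℝ) : Prop where
  measurable : ∀ n i, Measurable (A n i)
  indep : iIndepFun (fun (p : Fin N × ℕ) => A p.1 p.2) μ
  law : ∀ n i, μ.map (A n i) = expMeasure (lam n)

/-- Arrival-independent renewal (AIR) policies, given by their scheduling intervals `X n k`. For each
terminal the intervals are positive, i.i.d. and have finite first and second moments, and all the
intervals together are independent of all the arrivals.  Intervals of different terminals may depend
on each other. -/
structure IsAIR (μ : Measure Ω) (A X : Fin N → ℕ → Ω → ℝ) : Prop where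
  measurable : ∀ n k, Measurable (X n k)
  pos : ∀ n k, ∀ᵐ ω ∂μ, 0 < X n k ω
  indep : ∀ n, iIndepFun (X n) μ
  identDistrib : ∀ n k, IdentDistrib (X n k) (X n 0) μ μ
  memLp_two : ∀ n, MemLp (X n 0) 2 μ
  arrivalIndep : IndepFun (fun ω (p : Fin N × ℕ) => X p.1 p.2 ω)
    (fun ω (p : Fin N × ℕ) => A p.1 p.2 ω) μ

/-- The shared channel carries at most one scheduled terminal per unit of time (time slot), in the
long run. -/
def RespectsChannel (μ : Measure Ω) (X : Fin N → ℕ → Ω → ℝ) : Prop :=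
  ∀ᵐ ω ∂μ, limsup (fun T : ℝ =>
    (∑ n, (numScheduled (fun k => X n k ω) T : ℝ≥0∞)) / ENNReal.ofReal T) atTop ≤ 1

/-- All queues are strongly stable: the time averages of the mean queue lengths stay bounded. -/
def AllQueuesStable (μ : Measure Ω) (A X : Fin N → ℕ → Ω → ℝ) : Prop :=
  ∀ n, limsup (fun T : ℝ =>
    (∫⁻ t in Set.Ioc 0 T,
      ∫⁻ ω, (queueLength (fun i => A n i ω) (fun k => X n k ω) t : ℝ≥0∞) ∂μ)
      / ENNReal.ofReal T) atTop < ∞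

/-- Policies over which the time-average peak age is minimized. -/
structure IsAdmissible (μ : Measure Ω) (A X : Fin N → ℕ → Ω → ℝ) : Prop where
  air : IsAIR μ A X
  channel : RespectsChannel μ X
  stable : AllQueuesStable μ A X

/-- The time-average peak age of the policy `X` (mean over the terminals) exists almost surely and
is the number `ℓ`. -/
def HasTimeAvgPeakAge (μ : Measure Ω) (A X : Fin N → ℕ → Ω → ℝ) (ℓ : ℝ) : Prop :=
  ∀ᵐ ω ∂μ, Tendsto (fun T : ℝ =>
    (1 / (N : ℝ)) * ∑ n, avgPeakAge (fun i => A n i ω) (fun k => X n k ω) T) atTop (𝓝 ℓ)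

/-- The policy with the deterministic scheduling intervals `1 / β n`. -/
def deterministicPolicy (β : Fin N → ℝ) : Fin N → ℕ → Ω → ℝ := fun n _ _ => 1 / β n

end Model

/-! ### The convex problem P2 -/

/-- Objective function of P2. -/
def objectiveP2 {N : ℕ} (lam β : Fin N → ℝ) : ℝ :=
  (1 / (N : ℝ)) * ∑ n, (1 / lam n + 1 / 2 * (1 / (β n - lam n) + 1 / β n))

/-- Feasible set of P2. -/
def feasibleP2 {N : ℕ} (lam : Fin N → ℝ) : Set (Fin N → ℝ) :=
  {β | (∀ n, lam n < β n) ∧ ∑ n, β n = 1}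

/-- `β` is a solution of P2. -/
def SolvesP2 {N : ℕ} (lam β : Fin N → ℝ) : Prop :=
  β ∈ feasibleP2 lam ∧ IsMinOn (objectiveP2 lam) (feasibleP2 lam) β

end PeakAoI

end

/-! Each terminal is an M/G/1 queue, and its peak age is the sum of an interarrival time, a waiting
time and a service time (`peakAge_succ`). If the intervals have mean `m` and second moment `s`, the
long-run average is `1/λ + s / (2 (1/λ - m)) + m`, where the middle term is the Pollaczek–Khinchine
mean wait. Only the marginal behaviour of each terminal enters, so dependence between terminals is
harmless.

The optimization is then short. Strong stability forces `m < 1/λ`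
(`IsQueue.limsup_queueLength_eq_top`), and the law of large numbers turns the channel constraint
into `∑ 1/m ≤ 1` (`sum_inv_le_one_of_limsup_le`). Since `s ≥ m²`, with equality only for constant
intervals, the cost is at least the objective of P2 at `β = 1/m`. That objective decreases in every
`β n`, so the relaxation `∑ β ≤ 1` changes nothing (`SolvesP2.le_of_sum_le`), and strict convexity
gives uniqueness.

The probabilistic work avoids stationary laws. The waiting times follow the Lindley recursion
started from `0`, hence increase stochastically. Memorylessness of the arrivals yields an exact
recursion for a combination of their first two moments (`integral_sq_waitLaw_succ`). If the service
times have a third moment, all terms stay bounded and the limit of the recursion is the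
Pollaczek–Khinchine formula; truncation removes the third moment (`tendsto_integral_waitLaw`).
Almost sure convergence of the averages comes from comparing the recursion with its restarts on
independent blocks, the error being controlled by a maximal ergodic inequality
(`ae_tendsto_average_lindley`).

For instability at critical load, the mean wait is `O(√n)` by the second moment recursion, yet it
would grow linearly if the wait stayed below a fixed level with probability bounded away from `0`.
Stability of the deterministic policy is a quadratic drift estimate restricted to packets that
arrive before time `T`. -/

namespace PeakAoI

/-! ### Sample paths: the Lindley recursion -/

/-- The Lindley recursion with increments `z`, started from `0`. -/
def lindley (z : ℕ → ℝ) : ℕ → ℝ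
  | 0 => 0
  | k + 1 => max (lindley z k + z k) 0

lemma lindley_nonneg (z : ℕ → ℝ) (k : ℕ) : 0 ≤ lindley z k := by
  cases k with
  | zero => exact le_rfl
  | succ k => exact le_max_right _ _

lemma measurable_lindley (k : ℕ) : Measurable fun z : ℕ → ℝ => lindley z k := by
  induction k with
  | zero => exact measurable_const
  | succ k ih => exact (ih.add (measurable_pi_apply k)).max measurable_const

lemma lindley_congr {z z' : ℕ → ℝ} {k : ℕ} (h : ∀ i < k, z i = z' i) :
    lindley z k = lindley z' k := by
  induction k with
  | zero => rfl
  | succ k ih => simp only [lindley, h k (by omega), ih fun i hi => h i (by omega)]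

/-- The recursion is monotone in its state, so emptying the queue at index `a` can only lower later
values. All comparisons with restarted blocks rest on this. -/
lemma lindley_shift_le (z : ℕ → ℝ) (a n : ℕ) :
    lindley (fun i => z (i + a)) n ≤ lindley z (n + a) := by
  induction n with
  | zero => exact lindley_nonneg _ _
  | succ n ih =>
    rw [show n + 1 + a = (n + a) + 1 by omega]
    exact max_le_max (by linarith) le_rfl

/-- Increments of the Lindley recursion of the waiting times of a queue. -/
def queueIncrement (A X : ℕ → ℝ) (k : ℕ) : ℝ := X k - A (k + 1)

/-- Waiting time of packet `k + 1`. -/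
def waitingTime (A X : ℕ → ℝ) (k : ℕ) : ℝ := lindley (queueIncrement A X) k

lemma waitingTime_nonneg (A X : ℕ → ℝ) (k : ℕ) : 0 ≤ waitingTime A X k := lindley_nonneg _ _

lemma waitingTime_succ (A X : ℕ → ℝ) (k : ℕ) :
    waitingTime A X (k + 1) = max (waitingTime A X k + (X k - A (k + 1))) 0 := rfl

lemma arrivalTime_succ (A : ℕ → ℝ) (k : ℕ) : arrivalTime A (k + 1) = arrivalTime A k + A k :=
  Finset.sum_range_succ _ _

/-- Index `k` of the waiting time belongs to packet `k + 1`, whence the shift in `A (k + 1)`. The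
sign of `A 0` ensures that the first packet finds an idle server. -/
lemma deliveryTime_succ {A : ℕ → ℝ} (X : ℕ → ℝ) (hA : 0 ≤ A 0) (k : ℕ) :
    deliveryTime A X (k + 1) = arrivalTime A (k + 1) + waitingTime A X k + X k := by
  induction k with
  | zero => simp [deliveryTime, waitingTime, lindley, arrivalTime, hA]
  | succ k ih =>
    rw [deliveryTime, ih, waitingTime_succ, arrivalTime_succ A (k + 1)]
    rcases le_total (waitingTime A X k + (X k - A (k + 1))) 0 with h | h
    · rw [max_eq_right h, max_eq_right (by linarith)]; ring
    · rw [max_eq_left h, max_eq_left (by linarith)]; ring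

lemma strictMono_deliveryTime (A : ℕ → ℝ) {X : ℕ → ℝ} (hX : ∀ k, 0 < X k) :
    StrictMono (deliveryTime A X) :=
  strictMono_nat_of_lt_succ fun k => by
    have := le_max_left (deliveryTime A X k) (arrivalTime A (k + 1))
    rw [deliveryTime]
    linarith [hX k]

/-- Deliveries occur in strictly increasing order, so just before delivery `k + 1` the freshest
packet is `k`, generated `A k` before packet `k + 1`. -/
lemma peakAge_succ {A X : ℕ → ℝ} (hA : 0 ≤ A 0) (hX : ∀ k, 0 < X k) (k : ℕ) :
    peakAge A X (k + 1) = A k + waitingTime A X k + X k := by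
  have hset : {j : ℕ | 1 ≤ j ∧ deliveryTime A X j < deliveryTime A X (k + 1)}
      = (Finset.Icc 1 k : Finset ℕ) := by
    ext j
    simp only [Set.mem_ofPred_eq, (strictMono_deliveryTime A hX).lt_iff_lt, Finset.coe_Icc,
      Set.mem_Icc]
    omega
  rw [peakAge, ageBefore, hset, Set.ncard_coe_finset, Nat.card_Icc, deliveryTime_succ X hA,
    show k + 1 - 1 = k by omega, arrivalTime_succ]
  ring

lemma tendsto_numUpdates {A X : ℕ → ℝ} (hX : ∀ k, 0 < X k)
    (hD : Tendsto (deliveryTime A X) atTop atTop) : Tendsto (numUpdates A X) atTop atTop := by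
  refine tendsto_atTop.2 fun n => ?_
  filter_upwards [eventually_ge_atTop (deliveryTime A X n)] with T hT
  obtain ⟨M, hM⟩ := eventually_atTop.1 (hD.eventually_gt_atTop T)
  -- Finiteness is essential here: `Set.ncard` of an infinite set is `0`.
  have hfin : {k : ℕ | 1 ≤ k ∧ deliveryTime A X k ≤ T}.Finite :=
    (Set.finite_lt_nat M).subset fun k hk => by
      by_contra h
      exact absurd (hM k (not_lt.1 h)) (not_lt.2 hk.2)
  have hsub : ((Finset.Icc 1 n : Finset ℕ) : Set ℕ) ⊆ {k : ℕ | 1 ≤ k ∧ deliveryTime A X k ≤ T} := by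
    intro k hk
    rw [Finset.coe_Icc, Set.mem_Icc] at hk
    exact ⟨hk.1, ((strictMono_deliveryTime A hX).monotone hk.2).trans hT⟩
  have := Set.ncard_le_ncard hsub hfin
  rwa [Set.ncard_coe_finset, Nat.card_Icc, show n + 1 - 1 = n by omega] at this

lemma tendsto_deliveryTime {A X : ℕ → ℝ} {m : ℝ} (hm : 0 < m)
    (hX : Tendsto (fun n : ℕ => (∑ i ∈ Finset.range n, X i) / n) atTop (𝓝 m)) :
    Tendsto (deliveryTime A X) atTop atTop := by
  have hle : ∀ n, ∑ i ∈ Finset.range n, X i ≤ deliveryTime A X n := by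
    intro n
    induction n with
    | zero => simp [deliveryTime]
    | succ n ih =>
      rw [Finset.sum_range_succ, deliveryTime]
      linarith [le_max_left (deliveryTime A X n) (arrivalTime A (n + 1))]
  refine tendsto_atTop_mono hle ?_
  refine (hX.pos_mul_atTop hm tendsto_natCast_atTop_atTop).congr' ?_
  filter_upwards [eventually_gt_atTop 0] with n hn
  have : (n : ℝ) ≠ 0 := by positivity
  field_simp

/-- The average peak age converges when the averages of the interarrival, waiting and service times
converge. -/
lemma tendsto_avgPeakAge {A X : ℕ → ℝ} {a w m : ℝ} (hA0 : 0 ≤ A 0) (hX0 : ∀ k, 0 < X k) (hm : 0 < m)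
    (hA : Tendsto (fun n : ℕ => (∑ i ∈ Finset.range n, A i) / n) atTop (𝓝 a))
    (hW : Tendsto (fun n : ℕ => (∑ i ∈ Finset.range n, waitingTime A X i) / n) atTop (𝓝 w))
    (hX : Tendsto (fun n : ℕ => (∑ i ∈ Finset.range n, X i) / n) atTop (𝓝 m)) :
    Tendsto (avgPeakAge A X) atTop (𝓝 (a + w + m)) := by
  have hsum : ∀ n, ∑ k ∈ Finset.Icc 1 n, peakAge A X k
      = ∑ i ∈ Finset.range n, (A i + waitingTime A X i + X i) := by
    intro n
    induction n with
    | zero => simp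
    | succ n ih =>
      rw [Finset.sum_Icc_succ_top (by omega), ih, Finset.sum_range_succ, peakAge_succ hA0 hX0]
  have h := ((hA.add hW).add hX).comp
    (tendsto_numUpdates hX0 (tendsto_deliveryTime (A := A) hm hX))
  refine h.congr fun T => ?_
  simp only [Function.comp, avgPeakAge, hsum, Finset.sum_add_distrib]
  ring

/-! ### The maximal ergodic inequality -/

section MaximalErgodic

variable {Ω : Type*}

/-- The maximum of the first `L + 1` Birkhoff sums of `h` (the empty sum included). -/
def maxBirkhoffSum (T : Ω → Ω) (h : Ω → ℝ) : ℕ → Ω → ℝ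
  | 0 => fun _ => 0
  | L + 1 => fun ω => max 0 (h ω + maxBirkhoffSum T h L (T ω))

lemma maxBirkhoffSum_nonneg (T : Ω → Ω) (h : Ω → ℝ) (L : ℕ) (ω : Ω) :
    0 ≤ maxBirkhoffSum T h L ω := by
  cases L with
  | zero => exact le_rfl
  | succ L => exact le_max_left _ _

lemma maxBirkhoffSum_le_succ (T : Ω → Ω) (h : Ω → ℝ) (L : ℕ) (ω : Ω) :
    maxBirkhoffSum T h L ω ≤ maxBirkhoffSum T h (L + 1) ω := by
  induction L generalizing ω with
  | zero => exact le_max_left _ _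
  | succ L ih => exact max_le_max le_rfl (add_le_add le_rfl (ih _))

lemma birkhoffSum_le_maxBirkhoffSum (T : Ω → Ω) (h : Ω → ℝ) {L n : ℕ} (hn : n ≤ L) (ω : Ω) :
    birkhoffSum T h n ω ≤ maxBirkhoffSum T h L ω := by
  induction L generalizing ω n with
  | zero => simp [Nat.le_zero.1 hn, maxBirkhoffSum]
  | succ L ih =>
    cases n with
    | zero => simpa using maxBirkhoffSum_nonneg _ _ _ _
    | succ n =>
      rw [birkhoffSum_succ']
      exact (add_le_add le_rfl (ih (by omega) _)).trans (le_max_right _ _)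

variable [MeasurableSpace Ω] {μ : Measure Ω}

lemma measurable_maxBirkhoffSum {T : Ω → Ω} {h : Ω → ℝ} (hT : Measurable T) (hh : Measurable h)
    (L : ℕ) : Measurable (maxBirkhoffSum T h L) := by
  induction L with
  | zero => exact measurable_const
  | succ L ih => exact measurable_const.max (hh.add (ih.comp hT))

lemma integrable_maxBirkhoffSum [IsProbabilityMeasure μ] {T : Ω → Ω} {h : Ω → ℝ}
    (hT : MeasurePreserving T μ μ) (hh : Integrable h μ) (L : ℕ) :
    Integrable (maxBirkhoffSum T h L) μ := by
  induction L with
  | zero => exact integrable_const _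
  | succ L ih => exact (integrable_const (0 : ℝ)).sup (hh.add (hT.integrable_comp_of_integrable ih))

/-- Maximal ergodic inequality for a nonnegative function. -/
lemma measure_birkhoffSum_gt_le [IsProbabilityMeasure μ] {T : Ω → Ω} {g : Ω → ℝ}
    (hT : MeasurePreserving T μ μ) (hgm : Measurable g) (hg : Integrable g μ) (hg0 : ∀ ω, 0 ≤ g ω)
    {ε : ℝ} (hε : 0 < ε) (L : ℕ) :
    μ {ω | ∃ n ≤ L, n * ε < birkhoffSum T g n ω} ≤ ENNReal.ofReal ((∫ ω, g ω ∂μ) / ε) := by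
  set h : Ω → ℝ := fun ω => g ω - ε with hh
  have hint : Integrable h μ := hg.sub (integrable_const _)
  have hhm : Measurable h := hgm.sub_const _
  set S := maxBirkhoffSum T h (L + 1) with hS
  have hSm : Measurable S := measurable_maxBirkhoffSum hT.measurable hhm _
  have hSi : Integrable S μ := integrable_maxBirkhoffSum hT hint _
  set E : Set Ω := {ω | 0 < S ω}
  have hE : MeasurableSet E := measurableSet_lt measurable_const hSm
  have hsub : {ω | ∃ n ≤ L, n * ε < birkhoffSum T g n ω} ⊆ E := by
    rintro ω ⟨n, hn, hlt⟩
    have h1 := birkhoffSum_le_maxBirkhoffSum T h (hn.trans (Nat.le_succ L)) ω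
    have h2 : birkhoffSum T h n ω = birkhoffSum T g n ω - n * ε := by
      simp [birkhoffSum, hh, Finset.sum_sub_distrib]
    show 0 < S ω
    rw [h2] at h1
    exact lt_of_lt_of_le (by linarith) h1
  -- Garsia's argument: where `S > 0` its maximum is attained by a nonempty sum, so `S ≤ h + S ∘ T`;
  -- elsewhere `S = 0`. The left side integrates to `0` because `T` preserves the measure, so `h`
  -- has nonnegative integral over `E`.
  have hpt : ∀ ω, S ω - S (T ω) ≤ E.indicator h ω := by
    intro ω
    by_cases hω : ω ∈ E
    · rw [Set.indicator_of_mem hω]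
      have h1 : S ω = h ω + maxBirkhoffSum T h L (T ω) := by
        have h2 : 0 < max 0 (h ω + maxBirkhoffSum T h L (T ω)) := hω
        rcases lt_max_iff.1 h2 with h3 | h3
        · exact absurd h3 (lt_irrefl _)
        · exact max_eq_right h3.le
      have := maxBirkhoffSum_le_succ T h L (T ω)
      linarith
    · rw [Set.indicator_of_notMem hω]
      have h1 : S ω ≤ 0 := not_lt.1 hω
      linarith [maxBirkhoffSum_nonneg T h (L + 1) (T ω)]
  have h0 : 0 ≤ ∫ ω, E.indicator h ω ∂μ := by
    have h1 : ∫ ω, (S ω - S (T ω)) ∂μ = 0 := by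
      rw [integral_sub (g := fun ω => S (T ω)) hSi (hT.integrable_comp_of_integrable hSi)]
      have : ∫ ω, S (T ω) ∂μ = ∫ ω, S ω ∂μ := by
        conv_rhs => rw [← hT.map_eq]
        rw [integral_map hT.measurable.aemeasurable hSm.aestronglyMeasurable]
      linarith
    rw [← h1]
    exact integral_mono (hSi.sub (hT.integrable_comp_of_integrable hSi)) (hint.indicator hE) hpt
  have h2 : ∫ ω, E.indicator h ω ∂μ ≤ ∫ ω, g ω ∂μ - ε * μ.real E := by
    have h3 : ∫ ω, E.indicator (fun _ => ε) ω ∂μ = ε * μ.real E := by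
      rw [integral_indicator_const _ hE, smul_eq_mul, mul_comm]
    rw [← h3, ← integral_sub hg ((integrable_const ε).indicator hE)]
    refine integral_mono (hint.indicator hE) (hg.sub ((integrable_const ε).indicator hE)) fun ω => ?_
    by_cases hω : ω ∈ E
    · simp [hω, hh]
    · simp [hω, hg0 ω]
  refine (measure_mono hsub).trans ?_
  rw [← ofReal_measureReal]
  refine ENNReal.ofReal_le_ofReal ?_
  rw [le_div_iff₀ hε]
  linarith

end MaximalErgodic

/-! ### Independence of functions of disjoint sets of coordinates -/

/-- Each function factors measurably through its finite set of coordinates: the remaining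
coordinates are filled with an arbitrary constant `b`. -/
lemma indepFun_of_dependsOn {Ω ι β γ δ : Type*} [MeasurableSpace Ω] [MeasurableSpace β]
    [MeasurableSpace γ] [MeasurableSpace δ] [Nonempty β]
    {μ : Measure Ω} {f : ι → Ω → β} (hf : iIndepFun f μ) (hm : ∀ i, Measurable (f i))
    {S T : Finset ι} (hST : Disjoint S T) {F : (ι → β) → γ} {G : (ι → β) → δ}
    (hF : Measurable F) (hG : Measurable G) (hFS : DependsOn F S) (hGT : DependsOn G T) :
    IndepFun (fun ω => F fun i => f i ω) (fun ω => G fun i => f i ω) μ := by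
  classical
  obtain ⟨b⟩ := ‹Nonempty β›
  have key : ∀ U : Finset ι, ∃ e : (U → β) → (ι → β), Measurable e ∧
      ∀ x : ι → β, ∀ i ∈ U, e (fun j => x j) i = x i := by
    intro U
    refine ⟨fun u i => if h : i ∈ U then u ⟨i, h⟩ else b, ?_, ?_⟩
    · refine measurable_pi_iff.2 fun i => ?_
      by_cases h : i ∈ U
      · simpa [h] using measurable_pi_apply _
      · simp [h]
    · intro x i hi
      simp [hi]
  obtain ⟨e, he, he'⟩ := key S
  obtain ⟨e₂, he₂, he₂'⟩ := key T
  have h := (hf.indepFun_finset S T hST hm).comp (hF.comp he) (hG.comp he₂)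
  convert h using 2
  · rename_i ω
    exact hFS fun i hi => (he' (fun i => f i ω) i hi).symm
  · rename_i ω
    exact hGT fun i hi => (he₂' (fun i => f i ω) i hi).symm

/-! ### A law of large numbers for the Lindley recursion -/

/-- Shift of a sequence by `a` places. -/
def shiftBy (a : ℕ) (z : ℕ → ℝ) : ℕ → ℝ := fun i => z (i + a)

lemma measurable_shiftBy (a : ℕ) : Measurable (shiftBy a) :=
  measurable_pi_iff.2 fun _ => measurable_pi_apply _

lemma shiftBy_shiftBy (a b : ℕ) (z : ℕ → ℝ) : shiftBy a (shiftBy b z) = shiftBy (a + b) z := by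
  funext i
  simp [shiftBy, add_assoc]

lemma shiftBy_iterate (a n : ℕ) (z : ℕ → ℝ) : (shiftBy a)^[n] z = shiftBy (a * n) z := by
  induction n with
  | zero => funext i; simp [shiftBy]
  | succ n ih => rw [Function.iterate_succ_apply', ih, shiftBy_shiftBy, mul_add_one, add_comm]

lemma measurePreserving_shiftBy (ρ : Measure ℝ) [IsProbabilityMeasure ρ] (a : ℕ) :
    MeasurePreserving (shiftBy a) (Measure.infinitePi fun _ => ρ) (Measure.infinitePi fun _ => ρ) :=
  ⟨measurable_shiftBy a, Measure.map_infinitePi_infinitePi_of_inj (P := fun _ : ℕ => ρ)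
    (add_left_injective a)⟩

/-- Sum of the first `m` terms of the Lindley recursion. -/
def lindleyBlock (m : ℕ) (z : ℕ → ℝ) : ℝ := ∑ i ∈ Finset.range m, lindley z i

lemma measurable_lindleyBlock (m : ℕ) : Measurable (lindleyBlock m) :=
  Finset.measurable_sum _ fun i _ => measurable_lindley i

lemma sum_range_mul_eq {M : Type*} [AddCommMonoid M] (f : ℕ → M) (m n : ℕ) :
    ∑ k ∈ Finset.range (m * n), f k
      = ∑ j ∈ Finset.range n, ∑ i ∈ Finset.range m, f (i + m * j) := by
  induction n with
  | zero => simp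
  | succ n ih =>
    rw [mul_add_one, Finset.sum_range_add, ih, Finset.sum_range_succ]
    simp only [add_comm]

lemma sum_lindleyBlock_le (m n : ℕ) (z : ℕ → ℝ) :
    ∑ j ∈ Finset.range n, lindleyBlock m (shiftBy (m * j) z) ≤ lindleyBlock (m * n) z := by
  rw [lindleyBlock, sum_range_mul_eq]
  exact Finset.sum_le_sum fun j _ => Finset.sum_le_sum fun i _ => lindley_shift_le z (m * j) i

lemma lindleyBlock_mono {m n : ℕ} (h : m ≤ n) (z : ℕ → ℝ) : lindleyBlock m z ≤ lindleyBlock n z :=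
  Finset.sum_le_sum_of_subset_of_nonneg (Finset.range_subset_range.2 h)
    fun i _ _ => lindley_nonneg z i

section LLN

variable {ρ : Measure ℝ} [IsProbabilityMeasure ρ]

local notation "P∞" => Measure.infinitePi (fun _ : ℕ => ρ)

/-- Restarted blocks use disjoint stretches of `m` increments, so they are i.i.d. and the strong law
applies. -/
lemma ae_tendsto_average_lindleyBlock (m : ℕ) (hint : ∀ k, Integrable (fun z => lindley z k) P∞) :
    ∀ᵐ z ∂P∞, Tendsto (fun n : ℕ => (∑ j ∈ Finset.range n, lindleyBlock m (shiftBy (m * j) z)) / n)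
      atTop (𝓝 (∑ i ∈ Finset.range m, ∫ z, lindley z i ∂P∞)) := by
  have hB : Integrable (lindleyBlock m) P∞ := integrable_finsetSum _ fun i _ => hint i
  have h0 : (fun z => lindleyBlock m (shiftBy (m * 0) z)) = lindleyBlock m := by
    funext z
    rfl
  have hlaw := strong_law_ae_real (μ := P∞) (fun j z => lindleyBlock m (shiftBy (m * j) z))
    (by simpa only [h0] using hB) ?_ ?_
  · simp only [h0] at hlaw
    have : ∫ z, lindleyBlock m z ∂P∞ = ∑ i ∈ Finset.range m, ∫ z, lindley z i ∂P∞ :=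
      integral_finsetSum _ fun i _ => hint i
    rwa [this] at hlaw
  · intro j j' hjj
    have hind : iIndepFun (fun (i : ℕ) (z : ℕ → ℝ) => z i) P∞ :=
      iIndepFun_infinitePi (X := fun _ x => x) fun _ => measurable_id
    have hdep : ∀ j, DependsOn (fun z => lindleyBlock m (shiftBy (m * j) z))
        (Finset.Ico (m * j) (m * (j + 1)) : Finset ℕ) := by
      intro j x y hxy
      refine Finset.sum_congr rfl fun i hi => lindley_congr fun l hl => hxy _ ?_
      rw [Finset.mem_range] at hi
      rw [Finset.coe_Ico, Set.mem_Ico, mul_add_one]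
      omega
    refine indepFun_of_dependsOn hind (fun i => measurable_pi_apply i) ?_
      ((measurable_lindleyBlock m).comp (measurable_shiftBy _))
      ((measurable_lindleyBlock m).comp (measurable_shiftBy _)) (hdep j) (hdep j')
    rw [Finset.disjoint_left]
    intro l hl hl'
    rw [Finset.mem_Ico] at hl hl'
    rcases lt_or_gt_of_ne hjj with h | h
    · have := Nat.mul_le_mul_left m (Nat.succ_le_of_lt h)
      simp only [Nat.succ_eq_add_one] at this
      omega
    · have := Nat.mul_le_mul_left m (Nat.succ_le_of_lt h)
      simp only [Nat.succ_eq_add_one] at this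
      omega
  · intro j
    rw [h0]
    have hmp := measurePreserving_shiftBy ρ (m * j)
    refine ⟨((measurable_lindleyBlock m).comp hmp.measurable).aemeasurable,
      (measurable_lindleyBlock m).aemeasurable, ?_⟩
    conv_rhs => rw [← hmp.map_eq, Measure.map_map (measurable_lindleyBlock m) hmp.measurable]
    rfl

lemma integral_comp_shiftBy (f : (ℕ → ℝ) → ℝ) (hf : Measurable f) (a : ℕ) :
    ∫ z, f (shiftBy a z) ∂P∞ = ∫ z, f z ∂P∞ := by
  have hmp := measurePreserving_shiftBy ρ a
  conv_rhs => rw [← hmp.map_eq]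
  rw [integral_map hmp.measurable.aemeasurable hf.aestronglyMeasurable]

/-- By stationarity of the increments, the mean after `k` steps is that of a queue restarted at
index `1`, which lies below the unrestarted one. -/
lemma monotone_integral_lindley (hint : ∀ k, Integrable (fun z => lindley z k) P∞) :
    Monotone fun k => ∫ z, lindley z k ∂P∞ := by
  refine monotone_nat_of_le_succ fun k => ?_
  rw [← integral_comp_shiftBy (fun z => lindley z k) (measurable_lindley k) 1]
  exact integral_mono ((measurePreserving_shiftBy ρ 1).integrable_comp_of_integrable (hint k))
    (hint (k + 1)) fun z => lindley_shift_le z 1 k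

/-- With high probability, the average excess of the Lindley recursion over its restarted blocks
is small at all times. -/
lemma measure_lindleyBlock_excess_le (hint : ∀ k, Integrable (fun z => lindley z k) P∞) {w : ℝ}
    (hw : ∀ k, ∫ z, lindley z k ∂P∞ ≤ w) (m : ℕ) {ε : ℝ} (hε : 0 < ε) :
    P∞ {z | ∃ n : ℕ, ∑ j ∈ Finset.range n, lindleyBlock m (shiftBy (m * j) z) + n * ε
        < lindleyBlock (m * n) z}
      ≤ ENNReal.ofReal ((m * w - ∑ i ∈ Finset.range m, ∫ z, lindley z i ∂P∞) / ε) := by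
  set s : ℕ → Set (ℕ → ℝ) := fun L => {z | ∃ n ≤ L,
    ∑ j ∈ Finset.range n, lindleyBlock m (shiftBy (m * j) z) + n * ε < lindleyBlock (m * n) z}
  have hs : {z | ∃ n : ℕ, ∑ j ∈ Finset.range n, lindleyBlock m (shiftBy (m * j) z) + n * ε
        < lindleyBlock (m * n) z} = ⋃ L, s L := by
    ext z
    simp only [s, Set.mem_ofPred_eq, Set.mem_iUnion]
    exact ⟨fun ⟨n, h⟩ => ⟨n, n, le_rfl, h⟩, fun ⟨_, n, _, h⟩ => ⟨n, h⟩⟩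
  have hmono : Monotone s := fun L L' hL z ⟨n, hn, h⟩ => ⟨n, hn.trans hL, h⟩
  -- The bound does not depend on `L`, so it passes to the increasing union.
  rw [hs, hmono.measure_iUnion]
  refine iSup_le fun L => ?_
  have hsm : MeasurableSet (s L) := by
    have : s L = ⋃ n ∈ Finset.range (L + 1), {z | ∑ j ∈ Finset.range n,
        lindleyBlock m (shiftBy (m * j) z) + n * ε < lindleyBlock (m * n) z} := by
      ext z
      simp [s]
    rw [this]
    refine Finset.measurableSet_biUnion _ fun n _ => measurableSet_lt ?_ (measurable_lindleyBlock _)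
    exact (Finset.measurable_sum _ fun j _ =>
      (measurable_lindleyBlock m).comp (measurable_shiftBy _)).add_const _
  -- The event `s L` is evaluated on the path shifted by `m * L`, which leaves room for a longer
  -- past. `g` is the excess over a restarted block when the queue has run for `m * L` steps before
  -- it. Its iterates along `shiftBy m` dominate the excesses of all blocks `j < n ≤ L`, so the
  -- maximal ergodic inequality applies to the single function `g`.
  set g : (ℕ → ℝ) → ℝ := fun z =>
    ∑ i ∈ Finset.range m, (lindley z (i + m * L) - lindley (shiftBy (m * L) z) i) with hg
  have hgm : Measurable g := Finset.measurable_sum _ fun i _ =>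
    (measurable_lindley _).sub ((measurable_lindley i).comp (measurable_shiftBy _))
  have hi2 : ∀ i, Integrable (fun z => lindley (shiftBy (m * L) z) i) P∞ := fun i =>
    (measurePreserving_shiftBy ρ (m * L)).integrable_comp_of_integrable (hint i)
  have hgi : Integrable g P∞ := integrable_finsetSum _ fun i _ => (hint _).sub (hi2 i)
  have hg0 : ∀ z, 0 ≤ g z := fun z =>
    Finset.sum_nonneg fun i _ => sub_nonneg.2 (lindley_shift_le z (m * L) i)
  have hgint : ∫ z, g z ∂P∞ ≤ m * w - ∑ i ∈ Finset.range m, ∫ z, lindley z i ∂P∞ := by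
    have hsum : ∫ z, g z ∂P∞ = ∑ i ∈ Finset.range m,
        ∫ z, (lindley z (i + m * L) - lindley (shiftBy (m * L) z) i) ∂P∞ :=
      integral_finsetSum _ fun i _ => (hint _).sub (hi2 i)
    rw [hsum]
    have : (m : ℝ) * w = ∑ i ∈ Finset.range m, w := by simp
    rw [this, ← Finset.sum_sub_distrib]
    refine Finset.sum_le_sum fun i _ => ?_
    rw [integral_sub (hint _) (hi2 i),
      integral_comp_shiftBy (fun z => lindley z i) (measurable_lindley i)]
    linarith [hw (i + m * L)]
  have hmp := measurePreserving_shiftBy ρ (m * L)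
  rw [← hmp.measure_preimage hsm.nullMeasurableSet]
  refine (measure_mono ?_).trans ((measure_birkhoffSum_gt_le (measurePreserving_shiftBy ρ m)
    hgm hgi hg0 hε L).trans (ENNReal.ofReal_le_ofReal (div_le_div_of_nonneg_right hgint hε.le)))
  rintro z ⟨n, hn, hlt⟩
  refine ⟨n, hn, ?_⟩
  rw [lindleyBlock, sum_range_mul_eq] at hlt
  have hle : ∑ j ∈ Finset.range n, ∑ i ∈ Finset.range m, lindley (shiftBy (m * L) z) (i + m * j)
      - ∑ j ∈ Finset.range n, lindleyBlock m (shiftBy (m * j) (shiftBy (m * L) z))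
      ≤ birkhoffSum (shiftBy m) g n z := by
    rw [← Finset.sum_sub_distrib, birkhoffSum]
    refine Finset.sum_le_sum fun j hj => ?_
    rw [shiftBy_iterate, lindleyBlock, ← Finset.sum_sub_distrib]
    refine Finset.sum_le_sum fun i _ => ?_
    rw [shiftBy_shiftBy, shiftBy_shiftBy, add_comm (m * j) (m * L)]
    refine sub_le_sub_right ?_ _
    have hjL : j ≤ L := (Finset.mem_range.1 hj).le.trans hn
    obtain ⟨d, rfl⟩ := Nat.exists_eq_add_of_le hjL
    -- Both recursions end at the same index; the one started at `m * j` starts no later than the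
    -- one started at `m * L`, since `j ≤ L`, and is therefore larger.
    have h1 := lindley_shift_le (shiftBy (m * j) z) (m * d) (i + m * j)
    have h2 : (fun l => shiftBy (m * j) z (l + m * d)) = shiftBy (m * (j + d)) z := by
      funext l
      simp only [shiftBy]
      congr 1
      ring
    rw [h2] at h1
    rwa [show i + m * (j + d) = i + m * j + m * d by ring]
  linarith

/-- For every block length `m`, the failure probability is at most the gap between `w` and the
Cesàro mean of the first `m` expectations, divided by `ε`; this tends to `0` as `m` grows. The three
`ε` pay for the excess over restarted blocks, the law of large numbers for blocks, and the
incomplete last block. -/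
lemma ae_eventually_lindleyBlock_le (hint : ∀ k, Integrable (fun z => lindley z k) P∞) {w : ℝ}
    (hw : Tendsto (fun k => ∫ z, lindley z k ∂P∞) atTop (𝓝 w)) {ε : ℝ} (hε : 0 < ε) :
    ∀ᵐ z ∂P∞, ∀ᶠ n : ℕ in atTop, lindleyBlock n z ≤ n * (w + 3 * ε) := by
  have hle : ∀ k, ∫ z, lindley z k ∂P∞ ≤ w := (monotone_integral_lindley hint).ge_of_tendsto hw
  have hw0 : 0 ≤ w := (integral_nonneg fun z => lindley_nonneg z 0).trans (hle 0)
  set b : ℕ → ℝ := fun m => ∑ i ∈ Finset.range m, ∫ z, lindley z i ∂P∞ with hb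
  have hbound : ∀ m : ℕ, 0 < m → P∞ {z | ¬ ∀ᶠ n : ℕ in atTop, lindleyBlock n z ≤ n * (w + 3 * ε)}
      ≤ ENNReal.ofReal ((w - (m : ℝ)⁻¹ * b m) / ε) := by
    intro m hm
    have hm' : (0 : ℝ) < m := Nat.cast_pos.2 hm
    have h1 := measure_lindleyBlock_excess_le hint hle m (mul_pos hm' hε)
    have h2 : (m * w - ∑ i ∈ Finset.range m, ∫ z, lindley z i ∂P∞) / (m * ε)
        = (w - (m : ℝ)⁻¹ * b m) / ε := by
      rw [hb]
      field_simp
    rw [h2] at h1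
    refine le_trans ?_ h1
    refine measure_mono_ae ?_
    filter_upwards [ae_tendsto_average_lindleyBlock m hint] with z hz hnot
    by_contra hgood
    apply hnot
    have hgood' : ∀ n : ℕ, lindleyBlock (m * n) z
        ≤ ∑ j ∈ Finset.range n, lindleyBlock m (shiftBy (m * j) z) + n * (m * ε) := fun n =>
      not_lt.1 fun h => hgood ⟨n, h⟩
    have hbm : b m < m * w + m * ε := by
      have : b m ≤ ∑ i ∈ Finset.range m, w := Finset.sum_le_sum fun i _ => hle i
      simp only [Finset.sum_const, Finset.card_range, nsmul_eq_mul] at this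
      have := mul_pos hm' hε
      linarith
    obtain ⟨n₀, hn₀⟩ := eventually_atTop.1 (hz.eventually_lt_const hbm)
    obtain ⟨n₁, hn₁⟩ := exists_nat_gt (m * (w + 2 * ε) / ε)
    filter_upwards [eventually_ge_atTop (m * (n₀ + 1)), eventually_ge_atTop n₁] with N hN hN1
    set n := N / m + 1
    have hq : n₀ ≤ n := by
      have : n₀ + 1 ≤ N / m := (Nat.le_div_iff_mul_le hm).2 (by rw [mul_comm]; exact hN)
      omega
    have hNn : N ≤ m * n := by
      have := Nat.lt_mul_div_succ N hm
      exact this.le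
    have hnN : m * n ≤ N + m := by
      have := Nat.mul_div_le N m
      rw [show m * n = m * (N / m) + m by rw [← mul_add_one]]
      omega
    have hnpos : (0 : ℝ) < n := by positivity
    have h3 := (div_lt_iff₀ hnpos).1 (hn₀ n hq)
    have h4 := hgood' n
    have h5 := lindleyBlock_mono hNn z
    have h6 : ((m * n : ℕ) : ℝ) ≤ N + m := by exact_mod_cast hnN
    push_cast at h6
    have h7 : (m * (w + 2 * ε)) < N * ε := by
      rw [div_lt_iff₀ hε] at hn₁
      have : (n₁ : ℝ) ≤ N := by exact_mod_cast hN1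
      nlinarith
    have h8 : (m * n : ℝ) * (w + 2 * ε) ≤ (N + m) * (w + 2 * ε) :=
      mul_le_mul_of_nonneg_right h6 (by positivity)
    nlinarith
  have hces : Tendsto (fun m : ℕ => ENNReal.ofReal ((w - (m : ℝ)⁻¹ * b m) / ε)) atTop (𝓝 0) := by
    have h1 : Tendsto (fun m : ℕ => (w - (m : ℝ)⁻¹ * b m) / ε) atTop (𝓝 ((w - w) / ε)) :=
      (tendsto_const_nhds.sub hw.cesaro).div_const _
    rw [sub_self, zero_div] at h1
    simpa using ENNReal.tendsto_ofReal h1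
  refine le_antisymm (ge_of_tendsto hces ?_) bot_le
  filter_upwards [eventually_gt_atTop 0] with m hm using hbound m hm

/-- Restarting only lowers the sum, so one block length whose Cesàro mean exceeds `w - ε` suffices.
The other two `ε` pay for the law of large numbers and for the incomplete last block. -/
lemma ae_eventually_le_lindleyBlock (hint : ∀ k, Integrable (fun z => lindley z k) P∞) {w : ℝ}
    (hw : Tendsto (fun k => ∫ z, lindley z k ∂P∞) atTop (𝓝 w)) {ε : ℝ} (hε : 0 < ε) :
    ∀ᵐ z ∂P∞, ∀ᶠ n : ℕ in atTop, n * (w - 3 * ε) ≤ lindleyBlock n z := by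
  obtain ⟨m, hbm, hm⟩ : ∃ m : ℕ, w - ε < (m : ℝ)⁻¹ * ∑ i ∈ Finset.range m, ∫ z, lindley z i ∂P∞
      ∧ 0 < m := ((hw.cesaro.eventually_const_lt (sub_lt_self w hε)).and
        (eventually_gt_atTop 0)).exists
  have hm' : (0 : ℝ) < m := Nat.cast_pos.2 hm
  filter_upwards [ae_tendsto_average_lindleyBlock m hint] with z hz
  rcases le_total (w - 2 * ε) 0 with h0 | h0
  · refine Eventually.of_forall fun n => ?_
    refine le_trans ?_ (Finset.sum_nonneg fun i _ => lindley_nonneg z i)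
    exact mul_nonpos_of_nonneg_of_nonpos (Nat.cast_nonneg n) (by linarith)
  have hb : m * (w - 2 * ε) < ∑ i ∈ Finset.range m, ∫ z, lindley z i ∂P∞ := by
    have h1 : m * (w - ε) < ∑ i ∈ Finset.range m, ∫ z, lindley z i ∂P∞ := by
      have := mul_lt_mul_of_pos_left hbm hm'
      rwa [mul_inv_cancel_left₀ hm'.ne'] at this
    nlinarith [mul_pos hm' hε]
  obtain ⟨n₀, hn₀⟩ := eventually_atTop.1 (hz.eventually_const_lt hb)
  obtain ⟨n₁, hn₁⟩ := exists_nat_gt (m * (w - 2 * ε) / ε)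
  filter_upwards [eventually_ge_atTop (m * (n₀ + 1)), eventually_ge_atTop n₁] with N hN hN1
  set n := N / m
  have hq : n₀ + 1 ≤ n := (Nat.le_div_iff_mul_le hm).2 (by rw [mul_comm]; exact hN)
  have hNn : m * n ≤ N := Nat.mul_div_le N m
  have hnN : N ≤ m * n + m := (Nat.lt_mul_div_succ N hm).le
  have hnpos : (0 : ℝ) < n := by
    have : 0 < n := by omega
    exact_mod_cast this
  have h3 := (lt_div_iff₀ hnpos).1 (hn₀ n (by omega))
  have h4 := sum_lindleyBlock_le m n z
  have h5 := lindleyBlock_mono hNn z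
  have h6 : (N : ℝ) ≤ m * n + m := by exact_mod_cast hnN
  have h7 : (m * (w - 2 * ε)) < N * ε := by
    rw [div_lt_iff₀ hε] at hn₁
    have : (n₁ : ℝ) ≤ N := by exact_mod_cast hN1
    nlinarith
  have h8 : (N : ℝ) * (w - 2 * ε) ≤ (m * n + m) * (w - 2 * ε) :=
    mul_le_mul_of_nonneg_right h6 h0
  nlinarith

/-- Law of large numbers for the Lindley recursion with i.i.d. increments. -/
theorem ae_tendsto_average_lindley (hint : ∀ k, Integrable (fun z => lindley z k) P∞) {w : ℝ}
    (hw : Tendsto (fun k => ∫ z, lindley z k ∂P∞) atTop (𝓝 w)) :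
    ∀ᵐ z ∂P∞, Tendsto (fun n : ℕ => (∑ k ∈ Finset.range n, lindley z k) / n) atTop (𝓝 w) := by
  have hpos : ∀ q : ℕ, (0 : ℝ) < 1 / (q + 1) := fun q => Nat.one_div_pos_of_nat
  have h1 := ae_all_iff.2 fun q => ae_eventually_lindleyBlock_le hint hw (hpos q)
  have h2 := ae_all_iff.2 fun q => ae_eventually_le_lindleyBlock hint hw (hpos q)
  filter_upwards [h1, h2] with z hz1 hz2
  rw [Metric.tendsto_nhds]
  intro δ hδ
  obtain ⟨q, hq⟩ := exists_nat_one_div_lt (show 0 < δ / 3 by positivity)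
  filter_upwards [hz1 q, hz2 q, eventually_gt_atTop 0] with n hn1 hn2 hn
  have hn' : (0 : ℝ) < n := Nat.cast_pos.2 hn
  have h3 : (∑ k ∈ Finset.range n, lindley z k) / n ≤ w + 3 * (1 / (q + 1)) := by
    rw [div_le_iff₀ hn', mul_comm]; exact hn1
  have h4 : w - 3 * (1 / (q + 1)) ≤ (∑ k ∈ Finset.range n, lindley z k) / n := by
    rw [le_div_iff₀ hn', mul_comm]; exact hn2
  rw [Real.dist_eq, abs_lt]
  constructor <;> linarith

end LLN

/-! ### Moments of the exponential distribution -/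

lemma toReal_exponentialPDF {r : ℝ} (hr : 0 < r) (x : ℝ) :
    (exponentialPDF r x).toReal = if 0 ≤ x then r * Real.exp (-(r * x)) else 0 := by
  rw [exponentialPDF_eq, ENNReal.toReal_ofReal]
  split_ifs <;> positivity

lemma integral_expMeasure {r : ℝ} (hr : 0 < r) (f : ℝ → ℝ) :
    ∫ x, f x ∂(expMeasure r)
      = ∫ x, (Set.Ioi (0 : ℝ)).indicator (fun x => r * Real.exp (-(r * x)) * f x) x := by
  have h1 : ∫ x, f x ∂(expMeasure r)
      = ∫ x, (exponentialPDF r x).toReal • f x :=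
    integral_withDensity_eq_integral_toReal_smul
      (measurable_exponentialPDFReal r).ennreal_ofReal
      (Eventually.of_forall fun _ => ENNReal.ofReal_lt_top) f
  rw [h1]
  refine integral_congr_ae ?_
  have h0 : ∀ᵐ x : ℝ, x ≠ 0 := by simp [ae_iff]
  filter_upwards [h0] with x hx
  rw [toReal_exponentialPDF hr]
  by_cases h : 0 < x
  · simp [h, h.le]
  · have : ¬ 0 ≤ x := fun h' => h (lt_of_le_of_ne h' (Ne.symm hx))
    simp [h, this]

lemma ae_expMeasure_nonneg {r : ℝ} : ∀ᵐ x ∂(expMeasure r), 0 ≤ x := by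
  have : ∀ᵐ x ∂((volume : Measure ℝ).withDensity (exponentialPDF r)), 0 ≤ x := by
    rw [ae_withDensity_iff (show Measurable (exponentialPDF r) from
      (measurable_exponentialPDFReal r).ennreal_ofReal)]
    refine Eventually.of_forall fun x hx => ?_
    by_contra h
    exact hx (exponentialPDF_of_neg (not_le.1 h))
  exact this

lemma integral_pow_expMeasure {r : ℝ} (hr : 0 < r) (p : ℕ) :
    ∫ x, x ^ p ∂(expMeasure r) = p.factorial / r ^ p := by
  rw [integral_expMeasure hr, integral_indicator measurableSet_Ioi]
  have h := Real.integral_rpow_mul_exp_neg_mul_Ioi (a := p + 1) (r := r) (by positivity) hr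
  rw [Real.Gamma_nat_eq_factorial] at h
  have h2 : ∫ x in Set.Ioi (0 : ℝ), r * Real.exp (-(r * x)) * x ^ p
      = r * ∫ x in Set.Ioi (0 : ℝ), x ^ ((p + 1 : ℝ) - 1) * Real.exp (-(r * x)) := by
    rw [← integral_const_mul]
    refine setIntegral_congr_fun measurableSet_Ioi fun x _ => ?_
    simp only [add_sub_cancel_right, Real.rpow_natCast]
    ring
  rw [h2, h, Real.rpow_add_one (by positivity), Real.rpow_natCast]
  rw [one_div, inv_pow]
  field_simp

/-- A non-integrable function has Bochner integral `0`, but the computed moment is positive. -/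
lemma integrable_pow_expMeasure {r : ℝ} (hr : 0 < r) (p : ℕ) :
    Integrable (fun x : ℝ => x ^ p) (expMeasure r) := by
  by_contra h
  have h1 := integral_undef h
  rw [integral_pow_expMeasure hr] at h1
  have : (0 : ℝ) < p.factorial / r ^ p := by positivity
  linarith

lemma memLp_id_expMeasure {r : ℝ} (hr : 0 < r) (p : ℕ) : MemLp (fun x : ℝ => x) p (expMeasure r) := by
  rcases eq_or_ne p 0 with rfl | hp
  · rw [Nat.cast_zero, memLp_zero_iff_aestronglyMeasurable]
    exact measurable_id.aestronglyMeasurable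
  · rw [← integrable_norm_rpow_iff (f := fun x : ℝ => x) (p := (p : ℝ≥0∞))
      measurable_id.aestronglyMeasurable (by exact_mod_cast hp) (by simp)]
    simpa using (integrable_pow_expMeasure hr p).norm

/-- Memorylessness: moments of the excess over a level. -/
lemma integral_excess_pow_expMeasure {r : ℝ} (hr : 0 < r) {u : ℝ} (hu : 0 ≤ u) {p : ℕ}
    (hp : p ≠ 0) : ∫ x, (max (x - u) 0) ^ p ∂(expMeasure r)
      = Real.exp (-(r * u)) * (p.factorial / r ^ p) := by
  rw [← integral_pow_expMeasure hr p, integral_expMeasure hr, integral_expMeasure hr,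
    ← integral_const_mul, ← integral_sub_right_eq_self (fun x => Real.exp (-(r * u)) * _) u]
  congr 1
  funext x
  by_cases h : u < x
  · have h0 : 0 < x := hu.trans_lt h
    rw [Set.indicator_of_mem (Set.mem_Ioi.2 h0), Set.indicator_of_mem (Set.mem_Ioi.2 (sub_pos.2 h)),
      max_eq_left (sub_pos.2 h).le, show -(r * x) = -(r * u) + -(r * (x - u)) by ring, Real.exp_add]
    ring
  · have h1 : x - u ≤ 0 := by linarith
    rw [Set.indicator_of_notMem (s := Set.Ioi 0) (a := x - u) (by simpa using h1), mul_zero]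
    refine Set.indicator_apply_eq_zero.2 fun _ => ?_
    rw [max_eq_right h1, zero_pow hp, mul_zero]

/-! ### Stochastic order -/

/-- Stochastic domination of measures on the line. -/
def StochLE (ν ν' : Measure ℝ) : Prop :=
  ∀ f : ℝ → ℝ≥0∞, Monotone f → ∫⁻ x, f x ∂ν ≤ ∫⁻ x, f x ∂ν'

lemma StochLE.refl (ν : Measure ℝ) : StochLE ν ν := fun _ _ => le_rfl

lemma stochLE_map {σ : Measure ℝ} {f g : ℝ → ℝ} (hf : Measurable f) (hg : Measurable g)
    (h : ∀ᵐ x ∂σ, f x ≤ g x) : StochLE (σ.map f) (σ.map g) := by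
  intro F hF
  rw [lintegral_map hF.measurable hf, lintegral_map hF.measurable hg]
  refine lintegral_mono_ae ?_
  filter_upwards [h] with x hx using hF hx

lemma StochLE.measure_Iic_ge {ν ν' : Measure ℝ} [IsProbabilityMeasure ν] [IsProbabilityMeasure ν']
    (h : StochLE ν ν') (L : ℝ) : ν' (Set.Iic L) ≤ ν (Set.Iic L) := by
  have hmono : Monotone ((Set.Ioi L).indicator (1 : ℝ → ℝ≥0∞)) := by
    intro x y hxy
    by_cases hx : x ∈ Set.Ioi L
    · have hy : y ∈ Set.Ioi L := lt_of_lt_of_le hx hxy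
      rw [Set.indicator_of_mem hx, Set.indicator_of_mem hy]
      exact le_rfl
    · rw [Set.indicator_of_notMem hx]
      exact bot_le
  have h1 := h _ hmono
  rw [lintegral_indicator_one measurableSet_Ioi, lintegral_indicator_one measurableSet_Ioi,
    ← Set.compl_Iic, prob_compl_eq_one_sub measurableSet_Iic,
    prob_compl_eq_one_sub measurableSet_Iic] at h1
  exact (ENNReal.sub_le_sub_iff_left prob_le_one ENNReal.one_ne_top).1 h1

lemma StochLE.integral_pow_le {ν ν' : Measure ℝ} (h : StochLE ν ν') (h0 : ∀ᵐ x ∂ν, 0 ≤ x)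
    (h0' : ∀ᵐ x ∂ν', 0 ≤ x) {p : ℕ} (hp : Integrable (fun x => x ^ p) ν') :
    ∫ x, x ^ p ∂ν ≤ ∫ x, x ^ p ∂ν' := by
  have hnn : ∀ {ν : Measure ℝ}, (∀ᵐ x ∂ν, 0 ≤ x) → 0 ≤ᵐ[ν] fun x => x ^ p := fun h => by
    filter_upwards [h] with x hx using pow_nonneg hx p
  rw [integral_eq_lintegral_of_nonneg_ae (hnn h0) (by fun_prop),
    integral_eq_lintegral_of_nonneg_ae (hnn h0') (by fun_prop)]
  refine ENNReal.toReal_mono hp.lintegral_lt_top.ne ?_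
  -- Test functions must be monotone on the whole line, hence the positive part, which changes
  -- nothing almost everywhere.
  have hmono : Monotone fun x : ℝ => ENNReal.ofReal (max x 0 ^ p) := fun x y hxy =>
    ENNReal.ofReal_le_ofReal (pow_le_pow_left₀ (le_max_right _ _) (max_le_max hxy le_rfl) p)
  have hc : ∀ {ν : Measure ℝ}, (∀ᵐ x ∂ν, 0 ≤ x) →
      ∫⁻ x, ENNReal.ofReal (x ^ p) ∂ν = ∫⁻ x, ENNReal.ofReal (max x 0 ^ p) ∂ν := fun h =>
    lintegral_congr_ae (by filter_upwards [h] with x hx; rw [max_eq_left hx])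
  rw [hc h0, hc h0']
  exact h _ hmono

lemma stochLE_dirac_zero {ν : Measure ℝ} [IsProbabilityMeasure ν] (h0 : ∀ᵐ x ∂ν, 0 ≤ x) :
    StochLE (Measure.dirac 0) ν := by
  intro f hf
  rw [lintegral_dirac' _ hf.measurable]
  calc f 0 = ∫⁻ _, f 0 ∂ν := by simp
    _ ≤ ∫⁻ x, f x ∂ν := lintegral_mono_ae (by filter_upwards [h0] with x hx using hf hx)

/-- Image of a product measure under a map monotone in both variables. -/
lemma StochLE.map_prod {ν ν' σ σ' : Measure ℝ} [SFinite ν] [SFinite ν'] [SFinite σ] [SFinite σ']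
    {φ : ℝ × ℝ → ℝ} (hφ : Measurable φ) (h1 : ∀ y, Monotone fun x => φ (x, y))
    (h2 : ∀ x, Monotone fun y => φ (x, y)) (hν : StochLE ν ν') (hσ : StochLE σ σ') :
    StochLE ((ν.prod σ).map φ) ((ν'.prod σ').map φ) := by
  intro f hf
  have hm : Measurable fun p => f (φ p) := hf.measurable.comp hφ
  rw [lintegral_map hf.measurable hφ, lintegral_map hf.measurable hφ, lintegral_prod _ hm.aemeasurable,
    lintegral_prod _ hm.aemeasurable]
  calc ∫⁻ x, ∫⁻ y, f (φ (x, y)) ∂σ ∂ν ≤ ∫⁻ x, ∫⁻ y, f (φ (x, y)) ∂σ' ∂ν :=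
        lintegral_mono fun x => hσ _ fun y y' h => hf (h2 x h)
    _ ≤ ∫⁻ x, ∫⁻ y, f (φ (x, y)) ∂σ' ∂ν' := hν _ fun x x' h =>
        lintegral_mono fun y => hf (h1 y h)

/-! ### Laws of the waiting times -/

/-- Law of the waiting time of the next packet, when `U` is the law of the system time of a packet
and `e` is the law of the interarrival time. -/
noncomputable def nextWait (e U : Measure ℝ) : Measure ℝ :=
  (U.prod e).map fun p => max (p.1 - p.2) 0

/-- Law of the sum of a waiting time with law `ν` and an independent service time with law `σ`. -/
noncomputable def systemLaw (σ ν : Measure ℝ) : Measure ℝ :=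
  (ν.prod σ).map fun p => p.1 + p.2

/-- Laws of the successive waiting times of a queue, started empty. -/
noncomputable def waitLaw (e σ : Measure ℝ) : ℕ → Measure ℝ
  | 0 => Measure.dirac 0
  | k + 1 => nextWait e (systemLaw σ (waitLaw e σ k))

section Laws

variable {e σ σ' ν ν' U U' : Measure ℝ}

lemma measurable_nextWait_fun : Measurable fun p : ℝ × ℝ => max (p.1 - p.2) 0 := by fun_prop

lemma ae_nextWait_nonneg : ∀ᵐ x ∂(nextWait e U), 0 ≤ x := by
  rw [nextWait, ae_map_iff measurable_nextWait_fun.aemeasurable measurableSet_Ici]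
  exact Eventually.of_forall fun p => le_max_right _ _

lemma ae_systemLaw_nonneg (hν : ∀ᵐ x ∂ν, 0 ≤ x) (hσ : ∀ᵐ x ∂σ, 0 ≤ x) :
    ∀ᵐ x ∂(systemLaw σ ν), 0 ≤ x := by
  rw [systemLaw, ae_map_iff (by fun_prop) measurableSet_Ici]
  filter_upwards [Measure.quasiMeasurePreserving_fst.ae hν,
    Measure.quasiMeasurePreserving_snd.ae hσ] with p h1 h2 using add_nonneg h1 h2

lemma ae_waitLaw_nonneg (k : ℕ) : ∀ᵐ x ∂(waitLaw e σ k), 0 ≤ x := by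
  cases k with
  | zero => exact (ae_dirac_iff measurableSet_Ici).2 le_rfl
  | succ k => exact ae_nextWait_nonneg

lemma StochLE.nextWait [SFinite e] (hU : StochLE U U') : StochLE (nextWait e U) (nextWait e U') := by
  intro f hf
  have hm : Measurable fun p : ℝ × ℝ => f (max (p.1 - p.2) 0) :=
    hf.measurable.comp measurable_nextWait_fun
  rw [PeakAoI.nextWait, PeakAoI.nextWait, lintegral_map hf.measurable measurable_nextWait_fun,
    lintegral_map hf.measurable measurable_nextWait_fun, lintegral_prod _ hm.aemeasurable,
    lintegral_prod _ hm.aemeasurable]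
  exact hU _ fun x x' h => lintegral_mono fun y => hf (max_le_max (sub_le_sub_right h _) le_rfl)

variable [IsProbabilityMeasure e] [IsProbabilityMeasure σ]
  [IsProbabilityMeasure σ'] [IsProbabilityMeasure ν] [IsProbabilityMeasure ν']
  [IsProbabilityMeasure U] [IsProbabilityMeasure U']

instance : IsProbabilityMeasure (nextWait e U) :=
  Measure.isProbabilityMeasure_map measurable_nextWait_fun.aemeasurable

instance : IsProbabilityMeasure (systemLaw σ ν) :=
  Measure.isProbabilityMeasure_map (by fun_prop)

instance (k : ℕ) : IsProbabilityMeasure (waitLaw e σ k) := by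
  induction k with
  | zero => exact Measure.dirac.isProbabilityMeasure
  | succ k ih => exact inferInstanceAs (IsProbabilityMeasure (nextWait e _))

lemma StochLE.systemLaw (hσ : StochLE σ σ') (hν : StochLE ν ν') :
    StochLE (systemLaw σ ν) (systemLaw σ' ν') :=
  hν.map_prod (by fun_prop) (fun _ _ _ h => add_le_add h le_rfl)
    (fun _ _ _ h => add_le_add le_rfl h) hσ

lemma StochLE.waitLaw (hσ : StochLE σ σ') (k : ℕ) : StochLE (waitLaw e σ k) (waitLaw e σ' k) := by
  induction k with
  | zero => exact StochLE.refl _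
  | succ k ih => exact (hσ.systemLaw ih).nextWait

/-- The queue starts empty, the least possible state, and the transition preserves the stochastic
order. -/
lemma stochLE_waitLaw_succ (k : ℕ) : StochLE (waitLaw e σ k) (waitLaw e σ (k + 1)) := by
  induction k with
  | zero => exact stochLE_dirac_zero (ae_waitLaw_nonneg 1)
  | succ k ih => exact ((StochLE.refl σ).systemLaw ih).nextWait

/-! ### Moments of the waiting times -/

lemma memLp_systemLaw {p : ℝ≥0∞} (hν : MemLp (fun x => x) p ν) (hσ : MemLp (fun x => x) p σ) :
    MemLp (fun x => x) p (systemLaw σ ν) := by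
  rw [systemLaw, memLp_map_measure_iff (by fun_prop) (by fun_prop)]
  exact (hν.comp_fst σ).add (hσ.comp_snd ν)

lemma memLp_nextWait {p : ℝ≥0∞} (hU : MemLp (fun x => x) p U) (he : MemLp (fun x => x) p e) :
    MemLp (fun x => x) p (nextWait e U) := by
  rw [nextWait, memLp_map_measure_iff (by fun_prop) (by fun_prop)]
  refine ((hU.comp_fst e).sub (he.comp_snd U)).of_le (by fun_prop) (Eventually.of_forall fun p => ?_)
  simp only [Function.comp, Pi.sub_apply, Real.norm_eq_abs]
  rw [abs_of_nonneg (le_max_right _ _)]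
  exact max_le (le_abs_self _) (abs_nonneg _)

lemma memLp_waitLaw {p : ℝ≥0∞} (hσ : MemLp (fun x => x) p σ) (he : MemLp (fun x => x) p e) (k : ℕ) :
    MemLp (fun x => x) p (waitLaw e σ k) := by
  induction k with
  | zero =>
    have : (fun x : ℝ => x) =ᵐ[Measure.dirac 0] fun _ => 0 :=
      (ae_dirac_iff (measurableSet_singleton (0 : ℝ))).2 rfl
    exact (memLp_congr_ae this).2 MemLp.zero
  | succ k ih => exact memLp_nextWait (memLp_systemLaw ih hσ) he

end Laws

section Moments

variable {e σ ν U : Measure ℝ} [IsProbabilityMeasure e] [IsProbabilityMeasure σ]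
  [IsProbabilityMeasure ν] [IsProbabilityMeasure U]

lemma integrable_pow_of_memLp {n : ℕ} (h : MemLp (fun x : ℝ => x) n ν) {i : ℕ} (hi : i ≤ n) :
    Integrable (fun x => x ^ i) ν := by
  have h1 : MemLp (fun x : ℝ => x) i ν := h.mono_exponent (by exact_mod_cast hi)
  refine (integrable_norm_iff (by fun_prop)).1 ?_
  simpa [norm_pow] using h1.integrable_norm_pow'

/-- Used with `c = 1` for system times and `c = -1` for system time minus interarrival time. -/
lemma integral_add_mul_pow_prod {n : ℕ} (hν : MemLp (fun x : ℝ => x) n ν)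
    (hσ : MemLp (fun x : ℝ => x) n σ) (c : ℝ) :
    Integrable (fun p : ℝ × ℝ => (p.1 + c * p.2) ^ n) (ν.prod σ) ∧
    ∫ p : ℝ × ℝ, (p.1 + c * p.2) ^ n ∂(ν.prod σ)
      = ∑ m ∈ Finset.range (n + 1), (∫ x, x ^ m ∂ν) * (∫ x, x ^ (n - m) ∂σ) *
          (c ^ (n - m) * n.choose m) := by
  have hexp : (fun p : ℝ × ℝ => (p.1 + c * p.2) ^ n) = fun p => ∑ m ∈ Finset.range (n + 1),
      p.1 ^ m * p.2 ^ (n - m) * (c ^ (n - m) * n.choose m) := by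
    funext p
    rw [add_pow]
    refine Finset.sum_congr rfl fun m _ => ?_
    rw [mul_pow]
    ring
  have hint : ∀ m ∈ Finset.range (n + 1), Integrable (fun p : ℝ × ℝ =>
      p.1 ^ m * p.2 ^ (n - m) * (c ^ (n - m) * n.choose m)) (ν.prod σ) := fun m hm =>
    ((integrable_pow_of_memLp hν (Nat.lt_succ_iff.1 (Finset.mem_range.1 hm))).mul_prod
      (integrable_pow_of_memLp hσ (Nat.sub_le n m))).mul_const _
  rw [hexp]
  refine ⟨integrable_finsetSum _ hint, ?_⟩
  rw [integral_finsetSum _ hint]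
  refine Finset.sum_congr rfl fun m _ => ?_
  rw [integral_mul_const, integral_prod_mul (fun x : ℝ => x ^ m) fun x : ℝ => x ^ (n - m)]

lemma integral_pow_systemLaw {n : ℕ} (hν : MemLp (fun x : ℝ => x) n ν)
    (hσ : MemLp (fun x : ℝ => x) n σ) :
    ∫ x, x ^ n ∂(systemLaw σ ν) = ∑ m ∈ Finset.range (n + 1),
      (∫ x, x ^ m ∂ν) * (∫ x, x ^ (n - m) ∂σ) * n.choose m := by
  have h := (integral_add_mul_pow_prod hν hσ 1).2
  simp only [one_mul, one_pow] at h
  rw [systemLaw, integral_map (by fun_prop) (by fun_prop), h]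

lemma integral_systemLaw (hν : MemLp (fun x : ℝ => x) 2 ν) (hσ : MemLp (fun x : ℝ => x) 2 σ) :
    ∫ x, x ∂(systemLaw σ ν) = ∫ x, x ∂ν + ∫ x, x ∂σ := by
  have h := integral_pow_systemLaw (n := 1)
    (by simpa using hν.mono_exponent (p := 1) (by norm_num))
    (by simpa using hσ.mono_exponent (p := 1) (by norm_num))
  simp [Finset.sum_range_succ] at h
  linarith

lemma integral_sq_systemLaw (hν : MemLp (fun x : ℝ => x) 2 ν) (hσ : MemLp (fun x : ℝ => x) 2 σ) :
    ∫ x, x ^ 2 ∂(systemLaw σ ν)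
      = ∫ x, x ^ 2 ∂ν + 2 * (∫ x, x ∂ν) * (∫ x, x ∂σ) + ∫ x, x ^ 2 ∂σ := by
  have h := integral_pow_systemLaw (n := 2) (by simpa using hν) (by simpa using hσ)
  simp [Finset.sum_range_succ] at h
  linarith

lemma integral_cube_systemLaw (hν : MemLp (fun x : ℝ => x) 3 ν) (hσ : MemLp (fun x : ℝ => x) 3 σ) :
    ∫ x, x ^ 3 ∂(systemLaw σ ν)
      = ∫ x, x ^ 3 ∂ν + 3 * (∫ x, x ^ 2 ∂ν) * (∫ x, x ∂σ) + 3 * (∫ x, x ∂ν) * (∫ x, x ^ 2 ∂σ)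
        + ∫ x, x ^ 3 ∂σ := by
  have h := integral_pow_systemLaw (n := 3) (by simpa using hν) (by simpa using hσ)
  simp [Finset.sum_range_succ] at h
  linarith

/-! ### Exponential interarrival times -/

/-- Mean idle time before the next arrival. -/
noncomputable def meanIdle (lam : ℝ) (U : Measure ℝ) : ℝ := (∫ u, Real.exp (-(lam * u)) ∂U) / lam

lemma integrable_exp_neg {lam : ℝ} (hlam : 0 < lam) (hU : ∀ᵐ u ∂U, 0 ≤ u) :
    Integrable (fun u => Real.exp (-(lam * u))) U := by
  refine Integrable.of_bound (C := 1) (by fun_prop) ?_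
  filter_upwards [hU] with u hu
  rw [Real.norm_eq_abs, abs_of_pos (Real.exp_pos _), Real.exp_le_one_iff]
  nlinarith

/-- By memorylessness, given a system time `u` the idle time is a fresh exponential variable with
probability `exp (-λ u)` and `0` otherwise. All idle moments are thus multiples of `meanIdle`. -/
lemma integral_idle_pow {lam : ℝ} (hlam : 0 < lam) (hU : ∀ᵐ u ∂U, 0 ≤ u) {n : ℕ} (hn : n ≠ 0)
    (hUn : MemLp (fun x : ℝ => x) n U) :
    Integrable (fun p : ℝ × ℝ => max (p.2 - p.1) 0 ^ n) (U.prod (expMeasure lam)) ∧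
    ∫ p : ℝ × ℝ, max (p.2 - p.1) 0 ^ n ∂(U.prod (expMeasure lam))
      = (∫ u, Real.exp (-(lam * u)) ∂U) * (n.factorial / lam ^ n) := by
  have := isProbabilityMeasure_expMeasure hlam
  have hint : Integrable (fun p : ℝ × ℝ => max (p.2 - p.1) 0 ^ n) (U.prod (expMeasure lam)) := by
    have h1 := (integral_add_mul_pow_prod hUn (memLp_id_expMeasure hlam n) (-1)).1
    refine h1.mono (by fun_prop) (Eventually.of_forall fun p => ?_)
    simp only [norm_pow, Real.norm_eq_abs]
    refine pow_le_pow_left₀ (abs_nonneg _) ?_ n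
    rw [abs_of_nonneg (le_max_right _ _), neg_one_mul, ← sub_eq_add_neg, abs_sub_comm]
    exact max_le (le_abs_self _) (abs_nonneg _)
  refine ⟨hint, ?_⟩
  rw [integral_prod _ hint, ← integral_mul_const]
  refine integral_congr_ae ?_
  filter_upwards [hU] with u hu using integral_excess_pow_expMeasure hlam hu hn

/-- The wait is the signed difference plus the idle time: `(u - a)⁺ = (u - a) + (a - u)⁺`. For
squares the idle term is subtracted instead. -/
lemma integral_nextWait {lam : ℝ} (hlam : 0 < lam) (hU : ∀ᵐ u ∂U, 0 ≤ u)
    (hU2 : MemLp (fun x : ℝ => x) 2 U) :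
    ∫ x, x ∂(nextWait (expMeasure lam) U) = ∫ x, x ∂U - 1 / lam + meanIdle lam U := by
  have := isProbabilityMeasure_expMeasure hlam
  have hU1 : MemLp (fun x : ℝ => x) (1 : ℕ) U := by
    simpa using hU2.mono_exponent (p := 1) (by norm_num)
  obtain ⟨hi1, he1⟩ := integral_add_mul_pow_prod hU1 (memLp_id_expMeasure hlam 1) (-1)
  obtain ⟨hi2, he2⟩ := integral_idle_pow hlam hU one_ne_zero hU1
  have hpt : ∀ p : ℝ × ℝ, max (p.1 - p.2) 0 = (p.1 + -1 * p.2) ^ 1 + max (p.2 - p.1) 0 ^ 1 := by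
    intro p
    rcases le_total p.1 p.2 with h | h
    · rw [max_eq_right (by linarith), max_eq_left (by linarith)]; ring
    · rw [max_eq_left (by linarith), max_eq_right (by linarith)]; ring
  rw [nextWait, integral_map (by fun_prop) (by fun_prop)]
  simp only [hpt]
  rw [integral_add hi1 hi2, he1, he2]
  have h1 := integral_pow_expMeasure hlam 1
  simp only [pow_one, Nat.factorial_one, Nat.cast_one] at h1
  simp [Finset.sum_range_succ, meanIdle, h1]
  ring

lemma integral_sq_nextWait {lam : ℝ} (hlam : 0 < lam) (hU : ∀ᵐ u ∂U, 0 ≤ u)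
    (hU2 : MemLp (fun x : ℝ => x) 2 U) :
    ∫ x, x ^ 2 ∂(nextWait (expMeasure lam) U)
      = ∫ x, x ^ 2 ∂U - 2 / lam * ∫ x, x ∂U + 2 / lam ^ 2 - 2 / lam * meanIdle lam U := by
  have := isProbabilityMeasure_expMeasure hlam
  have hU1 : MemLp (fun x : ℝ => x) (2 : ℕ) U := by simpa using hU2
  obtain ⟨hi1, he1⟩ := integral_add_mul_pow_prod hU1 (memLp_id_expMeasure hlam 2) (-1)
  obtain ⟨hi2, he2⟩ := integral_idle_pow hlam hU two_ne_zero hU1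
  have hpt : ∀ p : ℝ × ℝ, max (p.1 - p.2) 0 ^ 2 = (p.1 + -1 * p.2) ^ 2 - max (p.2 - p.1) 0 ^ 2 := by
    intro p
    rcases le_total p.1 p.2 with h | h
    · rw [max_eq_right (by linarith), max_eq_left (by linarith)]; ring
    · rw [max_eq_left (by linarith), max_eq_right (by linarith)]; ring
  rw [nextWait, integral_map (by fun_prop) (by fun_prop)]
  simp only [hpt]
  rw [integral_sub hi1 hi2, he1, he2]
  have h1 := integral_pow_expMeasure hlam 1
  have h2 := integral_pow_expMeasure hlam 2
  simp only [pow_one, Nat.factorial_one, Nat.cast_one] at h1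
  simp only [Nat.factorial_two, Nat.cast_ofNat] at h2
  simp [Finset.sum_range_succ, meanIdle, h1, h2]
  ring

/-- The idle time is at most the interarrival time `a`, so `((u - a)⁺)³ ≤ (u - a)³ + a³`, and the
last term cancels the third moment of `a`. -/
lemma integral_cube_nextWait_le {lam : ℝ} (hlam : 0 < lam) (hU : ∀ᵐ u ∂U, 0 ≤ u)
    (hU3 : MemLp (fun x : ℝ => x) 3 U) :
    ∫ x, x ^ 3 ∂(nextWait (expMeasure lam) U)
      ≤ ∫ x, x ^ 3 ∂U - 3 / lam * ∫ x, x ^ 2 ∂U + 6 / lam ^ 2 * ∫ x, x ∂U := by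
  have := isProbabilityMeasure_expMeasure hlam
  have hU1 : MemLp (fun x : ℝ => x) (3 : ℕ) U := by simpa using hU3
  have he := memLp_id_expMeasure hlam 3
  obtain ⟨hi1, he1⟩ := integral_add_mul_pow_prod hU1 he (-1)
  have hi2 : Integrable (fun p : ℝ × ℝ => p.2 ^ 3) (U.prod (expMeasure lam)) :=
    (integrable_pow_of_memLp he le_rfl).comp_snd U
  have he2 : ∫ p : ℝ × ℝ, p.2 ^ 3 ∂(U.prod (expMeasure lam)) = ∫ x, x ^ 3 ∂(expMeasure lam) := by
    rw [integral_fun_snd (fun x : ℝ => x ^ 3)]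
    simp
  have hpt : ∀ᵐ p : ℝ × ℝ ∂(U.prod (expMeasure lam)),
      max (p.1 - p.2) 0 ^ 3 ≤ (p.1 + -1 * p.2) ^ 3 + p.2 ^ 3 := by
    filter_upwards [Measure.quasiMeasurePreserving_fst.ae hU,
      Measure.quasiMeasurePreserving_snd.ae ae_expMeasure_nonneg] with p h1 h2
    rcases le_total p.1 p.2 with h | h
    · rw [max_eq_right (by linarith)]
      have : (p.2 - p.1) ^ 3 ≤ p.2 ^ 3 := pow_le_pow_left₀ (by linarith) (by linarith) 3
      nlinarith
    · rw [max_eq_left (by linarith)]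
      have : 0 ≤ p.2 ^ 3 := pow_nonneg h2 3
      nlinarith
  have hpos : 0 ≤ᵐ[U.prod (expMeasure lam)] fun p : ℝ × ℝ => max (p.1 - p.2) 0 ^ 3 :=
    Eventually.of_forall fun p => pow_nonneg (le_max_right _ _) 3
  rw [nextWait, integral_map (by fun_prop) (by fun_prop)]
  refine (integral_mono_of_nonneg hpos (hi1.add hi2) hpt).trans (le_of_eq ?_)
  change ∫ p : ℝ × ℝ, ((p.1 + -1 * p.2) ^ 3 + p.2 ^ 3) ∂(U.prod (expMeasure lam)) = _
  rw [integral_add hi1 hi2, he1, he2]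
  have h1 := integral_pow_expMeasure hlam 1
  have h2 := integral_pow_expMeasure hlam 2
  simp only [pow_one, Nat.factorial_one, Nat.cast_one] at h1
  simp only [Nat.factorial_two, Nat.cast_ofNat] at h2
  simp [Finset.sum_range_succ, h1, h2]
  ring

end Moments

/-! ### The Pollaczek–Khinchine formula for exponential interarrival times -/

section PollaczekKhinchine

variable {σ : Measure ℝ} {lam : ℝ}

lemma stochLE_map_min (c : ℝ) : StochLE (σ.map fun x => min x c) σ := by
  have h := stochLE_map (σ := σ) (f := fun x => min x c) (g := fun x => x) (by fun_prop)
    (by fun_prop) (Eventually.of_forall fun x => min_le_left x c)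
  rwa [Measure.map_id'] at h

lemma integral_waitLaw_nonneg (hlam : 0 < lam) (k : ℕ) :
    0 ≤ ∫ x, x ∂(waitLaw (expMeasure lam) σ k) := by
  have := isProbabilityMeasure_expMeasure hlam
  exact integral_nonneg_of_ae (ae_waitLaw_nonneg k)

variable [IsProbabilityMeasure σ]

lemma memLp_two_waitLaw (hlam : 0 < lam) (hσ : MemLp (fun x : ℝ => x) 2 σ) (k : ℕ) :
    MemLp (fun x : ℝ => x) 2 (waitLaw (expMeasure lam) σ k) := by
  have := isProbabilityMeasure_expMeasure hlam
  exact memLp_waitLaw hσ (by simpa using memLp_id_expMeasure hlam 2) k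

lemma integral_waitLaw_succ (hlam : 0 < lam) (hσ0 : ∀ᵐ x ∂σ, 0 ≤ x)
    (hσ : MemLp (fun x : ℝ => x) 2 σ) (k : ℕ) :
    ∫ x, x ∂(waitLaw (expMeasure lam) σ (k + 1)) = ∫ x, x ∂(waitLaw (expMeasure lam) σ k)
      - (1 / lam - ∫ x, x ∂σ) + meanIdle lam (systemLaw σ (waitLaw (expMeasure lam) σ k)) := by
  have := isProbabilityMeasure_expMeasure hlam
  have hk := memLp_two_waitLaw hlam hσ k
  rw [waitLaw, integral_nextWait hlam (ae_systemLaw_nonneg (ae_waitLaw_nonneg k) hσ0)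
    (memLp_systemLaw hk hσ), integral_systemLaw hk hσ]
  ring

/-- The weight `2 / λ` on the first moment makes the unknown `meanIdle` cancel, leaving an exact
drift that vanishes precisely at the Pollaczek–Khinchine value when the load is below one. -/
lemma integral_sq_waitLaw_succ (hlam : 0 < lam) (hσ0 : ∀ᵐ x ∂σ, 0 ≤ x)
    (hσ : MemLp (fun x : ℝ => x) 2 σ) (k : ℕ) :
    ∫ x, x ^ 2 ∂(waitLaw (expMeasure lam) σ (k + 1))
        + 2 / lam * ∫ x, x ∂(waitLaw (expMeasure lam) σ (k + 1))
      = ∫ x, x ^ 2 ∂(waitLaw (expMeasure lam) σ k)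
        + 2 / lam * ∫ x, x ∂(waitLaw (expMeasure lam) σ k)
        + (∫ x, x ^ 2 ∂σ - 2 * (1 / lam - ∫ x, x ∂σ) * ∫ x, x ∂(waitLaw (expMeasure lam) σ k)) := by
  have := isProbabilityMeasure_expMeasure hlam
  have hk := memLp_two_waitLaw hlam hσ k
  rw [integral_waitLaw_succ hlam hσ0 hσ, waitLaw,
    integral_sq_nextWait hlam (ae_systemLaw_nonneg (ae_waitLaw_nonneg k) hσ0)
    (memLp_systemLaw hk hσ), integral_systemLaw hk hσ, integral_sq_systemLaw hk hσ]
  field_simp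
  ring

lemma integral_pow_waitLaw_le_succ (hlam : 0 < lam) {p : ℕ} (hσ : MemLp (fun x : ℝ => x) p σ)
    (k : ℕ) : ∫ x, x ^ p ∂(waitLaw (expMeasure lam) σ k)
      ≤ ∫ x, x ^ p ∂(waitLaw (expMeasure lam) σ (k + 1)) := by
  have := isProbabilityMeasure_expMeasure hlam
  exact (stochLE_waitLaw_succ k).integral_pow_le (ae_waitLaw_nonneg k) (ae_waitLaw_nonneg (k + 1))
    (integrable_pow_of_memLp (memLp_waitLaw hσ (memLp_id_expMeasure hlam p) (k + 1)) le_rfl)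

lemma monotone_integral_pow_waitLaw (hlam : 0 < lam) {p : ℕ} (hσ : MemLp (fun x : ℝ => x) p σ) :
    Monotone fun k => ∫ x, x ^ p ∂(waitLaw (expMeasure lam) σ k) :=
  monotone_nat_of_le_succ fun k => integral_pow_waitLaw_le_succ hlam hσ k

lemma monotone_integral_waitLaw (hlam : 0 < lam) (hσ : MemLp (fun x : ℝ => x) 2 σ) :
    Monotone fun k => ∫ x, x ∂(waitLaw (expMeasure lam) σ k) := by
  simpa using monotone_integral_pow_waitLaw hlam (p := 1)
    (by simpa using hσ.mono_exponent (p := 1) (by norm_num))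

/-- Upper half of the Pollaczek–Khinchine formula. -/
lemma integral_waitLaw_le (hlam : 0 < lam) (hσ0 : ∀ᵐ x ∂σ, 0 ≤ x)
    (hσ : MemLp (fun x : ℝ => x) 2 σ) (hd : 0 < 1 / lam - ∫ x, x ∂σ) (k : ℕ) :
    ∫ x, x ∂(waitLaw (expMeasure lam) σ k) ≤ (∫ x, x ^ 2 ∂σ) / (2 * (1 / lam - ∫ x, x ∂σ)) := by
  rw [le_div_iff₀ (by positivity)]
  -- Both moments are nondecreasing in `k`, so the drift is nonnegative.
  have h1 := integral_sq_waitLaw_succ hlam hσ0 hσ k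
  have h2 := integral_pow_waitLaw_le_succ hlam (p := 2) (by simpa using hσ) k
  have h3 := mul_le_mul_of_nonneg_left (monotone_integral_waitLaw hlam hσ (Nat.le_succ k))
    (show 0 ≤ 2 / lam by positivity)
  simp only [Nat.succ_eq_add_one] at h3
  linarith

/-- The second moments of the waiting times stay bounded when the service times have a third
moment. -/
lemma integral_sq_waitLaw_le (hlam : 0 < lam) (hσ0 : ∀ᵐ x ∂σ, 0 ≤ x)
    (hσ : MemLp (fun x : ℝ => x) 3 σ) (hd : 0 < 1 / lam - ∫ x, x ∂σ) :
    ∃ C, ∀ k, ∫ x, x ^ 2 ∂(waitLaw (expMeasure lam) σ k) ≤ C := by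
  have := isProbabilityMeasure_expMeasure hlam
  have hσ2 : MemLp (fun x : ℝ => x) 2 σ := hσ.mono_exponent (by norm_num)
  set s := ∫ x, x ^ 2 ∂σ
  set m := ∫ x, x ∂σ
  set B := s / (2 * (1 / lam - m))
  have hm0 : 0 ≤ m := integral_nonneg_of_ae hσ0
  have hs0 : 0 ≤ s := integral_nonneg fun x => sq_nonneg x
  refine ⟨(3 * B * s + ∫ x, x ^ 3 ∂σ + 6 / lam ^ 2 * (B + m)) / (3 * (1 / lam - m)), fun k => ?_⟩
  rw [le_div_iff₀ (by positivity)]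
  have hB := integral_waitLaw_le hlam hσ0 hσ2 hd k
  have hw0 := integral_waitLaw_nonneg (σ := σ) hlam k
  have hk3 : MemLp (fun x : ℝ => x) 3 (waitLaw (expMeasure lam) σ k) :=
    memLp_waitLaw hσ (by simpa using memLp_id_expMeasure hlam 3) k
  have hk := memLp_two_waitLaw hlam hσ2 k
  -- The third moments increase, so the cubic drift is nonnegative; its dominant term is `-3 (1/λ -
  -- m)` times the second moment, and everything else is bounded through `B`.
  have h1 := integral_pow_waitLaw_le_succ hlam (p := 3) (by simpa using hσ) k
  have h2 := integral_cube_nextWait_le hlam (ae_systemLaw_nonneg (ae_waitLaw_nonneg (σ := σ)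
    (e := expMeasure lam) k) hσ0) (memLp_systemLaw hk3 hσ)
  rw [integral_cube_systemLaw hk3 hσ, integral_sq_systemLaw hk hσ2, integral_systemLaw hk hσ2] at h2
  rw [waitLaw] at h1
  have h3 := h1.trans h2
  set w := ∫ x, x ∂(waitLaw (expMeasure lam) σ k)
  set v := ∫ x, x ^ 2 ∂(waitLaw (expMeasure lam) σ k)
  have e1 : 3 / lam = 3 * (1 / lam) := by ring
  rw [e1] at h3
  have hl : 0 < 1 / lam := by positivity
  have h4 : 0 ≤ (1 / lam) * (2 * w * m + s) := by positivity
  have h5 : 3 * w * s ≤ 3 * B * s := by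
    have := mul_le_mul_of_nonneg_right hB hs0
    linarith
  have h6 : 6 / lam ^ 2 * (w + m) ≤ 6 / lam ^ 2 * (B + m) :=
    mul_le_mul_of_nonneg_left (by linarith) (by positivity)
  nlinarith

/-- Bounded monotone moments converge, so the drift in `integral_sq_waitLaw_succ` tends to `0`. -/
lemma tendsto_integral_waitLaw_of_memLp_three (hlam : 0 < lam) (hσ0 : ∀ᵐ x ∂σ, 0 ≤ x)
    (hσ : MemLp (fun x : ℝ => x) 3 σ) (hd : 0 < 1 / lam - ∫ x, x ∂σ) :
    Tendsto (fun k => ∫ x, x ∂(waitLaw (expMeasure lam) σ k)) atTop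
      (𝓝 ((∫ x, x ^ 2 ∂σ) / (2 * (1 / lam - ∫ x, x ∂σ)))) := by
  have hσ2 : MemLp (fun x : ℝ => x) 2 σ := hσ.mono_exponent (by norm_num)
  obtain ⟨C, hC⟩ := integral_sq_waitLaw_le hlam hσ0 hσ hd
  have hw := tendsto_atTop_ciSup (monotone_integral_waitLaw hlam hσ2)
    ⟨_, Set.forall_mem_range.2 (integral_waitLaw_le hlam hσ0 hσ2 hd)⟩
  have hv := tendsto_atTop_ciSup (monotone_integral_pow_waitLaw hlam (p := 2) (by simpa using hσ2))
    ⟨_, Set.forall_mem_range.2 hC⟩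
  set L := ⨆ k, ∫ x, x ∂(waitLaw (expMeasure lam) σ k)
  have h1 := (hv.comp (tendsto_add_atTop_nat 1)).add
    ((hw.comp (tendsto_add_atTop_nat 1)).const_mul (2 / lam))
  have h2 := (hv.add (hw.const_mul (2 / lam))).add
    ((hw.const_mul (2 * (1 / lam - ∫ x, x ∂σ))).const_sub (∫ x, x ^ 2 ∂σ))
  have h3 := tendsto_nhds_unique h1
    (h2.congr fun k => (integral_sq_waitLaw_succ hlam hσ0 hσ2 k).symm)
  have h4 : L = (∫ x, x ^ 2 ∂σ) / (2 * (1 / lam - ∫ x, x ∂σ)) := by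
    rw [eq_div_iff (by positivity)]
    linarith
  rwa [← h4]

lemma tendsto_integral_map_min_pow (hσ0 : ∀ᵐ x ∂σ, 0 ≤ x) {p : ℕ}
    (hσ : MemLp (fun x : ℝ => x) p σ) :
    Tendsto (fun c : ℕ => ∫ x, x ^ p ∂(σ.map fun x => min x (c : ℝ))) atTop
      (𝓝 (∫ x, x ^ p ∂σ)) := by
  have h : ∀ c : ℕ, ∫ x, x ^ p ∂(σ.map fun x => min x (c : ℝ)) = ∫ x, min x (c : ℝ) ^ p ∂σ :=
    fun c => integral_map (by fun_prop) (by fun_prop)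
  simp only [h]
  refine tendsto_integral_of_dominated_convergence (fun x => x ^ p) (fun c => by fun_prop)
    (integrable_pow_of_memLp hσ le_rfl) (fun c => ?_) ?_
  · filter_upwards [hσ0] with x hx
    have h0 : 0 ≤ min x (c : ℝ) := le_min hx (Nat.cast_nonneg c)
    rw [Real.norm_eq_abs, abs_of_nonneg (pow_nonneg h0 p)]
    exact pow_le_pow_left₀ h0 (min_le_left _ _) p
  · refine Eventually.of_forall fun x => tendsto_const_nhds.congr' ?_
    obtain ⟨n, hn⟩ := exists_nat_gt x
    filter_upwards [eventually_ge_atTop n] with c hc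
    rw [min_eq_left (hn.le.trans (by exact_mod_cast hc))]

/-- The **Pollaczek–Khinchine formula** for the limit of the mean waiting times. -/
theorem tendsto_integral_waitLaw (hlam : 0 < lam) (hσ0 : ∀ᵐ x ∂σ, 0 ≤ x)
    (hσ : MemLp (fun x : ℝ => x) 2 σ) (hd : 0 < 1 / lam - ∫ x, x ∂σ) :
    Tendsto (fun k => ∫ x, x ∂(waitLaw (expMeasure lam) σ k)) atTop
      (𝓝 ((∫ x, x ^ 2 ∂σ) / (2 * (1 / lam - ∫ x, x ∂σ)))) := by
  have := isProbabilityMeasure_expMeasure hlam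
  have hσ1 : MemLp (fun x : ℝ => x) (1 : ℕ) σ := by
    simpa using hσ.mono_exponent (p := 1) (by norm_num)
  have hbdd : BddAbove (Set.range fun k => ∫ x, x ∂(waitLaw (expMeasure lam) σ k)) :=
    ⟨_, Set.forall_mem_range.2 (integral_waitLaw_le hlam hσ0 hσ hd)⟩
  have hw := tendsto_atTop_ciSup (monotone_integral_waitLaw hlam hσ) hbdd
  set L := ⨆ k, ∫ x, x ∂(waitLaw (expMeasure lam) σ k)
  have hL1 : L ≤ (∫ x, x ^ 2 ∂σ) / (2 * (1 / lam - ∫ x, x ∂σ)) :=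
    ciSup_le (integral_waitLaw_le hlam hσ0 hσ hd)
  have hm := tendsto_integral_map_min_pow hσ0 hσ1
  have hs := tendsto_integral_map_min_pow hσ0 (p := 2) (by simpa using hσ)
  simp only [pow_one] at hm
  have hlim := hs.div ((hm.const_sub (1 / lam)).const_mul 2) (by positivity)
  -- Service times truncated at `c` have all moments and produce smaller waits, so their
  -- Pollaczek–Khinchine values are at most `L`; then `c → ∞`.
  have hL2 : (∫ x, x ^ 2 ∂σ) / (2 * (1 / lam - ∫ x, x ∂σ)) ≤ L := by
    refine le_of_tendsto hlim (Eventually.of_forall fun c => ?_)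
    set τ := σ.map fun x => min x (c : ℝ)
    have : IsProbabilityMeasure τ := Measure.isProbabilityMeasure_map (by fun_prop)
    have hτ0 : ∀ᵐ x ∂τ, 0 ≤ x := by
      rw [ae_map_iff (by fun_prop) measurableSet_Ici]
      filter_upwards [hσ0] with x hx using le_min hx (Nat.cast_nonneg c)
    have hτ3 : MemLp (fun x : ℝ => x) 3 τ := by
      rw [memLp_map_measure_iff (by fun_prop) (by fun_prop)]
      refine MemLp.of_bound (by fun_prop) (c : ℝ) ?_
      filter_upwards [hσ0] with x hx
      simp only [Function.comp, Real.norm_eq_abs]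
      rw [abs_of_nonneg (le_min hx (Nat.cast_nonneg c))]
      exact min_le_right _ _
    have hτm : ∫ x, x ∂τ ≤ ∫ x, x ∂σ := by
      simpa using (stochLE_map_min (σ := σ) c).integral_pow_le hτ0 hσ0 (p := 1)
        (integrable_pow_of_memLp hσ1 le_rfl)
    refine le_of_tendsto_of_tendsto
      (tendsto_integral_waitLaw_of_memLp_three hlam hτ0 hτ3 (by linarith)) hw
      (Eventually.of_forall fun k => ?_)
    have h1 : MemLp (fun x : ℝ => x) (1 : ℕ) (waitLaw (expMeasure lam) σ k) := by
      simpa using (memLp_two_waitLaw hlam hσ k).mono_exponent (p := 1) (by norm_num)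
    simpa using ((stochLE_map_min (σ := σ) c).waitLaw k).integral_pow_le (ae_waitLaw_nonneg k)
      (ae_waitLaw_nonneg k) (p := 1) (integrable_pow_of_memLp h1 le_rfl)
  rwa [← le_antisymm hL1 hL2]

end PollaczekKhinchine

/-! ### Random queues: from laws to almost sure averages -/

/-- Independence is checked on the π-system of rectangles, where an intersection of pair events
splits into an `f`-event and a `g`-event. -/
lemma iIndepFun_prodMk {Ω ι β γ : Type*} [MeasurableSpace Ω] [MeasurableSpace β]
    [MeasurableSpace γ] {μ : Measure Ω} {f : ι → Ω → β} {g : ι → Ω → γ}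
    (hfm : ∀ i, Measurable (f i)) (hgm : ∀ i, Measurable (g i))
    (hf : iIndepFun f μ) (hg : iIndepFun g μ)
    (hfg : IndepFun (fun ω i => f i ω) (fun ω i => g i ω) μ) :
    iIndepFun (fun i ω => (f i ω, g i ω)) μ := by
  set R : Set (Set (β × γ)) :=
    Set.image2 (fun s t => s ×ˢ t) {s | MeasurableSet s} {t | MeasurableSet t} with hR
  have hpair : ∀ i, IndepFun (f i) (g i) μ := fun i =>
    hfg.comp (measurable_pi_apply i) (measurable_pi_apply i)
  refine iIndepSets.iIndep (fun i => ((hfm i).prodMk (hgm i)).comap_le)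
    (fun i => {s | ∃ t ∈ R, (fun ω => (f i ω, g i ω)) ⁻¹' t = s})
    (fun i => isPiSystem_prod.comap _) (fun i => ?_) ?_
  · rw [← generateFrom_prod, MeasurableSpace.comap_generateFrom]
    rfl
  · rw [iIndepSets_iff]
    intro s F hF
    have hF' : ∀ i, ∃ (B : Set β) (C : Set γ), MeasurableSet B ∧ MeasurableSet C ∧
        (i ∈ s → F i = f i ⁻¹' B ∩ g i ⁻¹' C) := by
      intro i
      by_cases hi : i ∈ s
      · obtain ⟨_, ⟨B, hB, C, hC, rfl⟩, h⟩ := hF i hi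
        exact ⟨B, C, hB, hC, fun _ => h.symm⟩
      · exact ⟨∅, ∅, .empty, .empty, fun h => absurd h hi⟩
    choose B C hB hC hBC using hF'
    have h1 : ⋂ i ∈ s, F i = (⋂ i ∈ s, f i ⁻¹' B i) ∩ ⋂ i ∈ s, g i ⁻¹' C i := by
      ext ω
      simp only [Set.mem_inter_iff, Set.mem_iInter]
      refine ⟨fun h => ⟨fun i hi => ?_, fun i hi => ?_⟩, fun h i hi => ?_⟩
      · exact (hBC i hi ▸ h i hi).1
      · exact (hBC i hi ▸ h i hi).2
      · rw [hBC i hi]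
        exact ⟨h.1 i hi, h.2 i hi⟩
    have h2 : ⋂ i ∈ s, f i ⁻¹' B i = (fun ω i => f i ω) ⁻¹' (Set.pi s B) := by
      ext ω; simp
    have h3 : ⋂ i ∈ s, g i ⁻¹' C i = (fun ω i => g i ω) ⁻¹' (Set.pi s C) := by
      ext ω; simp
    have h4 := hfg.measure_inter_preimage_eq_mul (Set.pi s B) (Set.pi s C)
      (MeasurableSet.pi s.countable_toSet fun i _ => hB i)
      (MeasurableSet.pi s.countable_toSet fun i _ => hC i)
    rw [h1, h2, h3, h4, ← h2, ← h3, hf.measure_inter_preimage_eq_mul s fun i _ => hB i,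
      hg.measure_inter_preimage_eq_mul s fun i _ => hC i, ← Finset.prod_mul_distrib]
    refine Finset.prod_congr rfl fun i hi => ?_
    rw [hBC i hi, (hpair i).measure_inter_preimage_eq_mul _ _ (hB i) (hC i)]

/-- A single queue with independent interarrival times of law `e` and service times of law `σ`. -/
structure IsQueue {Ω : Type*} [MeasurableSpace Ω] (μ : Measure Ω) (e σ : Measure ℝ)
    (A X : ℕ → Ω → ℝ) : Prop where
  measurable_arrival : ∀ k, Measurable (A k)
  measurable_service : ∀ k, Measurable (X k)
  law_arrival : ∀ k, μ.map (A k) = e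
  law_service : ∀ k, μ.map (X k) = σ
  indep_arrival : iIndepFun A μ
  indep_service : iIndepFun X μ
  indep : IndepFun (fun ω k => X k ω) (fun ω k => A k ω) μ

section Queue

variable {Ω : Type*} [MeasurableSpace Ω] {μ : Measure Ω} {e σ : Measure ℝ}
  {A X : ℕ → Ω → ℝ}

lemma IsQueue.iIndepFun_pair (h : IsQueue μ e σ A X) :
    iIndepFun (fun k ω => (X k ω, A (k + 1) ω)) μ :=
  iIndepFun_prodMk h.measurable_service (fun k => h.measurable_arrival (k + 1)) h.indep_service
    (h.indep_arrival.precomp (add_left_injective 1))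
    (h.indep.comp measurable_id (measurable_pi_iff.2 fun k => measurable_pi_apply (k + 1)))

lemma IsQueue.indepFun_pair (h : IsQueue μ e σ A X) (k : ℕ) : IndepFun (X k) (A (k + 1)) μ :=
  h.indep.comp (measurable_pi_apply k) (measurable_pi_apply (k + 1))

lemma ae_tendsto_average_of_law {τ : Measure ℝ} {Z : ℕ → Ω → ℝ} (hZm : ∀ k, Measurable (Z k))
    (hlaw : ∀ k, μ.map (Z k) = τ) (hind : iIndepFun Z μ) (hτ : Integrable (fun x : ℝ => x) τ) :
    ∀ᵐ ω ∂μ, Tendsto (fun n : ℕ => (∑ k ∈ Finset.range n, Z k ω) / n) atTop (𝓝 (∫ x, x ∂τ)) := by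
  have h1 := strong_law_ae_real Z ?_ (fun i j hij => hind.indepFun hij)
    fun k => ⟨(hZm k).aemeasurable, (hZm 0).aemeasurable, (hlaw k).trans (hlaw 0).symm⟩
  · rw [← hlaw 0, integral_map (hZm 0).aemeasurable (by fun_prop)]
    exact h1
  · rw [← hlaw 0] at hτ
    exact hτ.comp_measurable (hZm 0)

/-- The waiting time with index `k` involves only the pairs with index below `k`. -/
lemma IsQueue.indepFun_waitingTime (h : IsQueue μ e σ A X) (k : ℕ) :
    IndepFun (fun ω => waitingTime (fun i => A i ω) (fun i => X i ω) k)
      (fun ω => (X k ω, A (k + 1) ω)) μ := by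
  refine indepFun_of_dependsOn (f := fun k ω => (X k ω, A (k + 1) ω)) (S := Finset.range k) (T := {k})
    (F := fun z => lindley (fun i => (z i).1 - (z i).2) k) (G := fun z => z k)
    h.iIndepFun_pair (fun i => (h.measurable_service i).prodMk (h.measurable_arrival _)) (by simp)
    ((measurable_lindley k).comp (measurable_pi_iff.2 fun i => by fun_prop)) (by fun_prop)
    (fun x y hxy => lindley_congr fun i hi => ?_) fun x y hxy => hxy k (by simp)
  rw [hxy i (by simpa using hi)]

lemma IsQueue.ae_arrival_nonneg {lam : ℝ} (h : IsQueue μ (expMeasure lam) σ A X) :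
    ∀ᵐ ω ∂μ, ∀ k, 0 ≤ A k ω := ae_all_iff.2 fun k => by
  refine ae_of_ae_map (h.measurable_arrival k).aemeasurable ?_
  rw [h.law_arrival]
  exact ae_expMeasure_nonneg

lemma IsQueue.ae_service_nonneg (h : IsQueue μ e σ A X) (hσ0 : ∀ᵐ x ∂σ, 0 ≤ x) :
    ∀ᵐ ω ∂μ, ∀ k, 0 ≤ X k ω := ae_all_iff.2 fun k => by
  refine ae_of_ae_map (h.measurable_service k).aemeasurable ?_
  rwa [h.law_service]

lemma IsQueue.measureReal_le_arrivalTime_le {lam : ℝ} (hlam : 0 < lam) (h : IsQueue μ (expMeasure lam) σ A X)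
    (k : ℕ) {t : ℝ} (ht : 0 < t) :
    μ.real {ω | t ≤ arrivalTime (fun i => A i ω) k} ≤ k / lam / t := by
  have hA1 : ∫ x, x ∂(expMeasure lam) = 1 / lam := by
    simpa using integral_pow_expMeasure hlam 1
  have hi : ∀ k, Integrable (A k) μ := by
    intro k
    have hei : Integrable (fun x : ℝ => x) (expMeasure lam) := by
      simpa using integrable_pow_expMeasure hlam 1
    rw [← h.law_arrival k] at hei
    exact hei.comp_measurable (h.measurable_arrival k)
  have hE : ∫ ω, arrivalTime (fun i => A i ω) k ∂μ = k / lam := by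
    simp only [arrivalTime]
    rw [integral_finsetSum _ fun i _ => hi i]
    have : ∀ i, ∫ ω, A i ω ∂μ = 1 / lam := fun i => by
      rw [← hA1, ← h.law_arrival i, integral_map (h.measurable_arrival i).aemeasurable (by fun_prop)]
    simp [this, div_eq_mul_inv]
  have h0 : 0 ≤ᵐ[μ] fun ω => arrivalTime (fun i => A i ω) k := by
    filter_upwards [h.ae_arrival_nonneg] with ω hω using Finset.sum_nonneg fun i _ => hω i
  rw [le_div_iff₀ ht, ← hE, mul_comm]
  exact mul_meas_ge_le_integral_of_nonneg h0 (integrable_finsetSum _ fun i _ => hi i) t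

variable [IsProbabilityMeasure μ]

lemma IsQueue.isProbabilityMeasure_arrival (h : IsQueue μ e σ A X) : IsProbabilityMeasure e :=
  h.law_arrival 0 ▸ Measure.isProbabilityMeasure_map (h.measurable_arrival 0).aemeasurable

lemma IsQueue.isProbabilityMeasure_service (h : IsQueue μ e σ A X) : IsProbabilityMeasure σ :=
  h.law_service 0 ▸ Measure.isProbabilityMeasure_map (h.measurable_service 0).aemeasurable

lemma measurable_waitingTime (hA : ∀ k, Measurable (A k)) (hX : ∀ k, Measurable (X k)) (k : ℕ) :
    Measurable fun ω => waitingTime (fun i => A i ω) (fun i => X i ω) k :=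
  (measurable_lindley k).comp
    (measurable_pi_iff.2 fun i => (hX i).sub (hA (i + 1)))

/-- The product is rebracketed to match the independence of the wait from the pair (service, next
interarrival). -/
lemma nextWait_systemLaw {ν : Measure ℝ} [IsProbabilityMeasure ν] [IsProbabilityMeasure σ]
    [IsProbabilityMeasure e] : nextWait e (systemLaw σ ν)
      = (ν.prod (σ.prod e)).map fun p => max (p.1 + (p.2.1 - p.2.2)) 0 := by
  have h1 : (systemLaw σ ν).prod e
      = ((ν.prod σ).prod e).map (Prod.map (fun p : ℝ × ℝ => p.1 + p.2) id) := by
    rw [← Measure.map_prod_map _ _ (by fun_prop) measurable_id, Measure.map_id]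
    rfl
  rw [nextWait, h1, Measure.map_map (by fun_prop) (by fun_prop),
    ← (measurePreserving_prodAssoc ν σ e).map_eq, Measure.map_map (by fun_prop) (by fun_prop)]
  congr 1
  funext p
  simp only [Function.comp, Prod.map, id, add_sub_assoc]
  rfl

lemma IsQueue.map_waitingTime (h : IsQueue μ e σ A X) (k : ℕ) :
    μ.map (fun ω => waitingTime (fun i => A i ω) (fun i => X i ω) k) = waitLaw e σ k := by
  have := h.isProbabilityMeasure_arrival
  have := h.isProbabilityMeasure_service
  induction k with
  | zero =>
    simp only [waitingTime, lindley, waitLaw]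
    rw [Measure.map_const, measure_univ, one_smul]
  | succ k ih =>
    have hW := measurable_waitingTime h.measurable_arrival h.measurable_service k
    have hXA := (h.measurable_service k).prodMk (h.measurable_arrival (k + 1))
    have h1 := (indepFun_iff_map_prod_eq_prod_map_map hW.aemeasurable hXA.aemeasurable).1
      (h.indepFun_waitingTime k)
    have h2 := (indepFun_iff_map_prod_eq_prod_map_map (h.measurable_service k).aemeasurable
      (h.measurable_arrival (k + 1)).aemeasurable).1 (h.indepFun_pair k)
    rw [h2, ih, h.law_arrival, h.law_service] at h1
    rw [waitLaw, nextWait_systemLaw, ← h1, Measure.map_map (by fun_prop) (hW.prodMk hXA)]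
    rfl

/-- Transfers the question to the canonical sequence space, where the shift is measure preserving.
-/
lemma IsQueue.map_queueIncrement (h : IsQueue μ e σ A X) :
    μ.map (fun ω => queueIncrement (fun i => A i ω) (fun i => X i ω))
      = Measure.infinitePi fun _ => μ.map fun ω => X 0 ω - A 1 ω := by
  have hm : ∀ k, Measurable fun ω => X k ω - A (k + 1) ω := fun k =>
    (h.measurable_service k).sub (h.measurable_arrival (k + 1))
  have hind : iIndepFun (fun k ω => X k ω - A (k + 1) ω) μ :=
    h.iIndepFun_pair.comp (fun _ p => p.1 - p.2) fun _ => by fun_prop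
  have hlaw : ∀ k, μ.map (fun ω => X k ω - A (k + 1) ω) = (σ.prod e).map fun p => p.1 - p.2 := by
    intro k
    have h2 := (indepFun_iff_map_prod_eq_prod_map_map (h.measurable_service k).aemeasurable
      (h.measurable_arrival (k + 1)).aemeasurable).1 (h.indepFun_pair k)
    rw [h.law_arrival, h.law_service] at h2
    rw [← h2, Measure.map_map (by fun_prop)
      ((h.measurable_service k).prodMk (h.measurable_arrival (k + 1)))]
    rfl
  have h1 := hind.map_fun_eq_infinitePi_map hm
  have h2 : (fun k => μ.map fun ω => X k ω - A (k + 1) ω)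
      = fun _ => μ.map fun ω => X 0 ω - A 1 ω := by
    funext k
    rw [hlaw k, hlaw 0]
  rw [h2] at h1
  exact h1

/-- The averages of the waiting times converge to the Pollaczek–Khinchine value. -/
theorem IsQueue.ae_tendsto_average_waitingTime {lam : ℝ} (hlam : 0 < lam)
    (h : IsQueue μ (expMeasure lam) σ A X) (hσ0 : ∀ᵐ x ∂σ, 0 ≤ x)
    (hσ : MemLp (fun x : ℝ => x) 2 σ) (hd : 0 < 1 / lam - ∫ x, x ∂σ) :
    ∀ᵐ ω ∂μ, Tendsto (fun n : ℕ => (∑ k ∈ Finset.range n,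
      waitingTime (fun i => A i ω) (fun i => X i ω) k) / n) atTop
      (𝓝 ((∫ x, x ^ 2 ∂σ) / (2 * (1 / lam - ∫ x, x ∂σ)))) := by
  have := isProbabilityMeasure_expMeasure hlam
  have := h.isProbabilityMeasure_service
  have hξ : Measurable fun ω => queueIncrement (fun i => A i ω) (fun i => X i ω) :=
    measurable_pi_iff.2 fun k => (h.measurable_service k).sub (h.measurable_arrival (k + 1))
  set ρ := μ.map fun ω => X 0 ω - A 1 ω
  have : IsProbabilityMeasure ρ := Measure.isProbabilityMeasure_map
    ((h.measurable_service 0).sub (h.measurable_arrival 1)).aemeasurable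
  have hlaw : ∀ k, (Measure.infinitePi fun _ : ℕ => ρ).map (fun z => lindley z k)
      = waitLaw (expMeasure lam) σ k := by
    intro k
    rw [← h.map_queueIncrement, Measure.map_map (measurable_lindley k) hξ, ← h.map_waitingTime]
    rfl
  have hint : ∀ k, Integrable (fun z => lindley z k) (Measure.infinitePi fun _ : ℕ => ρ) := by
    intro k
    have h1 : Integrable (fun x : ℝ => x) (waitLaw (expMeasure lam) σ k) :=
      (memLp_two_waitLaw hlam hσ k).integrable (by norm_num)
    rw [← hlaw k] at h1
    exact h1.comp_measurable (measurable_lindley k)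
  have hw : Tendsto (fun k => ∫ z, lindley z k ∂(Measure.infinitePi fun _ : ℕ => ρ)) atTop
      (𝓝 ((∫ x, x ^ 2 ∂σ) / (2 * (1 / lam - ∫ x, x ∂σ)))) := by
    refine (tendsto_integral_waitLaw hlam hσ0 hσ hd).congr fun k => ?_
    rw [← hlaw k, integral_map (measurable_lindley k).aemeasurable (by fun_prop)]
  have hae := ae_tendsto_average_lindley hint hw
  rw [← h.map_queueIncrement] at hae
  exact ae_of_ae_map hξ.aemeasurable hae

/-- The average peak age of an `M/G/1` queue. -/
theorem IsQueue.ae_tendsto_avgPeakAge {lam : ℝ} (hlam : 0 < lam)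
    (h : IsQueue μ (expMeasure lam) σ A X) (hσ0 : ∀ᵐ x ∂σ, 0 < x)
    (hσ : MemLp (fun x : ℝ => x) 2 σ) (hm : 0 < ∫ x, x ∂σ) (hd : 0 < 1 / lam - ∫ x, x ∂σ) :
    ∀ᵐ ω ∂μ, Tendsto (avgPeakAge (fun i => A i ω) (fun i => X i ω)) atTop
      (𝓝 (1 / lam + (∫ x, x ^ 2 ∂σ) / (2 * (1 / lam - ∫ x, x ∂σ)) + ∫ x, x ∂σ)) := by
  have := isProbabilityMeasure_expMeasure hlam
  have := h.isProbabilityMeasure_service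
  have hσi : Integrable (fun x : ℝ => x) σ := hσ.integrable (by norm_num)
  have hei : Integrable (fun x : ℝ => x) (expMeasure lam) := by
    simpa using integrable_pow_expMeasure hlam 1
  have hA1 : ∫ x, x ∂(expMeasure lam) = 1 / lam := by
    simpa using integral_pow_expMeasure hlam 1
  have hA0 : ∀ᵐ ω ∂μ, 0 ≤ A 0 ω := by
    refine ae_of_ae_map (h.measurable_arrival 0).aemeasurable ?_
    rw [h.law_arrival]
    exact ae_expMeasure_nonneg
  have hX0 : ∀ᵐ ω ∂μ, ∀ k, 0 < X k ω := ae_all_iff.2 fun k => by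
    refine ae_of_ae_map (h.measurable_service k).aemeasurable ?_
    rw [h.law_service]
    exact hσ0
  have hA := ae_tendsto_average_of_law h.measurable_arrival h.law_arrival h.indep_arrival hei
  have hX := ae_tendsto_average_of_law h.measurable_service h.law_service h.indep_service hσi
  filter_upwards [hA0, hX0, hA, hX, h.ae_tendsto_average_waitingTime hlam
    (hσ0.mono fun x hx => hx.le) hσ hd] with ω h1 h2 h3 h4 h5
  rw [hA1] at h3
  exact tendsto_avgPeakAge h1 h2 hm h3 h5 h4

end Queue

/-! ### Time integral of the queue length -/

lemma coe_queueLength (A X : ℕ → ℝ) (t : ℝ) : (queueLength A X t : ℝ≥0∞)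
    = ∑' k : ℕ, (Set.Ico (arrivalTime A (k + 1)) (deliveryTime A X (k + 1))).indicator 1 t := by
  have h1 : {k : ℕ | 1 ≤ k ∧ arrivalTime A k ≤ t ∧ t < deliveryTime A X k} = Nat.succ ''
      {k : ℕ | t ∈ Set.Ico (arrivalTime A (k + 1)) (deliveryTime A X (k + 1))} := by
    ext k
    simp only [Set.mem_ofPred_eq, Set.mem_image, Set.mem_Ico]
    constructor
    · rintro ⟨h1, h2⟩
      exact ⟨k - 1, by rwa [Nat.sub_add_cancel h1], Nat.succ_pred_eq_of_pos h1⟩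
    · rintro ⟨j, hj, rfl⟩
      exact ⟨Nat.succ_pos j, hj⟩
  rw [queueLength, h1, Nat.succ_injective.encard_image, ← ENNReal.tsum_set_one,
    tsum_subtype _ fun _ => (1 : ℝ≥0∞)]
  refine tsum_congr fun k => ?_
  by_cases hk : t ∈ Set.Ico (arrivalTime A (k + 1)) (deliveryTime A X (k + 1))
  · rw [Set.indicator_of_mem hk, Set.indicator_of_mem (by exact hk)]
    rfl
  · rw [Set.indicator_of_notMem hk, Set.indicator_of_notMem (by exact hk)]

section Queue

variable {Ω : Type*} [MeasurableSpace Ω] {μ : Measure Ω} {A X : ℕ → Ω → ℝ}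

lemma measurable_arrivalTime (hA : ∀ k, Measurable (A k)) (k : ℕ) :
    Measurable fun ω => arrivalTime (fun i => A i ω) k :=
  Finset.measurable_sum _ fun i _ => hA i

lemma measurable_deliveryTime (hA : ∀ k, Measurable (A k)) (hX : ∀ k, Measurable (X k)) (k : ℕ) :
    Measurable fun ω => deliveryTime (fun i => A i ω) (fun i => X i ω) k := by
  induction k with
  | zero => exact measurable_const
  | succ k ih => exact (ih.max (measurable_arrivalTime hA (k + 1))).add (hX k)

/-- Tonelli: the integrated queue length is the total time that packets spend in the system within
the window. -/
lemma lintegral_queueLength [SFinite μ] (hA : ∀ k, Measurable (A k)) (hX : ∀ k, Measurable (X k))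
    (T : ℝ) :
    ∫⁻ t in Set.Ioc 0 T, ∫⁻ ω, (queueLength (fun i => A i ω) (fun i => X i ω) t : ℝ≥0∞) ∂μ
      = ∑' k : ℕ, ∫⁻ ω, volume (Set.Ico (arrivalTime (fun i => A i ω) (k + 1))
          (deliveryTime (fun i => A i ω) (fun i => X i ω) (k + 1)) ∩ Set.Ioc 0 T) ∂μ := by
  have hm : ∀ k : ℕ, Measurable fun p : ℝ × Ω =>
      (Set.Ico (arrivalTime (fun i => A i p.2) (k + 1))
        (deliveryTime (fun i => A i p.2) (fun i => X i p.2) (k + 1))).indicator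
        (1 : ℝ → ℝ≥0∞) p.1 := by
    intro k
    have hs : MeasurableSet {p : ℝ × Ω | arrivalTime (fun i => A i p.2) (k + 1) ≤ p.1 ∧
        p.1 < deliveryTime (fun i => A i p.2) (fun i => X i p.2) (k + 1)} :=
      (measurableSet_le ((measurable_arrivalTime hA _).comp measurable_snd) measurable_fst).inter
        (measurableSet_lt measurable_fst ((measurable_deliveryTime hA hX (k + 1)).comp measurable_snd))
    exact (measurable_one (α := ℝ≥0∞)).indicator hs
  simp only [coe_queueLength]
  have h1 : ∀ t : ℝ, ∫⁻ ω, ∑' k : ℕ, (Set.Ico (arrivalTime (fun i => A i ω) (k + 1))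
        (deliveryTime (fun i => A i ω) (fun i => X i ω) (k + 1))).indicator (1 : ℝ → ℝ≥0∞) t ∂μ
      = ∑' k : ℕ, ∫⁻ ω, (Set.Ico (arrivalTime (fun i => A i ω) (k + 1))
        (deliveryTime (fun i => A i ω) (fun i => X i ω) (k + 1))).indicator (1 : ℝ → ℝ≥0∞) t ∂μ :=
    fun t => lintegral_tsum fun k => ((hm k).comp measurable_prodMk_left).aemeasurable
  simp only [h1]
  rw [lintegral_tsum fun k => ((hm k).lintegral_prod_right').aemeasurable]
  refine tsum_congr fun k => ?_
  rw [lintegral_lintegral_swap (hm k).aemeasurable]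
  refine lintegral_congr fun ω => ?_
  simp only
  rw [lintegral_indicator_one measurableSet_Ico, Measure.restrict_apply measurableSet_Ico]

end Queue

/-! ### Instability of overloaded queues -/

section Overload

variable {σ : Measure ℝ} {lam : ℝ}

lemma exp_mul_le_integral_exp_neg {ν : Measure ℝ} [IsProbabilityMeasure ν] (hlam : 0 < lam)
    (hν : ∀ᵐ x ∂ν, 0 ≤ x) (L : ℝ) :
    Real.exp (-(lam * L)) * ν.real (Set.Iic L) ≤ ∫ x, Real.exp (-(lam * x)) ∂ν := by
  have h1 : ∫ x, (Set.Iic L).indicator (fun _ => Real.exp (-(lam * L))) x ∂ν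
      = Real.exp (-(lam * L)) * ν.real (Set.Iic L) := by
    rw [integral_indicator_const _ measurableSet_Iic, smul_eq_mul, mul_comm]
  rw [← h1]
  refine integral_mono ((integrable_const _).indicator measurableSet_Iic)
    (integrable_exp_neg hlam hν) fun x => ?_
  by_cases hx : x ∈ Set.Iic L
  · rw [Set.indicator_of_mem hx]
    exact Real.exp_le_exp.2 (neg_le_neg (mul_le_mul_of_nonneg_left hx hlam.le))
  · rw [Set.indicator_of_notMem hx]
    exact (Real.exp_pos _).le

lemma sq_integral_le {ν : Measure ℝ} [IsProbabilityMeasure ν] (h : MemLp (fun x : ℝ => x) 2 ν) :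
    (∫ x, x ∂ν) ^ 2 ≤ ∫ x, x ^ 2 ∂ν := by
  have h1 := variance_nonneg (fun x : ℝ => x) ν
  rw [variance_eq_sub h] at h1
  simpa using h1

variable {Ω : Type*} [MeasurableSpace Ω] {μ : Measure Ω} [IsProbabilityMeasure μ]
  {A X : ℕ → Ω → ℝ}

/-- By Markov's inequality the packet arrives before `T / 2` with probability at least `1/2`, and it
waits longer than `L` with probability at least `3/4`. Both happen with probability at least `1/4`,
and then it spends at least `L` in the window, since `T / 2 + L ≤ T`. -/
lemma IsQueue.le_lintegral_sojourn (hlam : 0 < lam) (h : IsQueue μ (expMeasure lam) σ A X)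
    (hσ0 : ∀ᵐ x ∂σ, 0 ≤ x) {L T : ℝ} (hL : 0 ≤ L) (hT : 2 * L ≤ T) (hT0 : 0 < T) {k : ℕ}
    (hk : (k + 1 : ℝ) ≤ lam * T / 4)
    (hW : (waitLaw (expMeasure lam) σ k).real (Set.Iic L) ≤ 1 / 4) :
    ENNReal.ofReal (L / 4) ≤ ∫⁻ ω, volume (Set.Ico (arrivalTime (fun i => A i ω) (k + 1))
      (deliveryTime (fun i => A i ω) (fun i => X i ω) (k + 1)) ∩ Set.Ioc 0 T) ∂μ := by
  have hWm := measurable_waitingTime h.measurable_arrival h.measurable_service k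
  have ham := measurable_arrivalTime h.measurable_arrival (k + 1)
  set B₁ : Set Ω := {ω | T / 2 ≤ arrivalTime (fun i => A i ω) (k + 1)}
  set B₂ : Set Ω := {ω | waitingTime (fun i => A i ω) (fun i => X i ω) k ≤ L}
  have hB₁m : MeasurableSet B₁ := measurableSet_le measurable_const ham
  have hB₂m : MeasurableSet B₂ := measurableSet_le hWm measurable_const
  have hB₁ : μ.real B₁ ≤ 1 / 2 := by
    refine (h.measureReal_le_arrivalTime_le hlam (k + 1) (half_pos hT0)).trans ?_
    rw [div_div, div_le_iff₀ (by positivity)]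
    push_cast
    linarith
  have hB₂ : μ.real B₂ ≤ 1 / 4 := by
    refine le_trans (le_of_eq ?_) hW
    rw [← h.map_waitingTime k, map_measureReal_apply hWm measurableSet_Iic]
    rfl
  have hG : 1 / 4 ≤ μ.real (B₁ ∪ B₂)ᶜ := by
    rw [probReal_compl_eq_one_sub (hB₁m.union hB₂m)]
    linarith [measureReal_union_le (μ := μ) B₁ B₂]
  have hlow : ∫⁻ ω, (B₁ ∪ B₂)ᶜ.indicator (fun _ => ENNReal.ofReal L) ω ∂μ
      ≤ ∫⁻ ω, volume (Set.Ico (arrivalTime (fun i => A i ω) (k + 1))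
      (deliveryTime (fun i => A i ω) (fun i => X i ω) (k + 1)) ∩ Set.Ioc 0 T) ∂μ := by
    refine lintegral_mono_ae ?_
    filter_upwards [h.ae_arrival_nonneg, h.ae_service_nonneg hσ0] with ω hA hX
    by_cases hω : ω ∈ (B₁ ∪ B₂)ᶜ
    · rw [Set.indicator_of_mem hω]
      simp only [Set.mem_compl_iff, Set.mem_union, not_or, B₁, B₂, Set.mem_ofPred_eq, not_le] at hω
      rw [deliveryTime_succ _ (hA 0)]
      set a := arrivalTime (fun i => A i ω) (k + 1)
      have ha0 : 0 ≤ a := Finset.sum_nonneg fun i _ => hA i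
      have hsub : Set.Ioo a (a + L) ⊆
          Set.Ico a (a + waitingTime (fun i => A i ω) (fun i => X i ω) k + X k ω) ∩ Set.Ioc 0 T := by
        intro x hx
        have := hX k
        exact ⟨⟨hx.1.le, by linarith [hx.2, hω.2]⟩, by linarith [hx.1], by linarith [hx.2, hω.1]⟩
      refine le_trans (le_of_eq ?_) (measure_mono hsub)
      rw [Real.volume_Ioo, add_sub_cancel_left]
    · rw [Set.indicator_of_notMem hω]
      exact bot_le
  refine le_trans ?_ hlow
  rw [lintegral_indicator_const (hB₁m.union hB₂m).compl, ← ofReal_measureReal,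
    ← ENNReal.ofReal_mul hL]
  refine ENNReal.ofReal_le_ofReal ?_
  have := mul_le_mul_of_nonneg_left hG hL
  linarith

variable [IsProbabilityMeasure σ]

lemma integral_exp_neg_systemLaw {ν : Measure ℝ} [IsProbabilityMeasure ν] :
    ∫ x, Real.exp (-(lam * x)) ∂(systemLaw σ ν)
      = (∫ x, Real.exp (-(lam * x)) ∂ν) * ∫ x, Real.exp (-(lam * x)) ∂σ := by
  rw [systemLaw, integral_map (by fun_prop) (by fun_prop),
    ← integral_prod_mul (fun x => Real.exp (-(lam * x))) fun x => Real.exp (-(lam * x))]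
  refine integral_congr_ae (Eventually.of_forall fun p => ?_)
  simp only
  rw [← Real.exp_add]
  ring_nf

/-- At critical load, the waiting times grow without bound in probability. -/
lemma tendsto_waitLaw_Iic_of_critical (hlam : 0 < lam) (hσ0 : ∀ᵐ x ∂σ, 0 ≤ x)
    (hσ : MemLp (fun x : ℝ => x) 2 σ) (hm : ∫ x, x ∂σ = 1 / lam) (L : ℝ) :
    Tendsto (fun k => (waitLaw (expMeasure lam) σ k).real (Set.Iic L)) atTop (𝓝 0) := by
  have := isProbabilityMeasure_expMeasure hlam
  set ν := waitLaw (expMeasure lam) σ with hν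
  set p : ℕ → ℝ := fun k => (ν k).real (Set.Iic L)
  set s := ∫ x, x ^ 2 ∂σ
  set M := ∫ x, Real.exp (-(lam * x)) ∂σ
  have hM : 0 < M := integral_exp_pos (integrable_exp_neg hlam hσ0)
  have hanti : Antitone p := antitone_nat_of_succ_le fun k =>
    ENNReal.toReal_mono (measure_ne_top _ _) ((stochLE_waitLaw_succ k).measure_Iic_ge L)
  set c := Real.exp (-(lam * L)) * M / lam with hc
  have hcpos : 0 < c := by positivity
  have hstep : ∀ k, ∫ x, x ∂(ν k) + c * p k ≤ ∫ x, x ∂(ν (k + 1)) := by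
    intro k
    have h1 := integral_waitLaw_succ hlam hσ0 hσ k
    rw [hm, sub_self, sub_zero] at h1
    have h2 : c * p k ≤ meanIdle lam (systemLaw σ (ν k)) := by
      rw [meanIdle, integral_exp_neg_systemLaw, hc, div_mul_eq_mul_div]
      refine div_le_div_of_nonneg_right ?_ hlam.le
      have := mul_le_mul_of_nonneg_right
        (exp_mul_le_integral_exp_neg hlam (ae_waitLaw_nonneg (e := expMeasure lam) (σ := σ) k) L) hM.le
      linarith
    rw [h1]
    linarith
  have hlow : ∀ n : ℕ, c * (n * p n) ≤ ∫ x, x ∂(ν n) := by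
    intro n
    have h1 : ∀ j ≤ n, c * (j * p n) ≤ ∫ x, x ∂(ν j) := by
      intro j
      induction j with
      | zero => intro _; simpa using integral_waitLaw_nonneg (σ := σ) hlam 0
      | succ j ih =>
        intro hj
        have h2 := ih (by omega)
        have h3 := mul_le_mul_of_nonneg_left (hanti (show j ≤ n by omega)) hcpos.le
        have h4 := hstep j
        push_cast
        linarith
    exact h1 n le_rfl
  -- The linear drift of the second moment recursion vanishes, so the weighted moment equals `n *
  -- s`. With `hlow` this gives `p n ^ 2 ≤ s / (c ^ 2 * n)`.
  have hup : ∀ n : ℕ, (∫ x, x ∂(ν n)) ^ 2 ≤ n * s := by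
    intro n
    have h1 : ∫ x, x ^ 2 ∂(ν n) + 2 / lam * ∫ x, x ∂(ν n) = n * s := by
      induction n with
      | zero => simp [hν, waitLaw]
      | succ n ih =>
        rw [hν, integral_sq_waitLaw_succ hlam hσ0 hσ, ← hν, ih, hm]
        push_cast
        ring
    have h2 := sq_integral_le (memLp_two_waitLaw hlam hσ n)
    have h3 : 0 ≤ 2 / lam * ∫ x, x ∂(ν n) :=
      mul_nonneg (by positivity) (integral_waitLaw_nonneg hlam n)
    linarith
  have hsq : Tendsto (fun n : ℕ => s / c ^ 2 / (n : ℝ)) atTop (𝓝 0) :=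
    tendsto_const_nhds.div_atTop tendsto_natCast_atTop_atTop
  have hp2 : Tendsto (fun n => p n ^ 2) atTop (𝓝 0) := by
    refine squeeze_zero' (Eventually.of_forall fun n => sq_nonneg _) ?_ hsq
    filter_upwards [eventually_gt_atTop 0] with n hn
    have hn' : (0 : ℝ) < n := Nat.cast_pos.2 hn
    rw [div_div, le_div_iff₀ (by positivity)]
    have h1 : (c * (n * p n)) ^ 2 ≤ n * s :=
      (pow_le_pow_left₀ (by positivity) (hlow n) 2).trans (hup n)
    have h2 : (n : ℝ) * (p n ^ 2 * (c ^ 2 * n)) ≤ n * s := by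
      calc (n : ℝ) * (p n ^ 2 * (c ^ 2 * n)) = (c * (n * p n)) ^ 2 := by ring
        _ ≤ n * s := h1
    exact le_of_mul_le_mul_left h2 hn'
  have h := hp2.sqrt
  simp only [Real.sqrt_zero] at h
  exact h.congr fun n => Real.sqrt_sq measureReal_nonneg

/-- Scaling the service times down to critical load only shortens the waits. -/
lemma tendsto_waitLaw_Iic_of_overload (hlam : 0 < lam) (hσ0 : ∀ᵐ x ∂σ, 0 ≤ x)
    (hσ : MemLp (fun x : ℝ => x) 2 σ) (hm : 1 / lam ≤ ∫ x, x ∂σ) (L : ℝ) :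
    Tendsto (fun k => (waitLaw (expMeasure lam) σ k).real (Set.Iic L)) atTop (𝓝 0) := by
  have := isProbabilityMeasure_expMeasure hlam
  have hl : 0 < 1 / lam := by positivity
  set m := ∫ x, x ∂σ
  have hm0 : 0 < m := hl.trans_le hm
  set t := 1 / lam / m
  have ht0 : 0 < t := by positivity
  have ht1 : t ≤ 1 := (div_le_one hm0).2 hm
  set τ := σ.map fun x => x * t
  have : IsProbabilityMeasure τ := Measure.isProbabilityMeasure_map (by fun_prop)
  have hle : StochLE τ σ := by
    have h := stochLE_map (σ := σ) (f := fun x => x * t) (g := fun x => x) (by fun_prop)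
      (by fun_prop) (by filter_upwards [hσ0] with x hx using mul_le_of_le_one_right hx ht1)
    rwa [Measure.map_id'] at h
  have hτ0 : ∀ᵐ x ∂τ, 0 ≤ x := by
    rw [ae_map_iff (by fun_prop) measurableSet_Ici]
    filter_upwards [hσ0] with x hx using mul_nonneg hx ht0.le
  have hτ : MemLp (fun x : ℝ => x) 2 τ := by
    rw [memLp_map_measure_iff (by fun_prop) (by fun_prop)]
    exact hσ.mul_const t
  have hτm : ∫ x, x ∂τ = 1 / lam := by
    rw [integral_map (by fun_prop) (by fun_prop), integral_mul_const]
    exact mul_div_cancel₀ _ hm0.ne'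
  refine squeeze_zero (fun k => measureReal_nonneg) (fun k => ?_)
    (tendsto_waitLaw_Iic_of_critical hlam hτ0 hτ hτm L)
  exact ENNReal.toReal_mono (measure_ne_top _ _) ((hle.waitLaw k).measure_Iic_ge L)

/-- An overloaded queue is not strongly stable. -/
theorem IsQueue.limsup_queueLength_eq_top (hlam : 0 < lam) (h : IsQueue μ (expMeasure lam) σ A X)
    (hσ0 : ∀ᵐ x ∂σ, 0 ≤ x) (hσ : MemLp (fun x : ℝ => x) 2 σ) (hm : 1 / lam ≤ ∫ x, x ∂σ) :
    limsup (fun T : ℝ => (∫⁻ t in Set.Ioc 0 T,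
      ∫⁻ ω, (queueLength (fun i => A i ω) (fun i => X i ω) t : ℝ≥0∞) ∂μ) / ENNReal.ofReal T) atTop
      = ∞ := by
  refine ENNReal.eq_top_of_forall_nnreal_le fun r => ?_
  -- At least `λ T / 8` packets each contribute `L / 4`, and `(λ T / 8) (L / 4) = r T`.
  set L : ℝ := 32 * r / lam
  have hL : 0 ≤ L := by positivity
  obtain ⟨K, hK⟩ := eventually_atTop.1 ((tendsto_waitLaw_Iic_of_overload hlam hσ0 hσ hm
    L).eventually_le_const (show (0 : ℝ) < 1 / 4 by norm_num))
  have hev : ∀ᶠ T : ℝ in atTop, (r : ℝ≥0∞) ≤ (∫⁻ t in Set.Ioc 0 T,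
      ∫⁻ ω, (queueLength (fun i => A i ω) (fun i => X i ω) t : ℝ≥0∞) ∂μ) / ENNReal.ofReal T := by
    filter_upwards [eventually_ge_atTop (2 * L), eventually_gt_atTop 0,
      eventually_ge_atTop (8 * (K + 1) / lam)] with T hT hT0 hTK
    rw [ENNReal.le_div_iff_mul_le (by simp [hT0]) (by simp),
      lintegral_queueLength h.measurable_arrival h.measurable_service]
    rw [div_le_iff₀ hlam] at hTK
    set n := ⌊lam * T / 4⌋₊
    have hn : lam * T / 4 < n + 1 := Nat.lt_floor_add_one _
    have hn' : (n : ℝ) ≤ lam * T / 4 := Nat.floor_le (by positivity)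
    have hKn : K ≤ n := by
      have : (K : ℝ) ≤ n := by linarith
      exact_mod_cast this
    refine le_trans ?_ (ENNReal.sum_le_tsum (Finset.Ico K n))
    have hterm : ∀ k ∈ Finset.Ico K n, ENNReal.ofReal (L / 4) ≤
        ∫⁻ ω, volume (Set.Ico (arrivalTime (fun i => A i ω) (k + 1))
          (deliveryTime (fun i => A i ω) (fun i => X i ω) (k + 1)) ∩ Set.Ioc 0 T) ∂μ := by
      intro k hk
      rw [Finset.mem_Ico] at hk
      refine h.le_lintegral_sojourn hlam hσ0 hL hT hT0 ?_ (hK k hk.1)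
      have : ((k + 1 : ℕ) : ℝ) ≤ n := by exact_mod_cast hk.2
      push_cast at this
      linarith
    refine le_trans ?_ (Finset.card_nsmul_le_sum _ _ _ hterm)
    rw [Nat.card_Ico, nsmul_eq_mul, ← ENNReal.ofReal_coe_nnreal, ← ENNReal.ofReal_mul r.coe_nonneg,
      ← ENNReal.ofReal_natCast, ← ENNReal.ofReal_mul (Nat.cast_nonneg _)]
    refine ENNReal.ofReal_le_ofReal ?_
    rw [Nat.cast_sub hKn]
    have h1 : lam * T / 8 ≤ (n : ℝ) - K := by linarith
    have h2 := mul_le_mul_of_nonneg_right h1 (show 0 ≤ L / 4 by positivity)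
    refine le_trans (le_of_eq ?_) h2
    simp only [L]
    field_simp
    ring
  exact (le_liminf_of_le (by isBoundedDefault) hev).trans (liminf_le_limsup)

end Overload

/-! ### Stability of queues with deterministic service times -/

/-- Gaps that begin by time `T` fill `[0, T]` and, once capped at `1`, overshoot by at most `1`. The
bound by `arrivalTime` is what carries the induction. -/
lemma sum_min_indicator_le {A : ℕ → ℝ} (hA : ∀ k, 0 ≤ A k) {T : ℝ} (hT : 0 ≤ T) (n : ℕ) :
    ∑ k ∈ Finset.range n, (if arrivalTime A (k + 1) ≤ T then min (A (k + 1)) 1 else 0)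
      ≤ min (arrivalTime A (n + 1)) (T + 1) := by
  induction n with
  | zero =>
    rw [Finset.sum_range_zero]
    exact le_min (Finset.sum_nonneg fun i _ => hA i) (by linarith)
  | succ n ih =>
    rw [Finset.sum_range_succ, arrivalTime_succ A (n + 1)]
    have h1 := ih.trans (min_le_left _ _)
    have h2 := ih.trans (min_le_right _ _)
    split_ifs with h
    · exact le_min (by linarith [min_le_left (A (n + 1)) 1]) (by linarith [min_le_right (A (n + 1)) 1])
    · exact le_min (by linarith [hA (n + 1)]) (by linarith)

section Deterministic

variable {Ω : Type*} [MeasurableSpace Ω] {μ : Measure Ω} {lam m : ℝ}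
  {A : ℕ → Ω → ℝ}

/-- The event that packet `k + 1` arrives before time `T`. -/
def arrivedBy (A : ℕ → Ω → ℝ) (T : ℝ) (k : ℕ) : Set Ω :=
  {ω | arrivalTime (fun i => A i ω) (k + 1) ≤ T}

/-- With constant service, the event and the wait depend only on `A 0, …, A k`. The function `φ`
covers both the wait itself and the bare indicator. -/
lemma indepFun_indicator_arrivedBy (hA : ∀ k, Measurable (A k)) (hind : iIndepFun A μ) (T : ℝ)
    {φ : ℝ → ℝ} (hφ : Measurable φ) (k : ℕ) :
    IndepFun ((arrivedBy A T k).indicator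
      fun ω => φ (waitingTime (fun i => A i ω) (fun _ => m) k)) (A (k + 1)) μ := by
  have hWm : Measurable fun z : ℕ → ℝ => waitingTime z (fun _ => m) k :=
    measurable_waitingTime (Ω := ℕ → ℝ) (A := fun i z => z i) (X := fun _ _ => m)
      (fun i => measurable_pi_apply i) (fun _ => measurable_const) k
  have ham : Measurable fun z : ℕ → ℝ => arrivalTime z (k + 1) :=
    measurable_arrivalTime (Ω := ℕ → ℝ) (A := fun i z => z i) (fun i => measurable_pi_apply i) _
  refine indepFun_of_dependsOn (f := A) (S := Finset.range (k + 1)) (T := {k + 1})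
    (F := {z : ℕ → ℝ | arrivalTime z (k + 1) ≤ T}.indicator
      fun z => φ (waitingTime z (fun _ => m) k)) (G := fun z => z (k + 1)) hind hA (by simp)
    ((hφ.comp hWm).indicator (measurableSet_le ham measurable_const)) (by fun_prop)
    (fun x y hxy => ?_) fun x y hxy => hxy (k + 1) (by simp)
  have h1 : arrivalTime x (k + 1) = arrivalTime y (k + 1) := Finset.sum_congr rfl fun i hi =>
    hxy i hi
  have h2 : waitingTime x (fun _ => m) k = waitingTime y (fun _ => m) k :=
    lindley_congr fun i hi => by
      rw [queueIncrement, queueIncrement, hxy (i + 1) (by simpa using hi)]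
  simp only [Set.indicator, Set.mem_ofPred_eq, h1, h2]

lemma memLp_id_dirac (c : ℝ) (p : ℝ≥0∞) : MemLp (fun x : ℝ => x) p (Measure.dirac c) := by
  have : (fun x : ℝ => x) =ᵐ[Measure.dirac c] fun _ => c :=
    (ae_dirac_iff (measurableSet_singleton c)).2 rfl
  exact (memLp_congr_ae this).2 (memLp_const c)

variable [IsProbabilityMeasure μ]

lemma isQueue_const {e : Measure ℝ} (hA : ∀ k, Measurable (A k)) (hlaw : ∀ k, μ.map (A k) = e)
    (hind : iIndepFun A μ) (c : ℝ) :
    IsQueue μ e (Measure.dirac c) A (fun _ _ => c) where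
  measurable_arrival := hA
  measurable_service _ := measurable_const
  law_arrival := hlaw
  law_service _ := by rw [Measure.map_const, measure_univ, one_smul]
  indep_arrival := hind
  indep_service := by
    rw [iIndepFun_iff_map_fun_eq_infinitePi_map fun _ => measurable_const]
    simp only [Measure.map_const, measure_univ, one_smul]
    exact (Measure.infinitePi_dirac _).symm
  indep := indepFun_const_left _ _

/-- A bound for the expected number of arrivals that is linear in time. -/
lemma exists_sum_arrivedBy_le (hlam : 0 < lam) (hA : ∀ k, Measurable (A k))
    (hlaw : ∀ k, μ.map (A k) = expMeasure lam) (hind : iIndepFun A μ)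
    (hA0 : ∀ᵐ ω ∂μ, ∀ k, 0 ≤ A k ω) : ∃ C : ℝ, 0 ≤ C ∧ ∀ T : ℝ, 0 ≤ T → ∀ n : ℕ,
      ∑ k ∈ Finset.range n, μ.real (arrivedBy A T k) ≤ C * (T + 1) := by
  have := isProbabilityMeasure_expMeasure hlam
  have hbd : ∀ᵐ x ∂(expMeasure lam), ‖min x 1‖ ≤ 1 := by
    filter_upwards [ae_expMeasure_nonneg] with x hx
    rw [Real.norm_eq_abs, abs_of_nonneg (le_min hx zero_le_one)]
    exact min_le_right _ _
  have hmini : Integrable (fun x : ℝ => min x 1) (expMeasure lam) :=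
    Integrable.of_bound (by fun_prop) 1 hbd
  set κ := ∫ x, min x 1 ∂(expMeasure lam)
  have hmin0 : 0 ≤ᵐ[expMeasure lam] fun x => min x 1 := by
    filter_upwards [ae_expMeasure_nonneg] with x hx using le_min hx zero_le_one
  have hκ : 0 < κ := by
    refine lt_of_le_of_ne (integral_nonneg_of_ae hmin0) fun h => ?_
    have h1 := (integral_eq_zero_iff_of_nonneg_ae hmin0 hmini).1 h.symm
    have h2 : ∫ x, x ∂(expMeasure lam) = 0 := by
      refine integral_eq_zero_of_ae ?_
      filter_upwards [h1] with x hx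
      simp only [Pi.zero_apply] at hx ⊢
      rcases le_total x 1 with h | h
      · rwa [min_eq_left h] at hx
      · rw [min_eq_right h] at hx
        exact absurd hx one_ne_zero
    have h3 := integral_pow_expMeasure hlam 1
    simp only [pow_one, Nat.factorial_one, Nat.cast_one, h2] at h3
    have : 0 < 1 / lam := by positivity
    linarith
  have hBm : ∀ (T : ℝ) (k : ℕ), MeasurableSet (arrivedBy A T k) := fun T k =>
    measurableSet_le (measurable_arrivalTime hA (k + 1)) measurable_const
  -- A Wald-type estimate: each gap after an arrival by `T` is independent of that arrival, so the
  -- expected count times the mean capped gap `κ` is at most `T + 1`.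
  refine ⟨1 / κ, by positivity, fun T hT n => ?_⟩
  rw [one_div_mul_eq_div, le_div_iff₀ hκ, Finset.sum_mul]
  have hterm : ∀ k, Integrable (fun ω => (arrivedBy A T k).indicator (fun _ => (1 : ℝ)) ω
        * min (A (k + 1) ω) 1) μ ∧
      ∫ ω, (arrivedBy A T k).indicator (fun _ => (1 : ℝ)) ω * min (A (k + 1) ω) 1 ∂μ
        = μ.real (arrivedBy A T k) * κ := by
    intro k
    have hi := (indepFun_indicator_arrivedBy (m := 0) hA hind T
      (φ := fun _ => 1) measurable_const k).comp measurable_id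
      (show Measurable fun x : ℝ => min x 1 by fun_prop)
    have hint1 : Integrable ((arrivedBy A T k).indicator fun _ => (1 : ℝ)) μ :=
      (integrable_const _).indicator (hBm T k)
    have hint2 : Integrable (fun ω => min (A (k + 1) ω) 1) μ := by
      have h1 := hmini
      rw [← hlaw (k + 1)] at h1
      exact h1.comp_measurable (hA (k + 1))
    refine ⟨hi.integrable_mul hint1 hint2, ?_⟩
    refine (hi.integral_mul_eq_mul_integral hint1.aestronglyMeasurable
      hint2.aestronglyMeasurable).trans ?_
    congr 1
    · exact integral_indicator_one (hBm T k)
    · simp only [κ]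
      rw [← hlaw (k + 1), integral_map (hA (k + 1)).aemeasurable (by fun_prop)]
      rfl
  calc ∑ k ∈ Finset.range n, μ.real (arrivedBy A T k) * κ
      = ∫ ω, ∑ k ∈ Finset.range n, (arrivedBy A T k).indicator (fun _ => (1 : ℝ)) ω
        * min (A (k + 1) ω) 1 ∂μ := by
        rw [integral_finsetSum _ fun k _ => (hterm k).1]
        exact Finset.sum_congr rfl fun k _ => (hterm k).2.symm
    _ ≤ ∫ _, (T + 1) ∂μ := by
        refine integral_mono_ae (integrable_finsetSum _ fun k _ => (hterm k).1)
          (integrable_const _) ?_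
        filter_upwards [hA0] with ω hω
        refine le_trans (le_of_eq (Finset.sum_congr rfl fun k _ => ?_))
          ((sum_min_indicator_le hω hT n).trans (min_le_right _ _))
        by_cases h : ω ∈ arrivedBy A T k
        · rw [Set.indicator_of_mem h, one_mul, if_pos (by exact h)]
        · rw [Set.indicator_of_notMem h, zero_mul, if_neg (by exact h)]
    _ = T + 1 := by simp

/-- Expected total waiting time of the packets arriving up to time `T`. -/
lemma sum_integral_waitingTime_le (hlam : 0 < lam) (hA : ∀ k, Measurable (A k))
    (hlaw : ∀ k, μ.map (A k) = expMeasure lam) (hind : iIndepFun A μ)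
    (hA0 : ∀ᵐ ω ∂μ, ∀ k, 0 ≤ A k ω) (T : ℝ) (n : ℕ) :
    2 * (1 / lam - m) * ∑ k ∈ Finset.range n, ∫ ω, (arrivedBy A T k).indicator
        (fun ω => waitingTime (fun i => A i ω) (fun _ => m) k) ω ∂μ
      ≤ (∫ x, (m - x) ^ 2 ∂(expMeasure lam))
        * ∑ k ∈ Finset.range n, μ.real (arrivedBy A T k) := by
  have := isProbabilityMeasure_expMeasure hlam
  have hq := isQueue_const hA hlaw hind m
  set W : ℕ → Ω → ℝ := fun k ω => waitingTime (fun i => A i ω) (fun _ => m) k with hW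
  set B := arrivedBy A T
  have hWm : ∀ k, Measurable (W k) := fun k => measurable_waitingTime hA (fun _ => measurable_const) k
  have hBm : ∀ k : ℕ, MeasurableSet (B k) := fun k =>
    measurableSet_le (measurable_arrivalTime hA (k + 1)) measurable_const
  have he2 : MemLp (fun x : ℝ => x) 2 (expMeasure lam) := by
    simpa using memLp_id_expMeasure hlam 2
  have hW2 : ∀ k, MemLp (W k) 2 μ := fun k => by
    have h1 := memLp_two_waitLaw hlam (memLp_id_dirac m 2) k
    rw [← hq.map_waitingTime k] at h1
    exact h1.comp_of_map (hWm k).aemeasurable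
  have hA2 : ∀ k, MemLp (fun ω => m - A k ω) 2 μ := fun k => by
    have h1 := he2
    rw [← hlaw k] at h1
    exact (memLp_const m).sub (h1.comp_of_map (hA k).aemeasurable)
  have hEA : ∀ k, ∫ ω, (m - A k ω) ∂μ = -(1 / lam - m) := fun k => by
    have h1 : Integrable (fun x : ℝ => x) (expMeasure lam) := he2.integrable (by norm_num)
    have h2 := integral_pow_expMeasure hlam 1
    simp only [pow_one, Nat.factorial_one, Nat.cast_one] at h2
    have h3 : ∫ ω, (m - A k ω) ∂μ = ∫ x, (m - x) ∂(expMeasure lam) := by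
      rw [← hlaw k, integral_map (hA k).aemeasurable (by fun_prop)]
    rw [h3, integral_sub (integrable_const _) h1, h2]
    simp
  have hEA2 : ∀ k, ∫ ω, (m - A k ω) ^ 2 ∂μ = ∫ x, (m - x) ^ 2 ∂(expMeasure lam) := fun k => by
    rw [← hlaw k, integral_map (hA k).aemeasurable (by fun_prop)]
  set v : ℕ → ℝ := fun k => ∫ ω, (B k).indicator (fun ω => W k ω ^ 2) ω ∂μ with hv
  set u : ℕ → ℝ := fun k => ∫ ω, (B k).indicator (W k) ω ∂μ with hu
  set s := ∫ x, (m - x) ^ 2 ∂(expMeasure lam)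
  have hstep : ∀ k, v (k + 1) ≤ v k - 2 * (1 / lam - m) * u k + s * μ.real (B k) := by
    intro k
    have i1 : Integrable ((B k).indicator fun ω => W k ω ^ 2) μ :=
      (hW2 k).integrable_sq.indicator (hBm k)
    have i2 : Integrable ((B k).indicator (W k)) μ :=
      ((hW2 k).integrable (by norm_num)).indicator (hBm k)
    have i3 : Integrable ((B k).indicator fun _ => (1 : ℝ)) μ :=
      (integrable_const _).indicator (hBm k)
    have j1 : Integrable (fun ω => m - A (k + 1) ω) μ := (hA2 (k + 1)).integrable (by norm_num)
    have j2 : Integrable (fun ω => (m - A (k + 1) ω) ^ 2) μ := (hA2 (k + 1)).integrable_sq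
    have ind1 := (indepFun_indicator_arrivedBy (m := m) hA hind T measurable_id k).comp
      measurable_id (show Measurable fun x : ℝ => m - x by fun_prop)
    have ind2 := (indepFun_indicator_arrivedBy (m := m) hA hind T
      (φ := fun _ => 1) measurable_const k).comp
      measurable_id (show Measurable fun x : ℝ => (m - x) ^ 2 by fun_prop)
    have p1 : Integrable (fun ω => (B k).indicator (W k) ω * (m - A (k + 1) ω)) μ :=
      ind1.integrable_mul i2 j1
    have p2 : Integrable (fun ω => (B k).indicator (fun _ => (1 : ℝ)) ω * (m - A (k + 1) ω) ^ 2) μ :=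
      ind2.integrable_mul i3 j2
    have p1' : Integrable (fun ω => 2 * ((B k).indicator (W k) ω * (m - A (k + 1) ω))) μ :=
      p1.const_mul 2
    have p3 : Integrable (fun ω => (B k).indicator (fun ω => W k ω ^ 2) ω
        + 2 * ((B k).indicator (W k) ω * (m - A (k + 1) ω))) μ := i1.add p1'
    have e1 : ∫ ω, (B k).indicator (W k) ω * (m - A (k + 1) ω) ∂μ = u k * -(1 / lam - m) := by
      rw [← hEA (k + 1)]
      exact ind1.integral_mul_eq_mul_integral i2.aestronglyMeasurable j1.aestronglyMeasurable
    have e2 : ∫ ω, (B k).indicator (fun _ => (1 : ℝ)) ω * (m - A (k + 1) ω) ^ 2 ∂μ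
        = μ.real (B k) * s := by
      have h1 : ∫ ω, (B k).indicator (fun _ => (1 : ℝ)) ω ∂μ = μ.real (B k) :=
        integral_indicator_one (hBm k)
      rw [← hEA2 (k + 1), ← h1]
      exact ind2.integral_mul_eq_mul_integral i3.aestronglyMeasurable j2.aestronglyMeasurable
    have hle : v (k + 1) ≤ ∫ ω, ((B k).indicator (fun ω => W k ω ^ 2) ω
        + 2 * ((B k).indicator (W k) ω * (m - A (k + 1) ω))
        + (B k).indicator (fun _ => (1 : ℝ)) ω * (m - A (k + 1) ω) ^ 2) ∂μ := by
      refine integral_mono_ae ((hW2 (k + 1)).integrable_sq.indicator (hBm (k + 1)))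
        (p3.add p2) ?_
      filter_upwards [hA0] with ω hω
      have hrhs : (B k).indicator (fun ω => W k ω ^ 2) ω
        + 2 * ((B k).indicator (W k) ω * (m - A (k + 1) ω))
        + (B k).indicator (fun _ => (1 : ℝ)) ω * (m - A (k + 1) ω) ^ 2
          = (B k).indicator (fun ω => (W k ω + (m - A (k + 1) ω)) ^ 2) ω := by
        by_cases h : ω ∈ B k
        · simp only [Set.indicator_of_mem h]
          ring
        · simp only [Set.indicator_of_notMem h]
          ring
      rw [hrhs]
      by_cases h : ω ∈ B (k + 1)
      · have h' : ω ∈ B k := by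
          have h1 : arrivalTime (fun i => A i ω) (k + 1 + 1) ≤ T := h
          rw [arrivalTime_succ] at h1
          exact (le_add_of_nonneg_right (hω (k + 1))).trans h1
        rw [Set.indicator_of_mem h, Set.indicator_of_mem h']
        have h2 : W (k + 1) ω = max (W k ω + (m - A (k + 1) ω)) 0 := rfl
        rw [h2]
        rcases le_total (W k ω + (m - A (k + 1) ω)) 0 with h3 | h3
        · rw [max_eq_right h3, zero_pow two_ne_zero]
          exact sq_nonneg _
        · rw [max_eq_left h3]
      · rw [Set.indicator_of_notMem h]
        exact Set.indicator_nonneg (fun _ _ => sq_nonneg _) _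
    rw [integral_add p3 p2, integral_add i1 p1',
      integral_const_mul, e1, e2] at hle
    linarith
  have hsum : ∀ n : ℕ, v n + 2 * (1 / lam - m) * ∑ k ∈ Finset.range n, u k
      ≤ s * ∑ k ∈ Finset.range n, μ.real (B k) := by
    intro n
    induction n with
    | zero => simp [hv, hW, waitingTime, lindley]
    | succ n ih =>
      rw [Finset.sum_range_succ, Finset.sum_range_succ, mul_add, mul_add]
      linarith [hstep n]
  have hv0 : 0 ≤ v n := integral_nonneg fun ω => Set.indicator_nonneg (fun _ _ => sq_nonneg _) _
  linarith [hsum n]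

/-- An underloaded queue with Poisson arrivals and constant service times is strongly stable. -/
theorem limsup_queueLength_const_lt_top (hlam : 0 < lam) (hA : ∀ k, Measurable (A k))
    (hlaw : ∀ k, μ.map (A k) = expMeasure lam) (hind : iIndepFun A μ) (hm0 : 0 ≤ m)
    (hm : m < 1 / lam) :
    limsup (fun T : ℝ => (∫⁻ t in Set.Ioc 0 T,
      ∫⁻ ω, (queueLength (fun i => A i ω) (fun _ => m) t : ℝ≥0∞) ∂μ) / ENNReal.ofReal T) atTop
      < ∞ := by
  have := isProbabilityMeasure_expMeasure hlam
  have hq := isQueue_const hA hlaw hind m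
  have hA0 := hq.ae_arrival_nonneg
  obtain ⟨C, hC0, hC⟩ := exists_sum_arrivedBy_le hlam hA hlaw hind hA0
  set s := ∫ x, (m - x) ^ 2 ∂(expMeasure lam)
  have hs0 : 0 ≤ s := integral_nonneg fun x => sq_nonneg _
  have hd : 0 < 2 * (1 / lam - m) := by linarith
  set K := (s / (2 * (1 / lam - m)) + m) * C
  have hK0 : 0 ≤ K := by positivity
  have hWi : ∀ k, Integrable (fun ω => waitingTime (fun i => A i ω) (fun _ => m) k) μ := fun k => by
    have h1 : Integrable (fun x : ℝ => x) (waitLaw (expMeasure lam) (Measure.dirac m) k) :=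
      (memLp_two_waitLaw hlam (memLp_id_dirac m 2) k).integrable (by norm_num)
    rw [← hq.map_waitingTime k] at h1
    exact h1.comp_measurable (measurable_waitingTime hA (fun _ => measurable_const) k)
  have hbound : ∀ T : ℝ, 0 ≤ T → ∫⁻ t in Set.Ioc 0 T,
      ∫⁻ ω, (queueLength (fun i => A i ω) (fun _ => m) t : ℝ≥0∞) ∂μ
        ≤ ENNReal.ofReal (K * (T + 1)) := by
    intro T hT
    have hBm : ∀ k : ℕ, MeasurableSet (arrivedBy A T k) := fun k =>
      measurableSet_le (measurable_arrivalTime hA (k + 1)) measurable_const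
    rw [lintegral_queueLength (X := fun _ _ => m) hA fun _ => measurable_const]
    refine ENNReal.tsum_le_of_sum_range_le fun n => ?_
    have hterm : ∀ k, ∫⁻ ω, volume (Set.Ico (arrivalTime (fun i => A i ω) (k + 1))
        (deliveryTime (fun i => A i ω) (fun _ => m) (k + 1)) ∩ Set.Ioc 0 T) ∂μ
        ≤ ENNReal.ofReal (∫ ω, (arrivedBy A T k).indicator
            (fun ω => waitingTime (fun i => A i ω) (fun _ => m) k) ω ∂μ
          + m * μ.real (arrivedBy A T k)) := by
      intro k
      have hi1 := (hWi k).indicator (hBm k)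
      have hi2 : Integrable ((arrivedBy A T k).indicator fun _ => m) μ :=
        (integrable_const m).indicator (hBm k)
      have h1 : ∫ ω, (arrivedBy A T k).indicator
            (fun ω => waitingTime (fun i => A i ω) (fun _ => m) k) ω ∂μ
          + m * μ.real (arrivedBy A T k) = ∫ ω, ((arrivedBy A T k).indicator
            (fun ω => waitingTime (fun i => A i ω) (fun _ => m) k) ω
            + (arrivedBy A T k).indicator (fun _ => m) ω) ∂μ := by
        rw [integral_add hi1 hi2, integral_indicator_const _ (hBm k), smul_eq_mul, mul_comm]
      have hi3 : Integrable (fun ω => (arrivedBy A T k).indicator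
            (fun ω => waitingTime (fun i => A i ω) (fun _ => m) k) ω
            + (arrivedBy A T k).indicator (fun _ => m) ω) μ := hi1.add hi2
      rw [h1, ofReal_integral_eq_lintegral_ofReal hi3 (Eventually.of_forall fun ω =>
        add_nonneg (Set.indicator_nonneg (fun _ _ => waitingTime_nonneg _ _ _) _)
          (Set.indicator_nonneg (fun _ _ => hm0) _))]
      refine lintegral_mono_ae ?_
      filter_upwards [hA0] with ω hω
      by_cases h : ω ∈ arrivedBy A T k
      · rw [Set.indicator_of_mem h, Set.indicator_of_mem h]
        refine (measure_mono Set.inter_subset_left).trans ?_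
        rw [Real.volume_Ico, deliveryTime_succ _ (hω 0)]
        exact ENNReal.ofReal_le_ofReal (by linarith)
      · have : Set.Ico (arrivalTime (fun i => A i ω) (k + 1))
            (deliveryTime (fun i => A i ω) (fun _ => m) (k + 1)) ∩ Set.Ioc 0 T = ∅ := by
          rw [Set.eq_empty_iff_forall_notMem]
          intro t ht
          exact h (ht.1.1.trans ht.2.2)
        rw [this, measure_empty]
        exact bot_le
    refine (Finset.sum_le_sum fun k _ => hterm k).trans ?_
    rw [← ENNReal.ofReal_sum_of_nonneg fun k _ => add_nonneg (integral_nonneg fun ω =>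
      Set.indicator_nonneg (fun _ _ => waitingTime_nonneg _ _ _) _)
      (mul_nonneg hm0 measureReal_nonneg)]
    refine ENNReal.ofReal_le_ofReal ?_
    rw [Finset.sum_add_distrib, ← Finset.mul_sum]
    have h1 := sum_integral_waitingTime_le (m := m) hlam hA hlaw hind hA0 T n
    have h2 := hC T hT n
    rw [mul_comm, ← le_div_iff₀ hd] at h1
    have h3 : s * (∑ k ∈ Finset.range n, μ.real (arrivedBy A T k)) / (2 * (1 / lam - m))
        ≤ s / (2 * (1 / lam - m)) * (C * (T + 1)) := by
      rw [mul_div_right_comm]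
      exact mul_le_mul_of_nonneg_left h2 (by positivity)
    have h4 := mul_le_mul_of_nonneg_left h2 hm0
    have h5 : K * (T + 1) = s / (2 * (1 / lam - m)) * (C * (T + 1)) + m * (C * (T + 1)) := by
      simp only [K]
      ring
    linarith
  refine lt_of_le_of_lt (limsup_le_of_le (by isBoundedDefault) ?_)
    (ENNReal.ofReal_lt_top (r := 2 * K))
  filter_upwards [eventually_ge_atTop 1] with T hT
  refine ENNReal.div_le_of_le_mul ((hbound T (by linarith)).trans ?_)
  rw [← ENNReal.ofReal_mul (by positivity)]
  refine ENNReal.ofReal_le_ofReal ?_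
  nlinarith

end Deterministic

/-! ### The channel constraint -/

lemma le_numScheduled {X : ℕ → ℝ} {t : ℝ} {r : ℕ} (h : ∑ k ∈ Finset.range r, X k ≤ t) :
    (r : ℕ∞) ≤ numScheduled X t :=
  le_iSup₂_of_le (f := fun (r : ℕ) (_ : ∑ k ∈ Finset.range r, X k ≤ t) => (r : ℕ∞)) r h le_rfl

/-- For large `T`, the first `⌊T / c⌋` intervals have average below `c` and so fit into `[0, T]`. -/
lemma eventually_le_numScheduled {X : ℕ → ℝ} {m c : ℝ} (hm : 0 < m) (hc : m < c)
    (hX : Tendsto (fun n : ℕ => (∑ i ∈ Finset.range n, X i) / n) atTop (𝓝 m)) :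
    ∀ᶠ T : ℝ in atTop, ENNReal.ofReal (T / c - 1) ≤ (numScheduled X T : ℝ≥0∞) := by
  have hc0 : 0 < c := hm.trans hc
  obtain ⟨r₀, hr₀⟩ := eventually_atTop.1 (hX.eventually_lt_const hc)
  filter_upwards [eventually_ge_atTop (c * (r₀ + 1))] with T hT
  have hT0 : 0 ≤ T := le_trans (by positivity) hT
  set r := ⌊T / c⌋₊
  have h1 : (r : ℝ) ≤ T / c := Nat.floor_le (by positivity)
  have h2 : T / c < r + 1 := Nat.lt_floor_add_one _
  have h3 : r₀ + 1 ≤ r := by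
    refine Nat.le_floor ?_
    rw [le_div_iff₀ hc0]
    push_cast
    linarith
  have hr : (0 : ℝ) < r := by
    have : 0 < r := by omega
    exact_mod_cast this
  have h4 := (div_lt_iff₀ hr).1 (hr₀ r (by omega))
  have h5 : ∑ i ∈ Finset.range r, X i ≤ T := by
    rw [le_div_iff₀ hc0] at h1
    linarith
  have h6 : ((r : ℕ∞) : ℝ≥0∞) ≤ (numScheduled X T : ℝ≥0∞) :=
    ENat.toENNReal_le.2 (le_numScheduled h5)
  refine le_trans ?_ h6
  rw [ENat.toENNReal_coe, ← ENNReal.ofReal_natCast]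
  exact ENNReal.ofReal_le_ofReal (by linarith)

/-- The scheduling rates of policies that respect the channel add up to at most `1`. -/
lemma sum_inv_le_one_of_limsup_le {N : ℕ} {X : Fin N → ℕ → ℝ} {m : Fin N → ℝ} (hm : ∀ n, 0 < m n)
    (hX : ∀ n, Tendsto (fun r : ℕ => (∑ i ∈ Finset.range r, X n i) / r) atTop (𝓝 (m n)))
    (hlim : limsup (fun T : ℝ => (∑ n, (numScheduled (X n) T : ℝ≥0∞)) / ENNReal.ofReal T) atTop
      ≤ 1) : ∑ n, 1 / m n ≤ 1 := by
  have hle : ∀ ε : ℝ, 0 < ε → ∑ n, 1 / (m n + ε) ≤ 1 := by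
    intro ε hε
    by_contra hlt
    set c := ∑ n, 1 / (m n + ε)
    have hc : 1 < c := not_le.1 hlt
    have hev : ∀ᶠ T : ℝ in atTop, ENNReal.ofReal ((1 + c) / 2)
        ≤ (∑ n, (numScheduled (X n) T : ℝ≥0∞)) / ENNReal.ofReal T := by
      -- Rounding costs at most one scheduling per terminal, `N` in all; for `T ≥ 2 N / (c - 1)`
      -- this still leaves the rate `(1 + c) / 2 > 1`.
      filter_upwards [eventually_all.2 fun n => eventually_le_numScheduled (hm n)
        (lt_add_of_pos_right (m n) hε) (hX n), eventually_gt_atTop 0,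
        eventually_ge_atTop (2 * N / (c - 1))] with T hT hT0 hT1
      rw [ENNReal.le_div_iff_mul_le (by simp [hT0]) (by simp)]
      refine le_trans ?_ (Finset.sum_le_sum fun n _ => hT n)
      refine le_trans ?_ (Finset.le_sum_of_subadditive ENNReal.ofReal ENNReal.ofReal_zero.le
        (fun _ _ => ENNReal.ofReal_add_le) Finset.univ fun n => T / (m n + ε) - 1)
      rw [← ENNReal.ofReal_mul (by linarith)]
      refine ENNReal.ofReal_le_ofReal ?_
      have h1 : ∑ n, (T / (m n + ε) - 1) = T * c - N := by
        rw [Finset.sum_sub_distrib, Finset.mul_sum]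
        simp [div_eq_mul_inv]
      rw [h1]
      rw [div_le_iff₀ (by linarith)] at hT1
      nlinarith
    have h1 := (le_liminf_of_le (by isBoundedDefault) hev).trans
      (le_trans liminf_le_limsup hlim)
    rw [ENNReal.ofReal_le_one] at h1
    linarith
  have hcont : Tendsto (fun ε : ℝ => ∑ n, 1 / (m n + ε)) (𝓝[>] 0) (𝓝 (∑ n, 1 / m n)) := by
    refine tendsto_finsetSum _ fun n _ => ?_
    have h1 : Tendsto (fun ε : ℝ => m n + ε) (𝓝[>] 0) (𝓝 (m n + 0)) :=
      (tendsto_const_nhds.add tendsto_id).mono_left nhdsWithin_le_nhds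
    rw [add_zero] at h1
    exact tendsto_const_nhds.div h1 (hm n).ne'
  exact le_of_tendsto hcont (eventually_mem_nhdsWithin.mono fun ε hε => hle ε hε)

lemma numScheduled_const_le {b : ℝ} (hb : 0 < b) {T : ℝ} (hT : 0 ≤ T) :
    (numScheduled (fun _ => 1 / b) T : ℝ≥0∞) ≤ ENNReal.ofReal (b * T) := by
  have h1 : numScheduled (fun _ => 1 / b) T ≤ ((⌊b * T⌋₊ : ℕ) : ℕ∞) := by
    refine iSup₂_le fun r hr => ?_
    rw [Finset.sum_const, Finset.card_range, nsmul_eq_mul, mul_one_div, div_le_iff₀ hb] at hr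
    exact_mod_cast Nat.le_floor (by linarith)
  refine (ENat.toENNReal_le.2 h1).trans ?_
  rw [ENat.toENNReal_coe, ← ENNReal.ofReal_natCast]
  exact ENNReal.ofReal_le_ofReal (Nat.floor_le (by positivity))

/-! ### The convex problem -/

section Convex

variable {N : ℕ} {lam : Fin N → ℝ}

lemma inv_convexComb_lt {x y a b : ℝ} (hx : 0 < x) (hy : 0 < y) (hxy : x ≠ y) (ha : 0 < a)
    (hb : 0 < b) (hab : a + b = 1) : 1 / (a * x + b * y) < a * (1 / x) + b * (1 / y) := by
  have h : a * (1 / x) + b * (1 / y) - 1 / (a * x + b * y)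
      = a * b * (x - y) ^ 2 / (x * y * (a * x + b * y)) := by
    obtain rfl : b = 1 - a := by linarith
    have : a * x + (1 - a) * y ≠ 0 := by positivity
    field_simp
    ring
  have h2 : 0 < a * b * (x - y) ^ 2 / (x * y * (a * x + b * y)) := by
    have : 0 < (x - y) ^ 2 := by
      have := sub_ne_zero.2 hxy
      positivity
    positivity
  linarith

lemma convex_setOf_forall_lt (lam : Fin N → ℝ) : Convex ℝ {β : Fin N → ℝ | ∀ n, lam n < β n} := by
  intro β hβ γ hγ a b ha hb hab n
  exact convex_Ioi (lam n) (hβ n) (hγ n) ha hb hab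

lemma convex_feasibleP2 (lam : Fin N → ℝ) : Convex ℝ (feasibleP2 lam) := by
  intro β hβ γ hγ a b ha hb hab
  refine ⟨convex_setOf_forall_lt lam hβ.1 hγ.1 ha hb hab, ?_⟩
  simp only [Pi.add_apply, Pi.smul_apply, smul_eq_mul]
  rw [Finset.sum_add_distrib, ← Finset.mul_sum, ← Finset.mul_sum, hβ.2, hγ.2]
  linarith

lemma strictConvexOn_objectiveP2 (hN : 0 < N) (hlam : ∀ n, 0 < lam n) :
    StrictConvexOn ℝ {β : Fin N → ℝ | ∀ n, lam n < β n} (objectiveP2 lam) := by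
  refine ⟨convex_setOf_forall_lt lam, fun β hβ γ hγ hne a b ha hb hab => ?_⟩
  have hN' : (0 : ℝ) < 1 / N := by positivity
  have hterm : ∀ n, β n ≠ γ n →
      1 / lam n + 1 / 2 * (1 / ((a • β + b • γ) n - lam n) + 1 / (a • β + b • γ) n)
      < a * (1 / lam n + 1 / 2 * (1 / (β n - lam n) + 1 / β n))
        + b * (1 / lam n + 1 / 2 * (1 / (γ n - lam n) + 1 / γ n)) := by
    intro n hn
    have h1 := inv_convexComb_lt (sub_pos.2 (hβ n)) (sub_pos.2 (hγ n))
      (fun h => hn (sub_left_inj.1 h)) ha hb hab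
    have h2 := inv_convexComb_lt ((hlam n).trans (hβ n)) ((hlam n).trans (hγ n)) hn ha hb hab
    have h3 : (a • β + b • γ) n - lam n = a * (β n - lam n) + b * (γ n - lam n) := by
      simp only [Pi.add_apply, Pi.smul_apply, smul_eq_mul]
      linear_combination (lam n) * hab
    have h4 : (a • β + b • γ) n = a * β n + b * γ n := rfl
    have h5 : a * (1 / lam n) + b * (1 / lam n) = 1 / lam n := by rw [← add_mul, hab, one_mul]
    rw [h3, h4]
    linarith
  obtain ⟨n, hn⟩ := Function.ne_iff.1 hne
  have hsum := Finset.sum_lt_sum (s := Finset.univ)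
    (f := fun n => 1 / lam n + 1 / 2 * (1 / ((a • β + b • γ) n - lam n) + 1 / (a • β + b • γ) n))
    (g := fun n => a * (1 / lam n + 1 / 2 * (1 / (β n - lam n) + 1 / β n))
        + b * (1 / lam n + 1 / 2 * (1 / (γ n - lam n) + 1 / γ n)))
    (fun n _ => by
      by_cases h : β n = γ n
      · refine le_of_eq ?_
        have h4 : (a • β + b • γ) n = γ n := by
          simp only [Pi.add_apply, Pi.smul_apply, smul_eq_mul, h]
          rw [← add_mul, hab, one_mul]
        simp only [h4, h]
        rw [← add_mul, hab, one_mul]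
      · exact (hterm n h).le) ⟨n, Finset.mem_univ n, hterm n hn⟩
  rw [Finset.sum_add_distrib (f := fun n => a * (1 / lam n + 1 / 2 * (1 / (β n - lam n) + 1 / β n))),
    ← Finset.mul_sum, ← Finset.mul_sum] at hsum
  have := mul_lt_mul_of_pos_left hsum hN'
  simp only [objectiveP2, smul_eq_mul]
  linarith

/-- The feasible set is not closed, but the objective blows up as some `β n` approaches `lam n`. A
minimum over a compact part containing `β₀` is therefore global. -/
lemma exists_solvesP2 (hN : 0 < N) (hlam : ∀ n, 0 < lam n) (hsum : ∑ n, lam n < 1) :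
    ∃ β, SolvesP2 lam β := by
  have hN' : (0 : ℝ) < N := Nat.cast_pos.2 hN
  set η := (1 - ∑ n, lam n) / N with hη
  have hη0 : 0 < η := div_pos (by linarith) hN'
  set β₀ : Fin N → ℝ := fun n => lam n + η
  have hβ₀sum : ∑ n, β₀ n = 1 := by
    simp only [β₀, Finset.sum_add_distrib, Finset.sum_const, Finset.card_univ, Fintype.card_fin,
      nsmul_eq_mul, hη]
    field_simp
    ring
  have hpos : ∀ β : Fin N → ℝ, (∀ n, lam n < β n) → ∀ n,
      1 / 2 * (1 / (β n - lam n)) < 1 / lam n + 1 / 2 * (1 / (β n - lam n) + 1 / β n) := by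
    intro β hβ n
    have h1 : 0 < 1 / lam n := one_div_pos.2 (hlam n)
    have h2 : 0 < 1 / β n := one_div_pos.2 ((hlam n).trans (hβ n))
    linarith
  have hpos' : ∀ β : Fin N → ℝ, (∀ n, lam n < β n) → ∀ n,
      0 < 1 / lam n + 1 / 2 * (1 / (β n - lam n) + 1 / β n) := fun β hβ n =>
    lt_trans (by have := sub_pos.2 (hβ n); positivity) (hpos β hβ n)
  have hβ₀ : ∀ n, lam n < β₀ n := fun n => lt_add_of_pos_right _ hη0
  set v := objectiveP2 lam β₀
  have hv : 0 < v := mul_pos (by positivity)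
    (Finset.sum_pos (fun n _ => hpos' β₀ hβ₀ n) ⟨⟨0, hN⟩, Finset.mem_univ _⟩)
  -- Within `1 / (2 * N * v)` of the boundary a single summand already reaches `N * v`, so the
  -- objective is at least `v`; the bound by `η` keeps `β₀` in `K`.
  set δ := min η (1 / (2 * N * v))
  have hδ0 : 0 < δ := lt_min hη0 (by positivity)
  set K : Set (Fin N → ℝ) := {β | (∀ n, lam n + δ ≤ β n) ∧ ∑ n, β n = 1}
  have hKsub : K ⊆ feasibleP2 lam := fun β hβ =>
    ⟨fun n => (lt_add_of_pos_right _ hδ0).trans_le (hβ.1 n), hβ.2⟩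
  have hKclosed : IsClosed K := by
    have : K = (⋂ n, {β : Fin N → ℝ | lam n + δ ≤ β n}) ∩ {β | ∑ n, β n = 1} := by
      ext β
      simp [K]
    rw [this]
    exact (isClosed_iInter fun n => isClosed_le continuous_const (continuous_apply n)).inter
      (isClosed_eq (continuous_finsetSum _ fun n _ => continuous_apply n) continuous_const)
  have hKcompact : IsCompact K := by
    refine (isCompact_univ_pi fun _ : Fin N => isCompact_Icc (a := (0 : ℝ)) (b := 1)).of_isClosed_subset
      hKclosed fun β hβ => ?_
    have h0 : ∀ n, 0 ≤ β n := fun n => (hlam n).le.trans ((hKsub hβ).1 n).le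
    exact fun n _ => ⟨h0 n, hβ.2 ▸ Finset.single_le_sum (f := β) (fun i _ => h0 i) (Finset.mem_univ n)⟩
  have hcont : ContinuousOn (objectiveP2 lam) K := by
    refine continuousOn_const.mul (continuousOn_finsetSum _ fun n _ => continuousOn_const.add
      (continuousOn_const.mul (ContinuousOn.add ?_ ?_)))
    · exact continuousOn_const.div ((continuous_apply n).continuousOn.sub continuousOn_const)
        fun β hβ => (sub_pos.2 ((hKsub hβ).1 n)).ne'
    · exact continuousOn_const.div (continuous_apply n).continuousOn
        fun β hβ => ((hlam n).trans ((hKsub hβ).1 n)).ne'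
  have hβ₀K : β₀ ∈ K := ⟨fun n => add_le_add le_rfl (min_le_left _ _), hβ₀sum⟩
  obtain ⟨β, hβK, hβ⟩ := hKcompact.exists_isMinOn ⟨β₀, hβ₀K⟩ hcont
  refine ⟨β, hKsub hβK, fun γ hγ => ?_⟩
  by_cases hγK : γ ∈ K
  · exact hβ hγK
  · obtain ⟨n, hn⟩ : ∃ n, γ n < lam n + δ := by
      by_contra h
      push Not at h
      exact hγK ⟨h, hγ.2⟩
    refine (show objectiveP2 lam β ≤ v from hβ hβ₀K).trans ?_
    have h1 := Finset.single_le_sum (f := fun n =>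
      1 / lam n + 1 / 2 * (1 / (γ n - lam n) + 1 / γ n)) (fun i _ => (hpos' γ hγ.1 i).le)
      (Finset.mem_univ n)
    have h2 := (hpos γ hγ.1 n).le.trans h1
    have h3 : 0 < γ n - lam n := sub_pos.2 (hγ.1 n)
    have h4 : γ n - lam n ≤ 1 / (2 * N * v) := le_trans (by linarith) (min_le_right η _)
    have h5 : 2 * N * v ≤ 1 / (γ n - lam n) := by
      rw [le_one_div (by positivity) h3]
      exact h4
    show v ≤ 1 / (N : ℝ) * _
    rw [one_div_mul_eq_div, le_div_iff₀ hN']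
    linarith

lemma SolvesP2.eq (hN : 0 < N) (hlam : ∀ n, 0 < lam n) {β γ : Fin N → ℝ} (hβ : SolvesP2 lam β)
    (hγ : SolvesP2 lam γ) : γ = β :=
  ((strictConvexOn_objectiveP2 hN hlam).subset (fun _ h => h.1)
    (convex_feasibleP2 lam)).eq_of_isMinOn hγ.2 hβ.2 hγ.1 hβ.1

/-- Relaxing the constraint `∑ β = 1` to `∑ β ≤ 1` changes neither the minimum nor the minimizer. -/
lemma SolvesP2.le_of_sum_le (hN : 0 < N) (hlam : ∀ n, 0 < lam n) {β γ : Fin N → ℝ}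
    (hβ : SolvesP2 lam β) (hγ : ∀ n, lam n < γ n) (hsum : ∑ n, γ n ≤ 1) :
    objectiveP2 lam β ≤ objectiveP2 lam γ ∧ (objectiveP2 lam γ = objectiveP2 lam β → γ = β) := by
  have hN' : (0 : ℝ) < N := Nat.cast_pos.2 hN
  rcases hsum.eq_or_lt with h1 | h1
  · have hf : γ ∈ feasibleP2 lam := ⟨hγ, h1⟩
    refine ⟨hβ.2 hf, fun h => hβ.eq hN hlam ⟨hf, fun x hx => ?_⟩⟩
    show objectiveP2 lam γ ≤ objectiveP2 lam x
    rw [h]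
    exact hβ.2 hx
  -- Unused capacity, shared equally, strictly lowers every summand.
  · set η := (1 - ∑ n, γ n) / N with hη
    have hη0 : 0 < η := div_pos (by linarith) hN'
    have hf : (fun n => γ n + η) ∈ feasibleP2 lam := by
      refine ⟨fun n => (hγ n).trans (lt_add_of_pos_right _ hη0), ?_⟩
      simp only [Finset.sum_add_distrib, Finset.sum_const, Finset.card_univ, Fintype.card_fin,
        nsmul_eq_mul, hη]
      field_simp
      ring
    have hlt : objectiveP2 lam (fun n => γ n + η) < objectiveP2 lam γ := by
      refine mul_lt_mul_of_pos_left (Finset.sum_lt_sum_of_nonempty ⟨⟨0, hN⟩, Finset.mem_univ _⟩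
        fun n _ => ?_) (by positivity)
      have h2 : 1 / (γ n + η - lam n) < 1 / (γ n - lam n) :=
        one_div_lt_one_div_of_lt (sub_pos.2 (hγ n)) (by linarith)
      have h3 : 1 / (γ n + η) < 1 / γ n :=
        one_div_lt_one_div_of_lt ((hlam n).trans (hγ n)) (by linarith)
      linarith
    have h2 := lt_of_le_of_lt (show objectiveP2 lam β ≤ _ from hβ.2 hf) hlt
    exact ⟨h2.le, fun h => absurd h h2.ne'⟩

end Convex

/-! ### AIR policies: moments of the intervals, constraints and cost -/

section Policy

variable {Ω : Type*} [MeasurableSpace Ω] {μ : Measure Ω} {N : ℕ}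
  {lam : Fin N → ℝ} {A X : Fin N → ℕ → Ω → ℝ}

lemma IsPoissonArrivals.indep_terminal (hA : IsPoissonArrivals μ lam A) (n : Fin N) :
    iIndepFun (A n) μ :=
  hA.indep.precomp (g := fun k : ℕ => (n, k)) fun _ _ h => (Prod.mk.inj h).2

lemma IsAIR.isQueue (hA : IsPoissonArrivals μ lam A) (hX : IsAIR μ A X) (n : Fin N) :
    IsQueue μ (expMeasure (lam n)) (μ.map (X n 0)) (A n) (X n) where
  measurable_arrival := hA.measurable n
  measurable_service := hX.measurable n
  law_arrival := hA.law n
  law_service k := (hX.identDistrib n k).map_eq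
  indep_arrival := hA.indep_terminal n
  indep_service := hX.indep n
  indep := by
    have hproj : Measurable fun (z : Fin N × ℕ → ℝ) (k : ℕ) => z (n, k) := by fun_prop
    exact hX.arrivalIndep.comp hproj hproj

/-- Mean of the scheduling intervals of terminal `n`. -/
noncomputable def meanInterval (μ : Measure Ω) (X : Fin N → ℕ → Ω → ℝ) (n : Fin N) : ℝ :=
  ∫ x, x ∂(μ.map (X n 0))

/-- Second moment of the scheduling intervals of terminal `n`. -/
noncomputable def sqMeanInterval (μ : Measure Ω) (X : Fin N → ℕ → Ω → ℝ) (n : Fin N) : ℝ :=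
  ∫ x, x ^ 2 ∂(μ.map (X n 0))

/-- Stationary mean peak age of an `M/G/1` queue with arrival rate `l` and service times with mean
`m` and second moment `s`. -/
noncomputable def meanPeakAge (l m s : ℝ) : ℝ := 1 / l + s / (2 * (1 / l - m)) + m

/-- The summand of P2 is the Pollaczek–Khinchine cost of constant service times `1 / b`. -/
lemma meanPeakAge_sq {l b : ℝ} (hl : 0 < l) (hb : l < b) :
    meanPeakAge l (1 / b) ((1 / b) ^ 2) = 1 / l + 1 / 2 * (1 / (b - l) + 1 / b) := by
  have h1 : b ≠ 0 := (hl.trans hb).ne'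
  have h2 : b - l ≠ 0 := (sub_pos.2 hb).ne'
  have h3 : 1 / l - 1 / b = (b - l) / (l * b) := by field_simp
  rw [meanPeakAge, h3]
  field_simp
  ring

lemma IsAIR.ae_map_pos (hX : IsAIR μ A X) (n : Fin N) : ∀ᵐ x ∂(μ.map (X n 0)), 0 < x :=
  (ae_map_iff (hX.measurable n 0).aemeasurable measurableSet_Ioi).2 (hX.pos n 0)

lemma IsAIR.memLp_map (hX : IsAIR μ A X) (n : Fin N) :
    MemLp (fun x : ℝ => x) 2 (μ.map (X n 0)) := by
  rw [memLp_map_measure_iff (by fun_prop) (hX.measurable n 0).aemeasurable]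
  exact hX.memLp_two n

variable [IsProbabilityMeasure μ]

lemma IsAIR.isProbabilityMeasure_map (hX : IsAIR μ A X) (n : Fin N) :
    IsProbabilityMeasure (μ.map (X n 0)) :=
  Measure.isProbabilityMeasure_map (hX.measurable n 0).aemeasurable

lemma IsAIR.meanInterval_pos (hX : IsAIR μ A X) (n : Fin N) : 0 < meanInterval μ X n := by
  have := hX.isProbabilityMeasure_map n
  have hint : Integrable (fun x : ℝ => x) (μ.map (X n 0)) := (hX.memLp_map n).integrable (by norm_num)
  have h0 : 0 ≤ᵐ[μ.map (X n 0)] fun x : ℝ => x := (hX.ae_map_pos n).mono fun x hx => hx.le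
  refine lt_of_le_of_ne (integral_nonneg_of_ae h0) fun h => ?_
  have h1 := (integral_eq_zero_iff_of_nonneg_ae h0 hint).1 h.symm
  obtain ⟨x, hx1, hx2⟩ := (h1.and (hX.ae_map_pos n)).exists
  exact hx2.ne' hx1

lemma IsAIR.sq_meanInterval_le (hX : IsAIR μ A X) (n : Fin N) :
    meanInterval μ X n ^ 2 ≤ sqMeanInterval μ X n := by
  have := hX.isProbabilityMeasure_map n
  exact sq_integral_le (hX.memLp_map n)

/-- The variance is zero. -/
lemma IsAIR.ae_eq_of_sq_eq (hX : IsAIR μ A X) {n : Fin N}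
    (h : sqMeanInterval μ X n = meanInterval μ X n ^ 2) (k : ℕ) :
    ∀ᵐ ω ∂μ, X n k ω = meanInterval μ X n := by
  have := hX.isProbabilityMeasure_map n
  set σ := μ.map (X n 0)
  set m := meanInterval μ X n with hm
  have hi1 : Integrable (fun x : ℝ => x) σ := (hX.memLp_map n).integrable (by norm_num)
  have hi2 : Integrable (fun x : ℝ => x ^ 2) σ := (hX.memLp_map n).integrable_sq
  have hi3 : Integrable (fun x : ℝ => x ^ 2 - 2 * m * x) σ := hi2.sub (hi1.const_mul (2 * m))
  have hexp : ∀ x : ℝ, (x - m) ^ 2 = x ^ 2 - 2 * m * x + m ^ 2 := fun x => by ring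
  have h0 : ∫ x, (x - m) ^ 2 ∂σ = 0 := by
    simp only [hexp]
    rw [integral_add hi3 (integrable_const _), integral_sub hi2 (hi1.const_mul (2 * m)),
      integral_const_mul]
    change sqMeanInterval μ X n - 2 * m * m + _ = 0
    rw [h]
    simp
    ring
  have hi : Integrable (fun x : ℝ => (x - m) ^ 2) σ := by
    simp only [hexp]
    exact hi3.add (integrable_const _)
  have h1 := (integral_eq_zero_iff_of_nonneg (fun x => sq_nonneg (x - m)) hi).1 h0
  have h2 : ∀ᵐ x ∂(μ.map (X n k)), x = m := by
    rw [(hX.identDistrib n k).map_eq]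
    filter_upwards [h1] with x hx
    exact sub_eq_zero.1 (pow_eq_zero_iff two_ne_zero |>.1 hx)
  exact ae_of_ae_map (hX.measurable n k).aemeasurable h2

/-- The time-average peak age of an AIR policy under which no queue is overloaded. -/
theorem IsAIR.hasTimeAvgPeakAge (hlam : ∀ n, 0 < lam n) (hA : IsPoissonArrivals μ lam A)
    (hX : IsAIR μ A X) (hload : ∀ n, meanInterval μ X n < 1 / lam n) :
    HasTimeAvgPeakAge μ A X
      (1 / (N : ℝ) * ∑ n, meanPeakAge (lam n) (meanInterval μ X n) (sqMeanInterval μ X n)) := by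
  have h := ae_all_iff.2 fun n => (hX.isQueue hA n).ae_tendsto_avgPeakAge (hlam n)
    (hX.ae_map_pos n) (hX.memLp_map n) (hX.meanInterval_pos n) (sub_pos.2 (hload n))
  filter_upwards [h] with ω hω
  exact (tendsto_finsetSum _ fun n _ => hω n).const_mul _

lemma IsAdmissible.meanInterval_lt (hlam : ∀ n, 0 < lam n) (hA : IsPoissonArrivals μ lam A)
    (hX : IsAdmissible μ A X) (n : Fin N) : meanInterval μ X n < 1 / lam n := by
  by_contra h
  have := hX.air.isProbabilityMeasure_map n
  exact (hX.stable n).ne ((hX.air.isQueue hA n).limsup_queueLength_eq_top (hlam n)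
    ((hX.air.ae_map_pos n).mono fun x hx => hx.le) (hX.air.memLp_map n) (not_lt.1 h))

/-- The conclusion is deterministic, so one sample path that satisfies both the strong law and the
channel constraint is enough. -/
lemma IsAdmissible.sum_inv_meanInterval_le (hX : IsAdmissible μ A X) : ∑ n, 1 / meanInterval μ X n ≤ 1 := by
  have h := ae_all_iff.2 fun n => ae_tendsto_average_of_law (hX.air.measurable n)
    (fun k => (hX.air.identDistrib n k).map_eq) (hX.air.indep n)
    (by
      have := hX.air.isProbabilityMeasure_map n
      exact (hX.air.memLp_map n).integrable (by norm_num))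
  obtain ⟨ω, h1, h2⟩ := (h.and hX.channel).exists
  exact sum_inv_le_one_of_limsup_le (X := fun n k => X n k ω)
    (fun n => hX.air.meanInterval_pos n) h1 h2

lemma isAIR_deterministicPolicy (hA : IsPoissonArrivals μ lam A) {β : Fin N → ℝ}
    (hβ : ∀ n, 0 < β n) : IsAIR μ A (deterministicPolicy β) where
  measurable _ _ := measurable_const
  pos n _ := Eventually.of_forall fun _ => one_div_pos.2 (hβ n)
  indep n := (isQueue_const (hA.measurable n) (hA.law n) (hA.indep_terminal n) _).indep_service
  identDistrib _ _ := IdentDistrib.refl aemeasurable_const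
  memLp_two _ := memLp_const _
  arrivalIndep := indepFun_const_left (fun p : Fin N × ℕ => 1 / β p.1) _

lemma isAdmissible_deterministicPolicy (hlam : ∀ n, 0 < lam n) (hA : IsPoissonArrivals μ lam A)
    {β : Fin N → ℝ} (hβ : β ∈ feasibleP2 lam) : IsAdmissible μ A (deterministicPolicy β) where
  air := isAIR_deterministicPolicy hA fun n => (hlam n).trans (hβ.1 n)
  channel := by
    have hβ0 : ∀ n, 0 < β n := fun n => (hlam n).trans (hβ.1 n)
    refine Eventually.of_forall fun ω => limsup_le_of_le (by isBoundedDefault) ?_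
    filter_upwards [eventually_gt_atTop 0] with T hT
    refine ENNReal.div_le_of_le_mul ?_
    rw [one_mul]
    refine (Finset.sum_le_sum fun n _ => numScheduled_const_le (hβ0 n) hT.le).trans ?_
    rw [← ENNReal.ofReal_sum_of_nonneg fun n _ => mul_nonneg (hβ0 n).le hT.le, ← Finset.sum_mul,
      hβ.2, one_mul]
  stable n := limsup_queueLength_const_lt_top (hlam n) (hA.measurable n) (hA.law n)
    (hA.indep_terminal n) (one_div_pos.2 ((hlam n).trans (hβ.1 n))).le
    (one_div_lt_one_div_of_lt (hlam n) (hβ.1 n))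

lemma hasTimeAvgPeakAge_deterministicPolicy (hlam : ∀ n, 0 < lam n)
    (hA : IsPoissonArrivals μ lam A) {β : Fin N → ℝ} (hβ : ∀ n, lam n < β n) :
    HasTimeAvgPeakAge μ A (deterministicPolicy β) (objectiveP2 lam β) := by
  have hlaw : ∀ n, μ.map (deterministicPolicy (Ω := Ω) β n 0) = Measure.dirac (1 / β n) := fun n => by
    change μ.map (fun _ => 1 / β n) = _
    rw [Measure.map_const, measure_univ, one_smul]
  have hm : ∀ n, meanInterval μ (deterministicPolicy β) n = 1 / β n := fun n => by
    rw [meanInterval, hlaw, integral_dirac]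
  have hs : ∀ n, sqMeanInterval μ (deterministicPolicy β) n = (1 / β n) ^ 2 := fun n => by
    rw [sqMeanInterval, hlaw, integral_dirac]
  have h := (isAIR_deterministicPolicy hA fun n => (hlam n).trans (hβ n)).hasTimeAvgPeakAge hlam hA
    fun n => by
      rw [hm]
      exact one_div_lt_one_div_of_lt (hlam n) (hβ n)
  simp only [hm, hs] at h
  rwa [Finset.sum_congr rfl fun n _ => meanPeakAge_sq (hlam n) (hβ n)] at h

end Policy

end PeakAoI

/-! ### The optimality theorem -/

theorem theorem4 {Ω : Type*} [MeasurableSpace Ω] (μ : Measure Ω) [IsProbabilityMeasure μ]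
    {N : ℕ} (hN : 0 < N) (lam : Fin N → ℝ) (hlam : ∀ n, 0 < lam n) (hsum : ∑ n, lam n < 1)
    (A : Fin N → ℕ → Ω → ℝ) (hA : PeakAoI.IsPoissonArrivals μ lam A) :
    -- P2 is a strictly convex problem
    Convex ℝ (PeakAoI.feasibleP2 lam) ∧
    StrictConvexOn ℝ {β : Fin N → ℝ | ∀ n, lam n < β n} (PeakAoI.objectiveP2 lam) ∧
    -- it has exactly one solution
    ∃ β : Fin N → ℝ, PeakAoI.SolvesP2 lam β ∧ (∀ β', PeakAoI.SolvesP2 lam β' → β' = β) ∧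
      -- the policy with deterministic intervals is admissible, with peak age the minimum of P2
      PeakAoI.IsAdmissible μ A (PeakAoI.deterministicPolicy β) ∧
      PeakAoI.HasTimeAvgPeakAge μ A (PeakAoI.deterministicPolicy β) (PeakAoI.objectiveP2 lam β) ∧
      -- every admissible policy does at least as badly, with equality only for the same intervals
      ∀ X : Fin N → ℕ → Ω → ℝ, PeakAoI.IsAdmissible μ A X →
        ∃ ℓ : ℝ, PeakAoI.HasTimeAvgPeakAge μ A X ℓ ∧ PeakAoI.objectiveP2 lam β ≤ ℓ ∧
          (ℓ = PeakAoI.objectiveP2 lam β → ∀ n k, ∀ᵐ ω ∂μ, X n k ω = 1 / β n) := by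
  obtain ⟨β, hβ⟩ := PeakAoI.exists_solvesP2 hN hlam hsum
  refine ⟨PeakAoI.convex_feasibleP2 lam, PeakAoI.strictConvexOn_objectiveP2 hN hlam, β, hβ,
    fun β' hβ' => hβ.eq hN hlam hβ', PeakAoI.isAdmissible_deterministicPolicy hlam hA hβ.1,
    PeakAoI.hasTimeAvgPeakAge_deterministicPolicy hlam hA hβ.1.1, fun X hX => ?_⟩
  have hN' : (0 : ℝ) < 1 / N := by positivity
  have hload := hX.meanInterval_lt hlam hA
  have hm := hX.air.meanInterval_pos
  set m := PeakAoI.meanInterval μ X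
  set s := PeakAoI.sqMeanInterval μ X
  set γ : Fin N → ℝ := fun n => 1 / m n with hγdef
  have hγ : ∀ n, lam n < γ n := fun n => (lt_one_div (hm n) (hlam n)).1 (hload n)
  have hγm : ∀ n, 1 / γ n = m n := fun n => one_div_one_div _
  -- At a fixed mean interval the cost increases with the second moment, which is least for a
  -- constant interval.
  have hmono : ∀ n, 1 / lam n + 1 / 2 * (1 / (γ n - lam n) + 1 / γ n)
      ≤ PeakAoI.meanPeakAge (lam n) (m n) (s n) := by
    intro n
    rw [← PeakAoI.meanPeakAge_sq (hlam n) (hγ n), hγm]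
    have h1 := div_le_div_of_nonneg_right (hX.air.sq_meanInterval_le n)
      (show 0 ≤ 2 * (1 / lam n - m n) by linarith [hload n])
    simp only [PeakAoI.meanPeakAge]
    linarith
  have hobj : PeakAoI.objectiveP2 lam γ
      ≤ 1 / (N : ℝ) * ∑ n, PeakAoI.meanPeakAge (lam n) (m n) (s n) :=
    mul_le_mul_of_nonneg_left (Finset.sum_le_sum fun n _ => hmono n) hN'.le
  obtain ⟨hle, heq⟩ := hβ.le_of_sum_le hN hlam hγ hX.sum_inv_meanInterval_le
  refine ⟨_, hX.air.hasTimeAvgPeakAge hlam hA hload, hle.trans hobj, fun hℓ n k => ?_⟩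
  -- Equality of the extremes forces equality in both steps: the rates solve P2, and every terminal
  -- attains its second moment bound.
  have hγβ : γ = β := heq (le_antisymm (hobj.trans hℓ.le) hle)
  have hsumeq : ∑ n, (1 / lam n + 1 / 2 * (1 / (γ n - lam n) + 1 / γ n))
      = ∑ n, PeakAoI.meanPeakAge (lam n) (m n) (s n) := by
    have h1 : PeakAoI.objectiveP2 lam γ
        = 1 / (N : ℝ) * ∑ n, PeakAoI.meanPeakAge (lam n) (m n) (s n) := by
      rw [hγβ]
      exact hℓ.symm
    exact mul_left_cancel₀ hN'.ne' h1
  have hterm := (Finset.sum_eq_sum_iff_of_le fun n _ => hmono n).1 hsumeq n (Finset.mem_univ n)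
  have hsq : s n = m n ^ 2 := by
    rw [← PeakAoI.meanPeakAge_sq (hlam n) (hγ n), hγm] at hterm
    have h1 : m n ^ 2 / (2 * (1 / lam n - m n)) = s n / (2 * (1 / lam n - m n)) := by
      simp only [PeakAoI.meanPeakAge] at hterm
      linarith
    have h2 : 2 * (1 / lam n - m n) ≠ 0 := by
      have := sub_pos.2 (hload n)
      positivity
    exact ((div_left_inj' h2).1 h1).symm
  rw [← hγβ, hγm]
  exact hX.air.ae_eq_of_sq_eq hsq k
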